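/- **Setting.** For $r\ge 1$ let $L_{r}(u)=\sum_{k=0}^{r}(-1)^{r-k}\binom rk\binom{r+k}{k}u^k$ be the shifted Legendre polynomial and, for $r\ge2$, $K_r(t)=\int_0^tL_{r-1}(u)\,du$. Let $\ell\ge 2$ and $K=(K_2,\dots,K_\ell)$. Let $\varphi:\mathbb R\to[0,\infty]$ be convex, strictly convex on its domain, finite near $1$, with $\varphi(1)=0$, and suppose that its Fenchel–Legendre transform $\psi(t)=\sup_x\{tx-\varphi(x)\}$ is finite on $\mathbb R$ and $\mathcal C^2$, with $\psi''(0)=1$ (then $\psi(0)=0$ and $\psi'(0)=1$). Let $\Theta\subset\mathbb R^d$, $\mathcal A\subset\mathbb R^s$, let $P_1(\cdot|\theta)$, $\theta\in\Theta$, be probability measures on $\mathbb R$ with finite first moment and cdf $\mathbb F_1(\cdot|\theta)$, let $m$ be a map with values in $\mathbb R^{\ell-1}$ defined on $\mathcal A$, and let $\Phi$ be a set of parameters $\phi=(\lambda,\theta,\alpha)\in(0,1)\times\Theta\times\mathcal A$. Let $\phi^*=(\lambda^*,\theta^*,\alpha^*)\in\Phi$ and let $$P_T=\lambda^*P_1(\cdot|\theta^*)+(1-\lambda^*)P_0^*$$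 with cdf $\mathbb F_T$, where $P_0^*$ is a probability measure whose quantile measure $\mathbf F_0^{*-1}$ (the Lebesgue–Stieltjes measure on $(0,1)$ of its quantile function) belongs to $$\mathcal M_{\alpha^*}=\Big\{\mathbf Q\ \sigma\text{-finite on }(0,1):\ \mathbf Q\ll\mathbf F_0^{*-1},\ \int_0^1K(u)\,\mathbf Q(du)=m(\alpha^*)\Big\}.$$ Let $X_1,X_2,\dots$ be i.i.d. with law $P_T$, let $\mathbb F_n$ be the empirical cdf of $X_1,\dots,X_n$, and put $$\mathbb F_0(y|\phi)=\tfrac1{1-\lambda}\mathbb F_T(y)-\tfrac{\lambda}{1-\lambda}\mathbb F_1(y|\theta),\qquad \hat{\mathbb F}_0(y|\phi)=\tfrac1{1-\lambda}\mathbb F_n(y)-\tfrac{\lambda}{1-\lambda}\mathbb F_1(y|\theta),$$ $$H_n(\phi,\xi)=\xi^tm(\alpha)-\int_{\mathbb R}\psi\big(\xi^tK(\hat{\mathbb F}_0(y|\phi))\big)dy .$$ Let $\hat\phi=\hat\phi_n$ and $\xi_n(\hat\phi)$ be measurable functions of $\omega$ such that, with probability tending to one, $$\hat\phi\in\operatorname*{arg\,inf}_{\phi\in\Phi}\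 \sup_{\xi\in\mathbb R^{\ell-1}}H_n(\phi,\xi),\qquad \xi_n(\hat\phi)\in\operatorname*{arg\,sup}_{\xi\in\mathbb R^{\ell-1}}H_n(\hat\phi,\xi).$$ **Matrices.** With $\nabla m(\alpha^*)$ the Jacobian matrix of $m$, let $J_{\phi^*,\xi^*}$ be the $(\ell-1)\times(1+d+s)$ matrix with the blocks of columns $$-\tfrac1{(1-\lambda^*)^2}\int[\mathbb F_T(y)-\mathbb F_1(y|\theta^*)]K'(\mathbb F_0(y|\phi^*))dy,\quad \tfrac{\lambda^*}{1-\lambda^*}\int K'(\mathbb F_0(y|\phi^*))\nabla_\theta\mathbb F_1(y|\theta^*)^tdy,\quad \nabla m(\alpha^*),$$ and let $$J_{\xi^*,\xi^*}=\int K(\mathbb F_0(y|\phi^*))K(\mathbb F_0(y|\phi^*))^tdy,\qquad \tilde\Sigma=\big(J_{\phi^*,\xi^*}^tJ_{\xi^*,\xi^*}^{-1}J_{\phi^*,\xi^*}\big)^{-1},$$ $$H=\tilde\Sigma J_{\phi^*,\xi^*}^tJ_{\xi^*,\xi^*}^{-1},\qquad P=J_{\xi^*,\xi^*}^{-1}-J_{\xi^*,\xi^*}^{-1}J_{\phi^*,\xi^*}\tilde\Sigma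 J_{\phi^*,\xi^*}^tJ_{\xi^*,\xi^*}^{-1},$$ $$\Sigma_{r_1,r_2}=\frac1{(1-\lambda^*)^2}\int\!\!\int\big(\mathbb F_T(\min(x,y))-\mathbb F_T(x)\mathbb F_T(y)\big)L_{r_1-1}(\mathbb F_0(x|\phi^*))L_{r_2-1}(\mathbb F_0(y|\phi^*))\,dy\,dx,\quad 2\le r_1,r_2\le\ell.$$ **Theorem.** Suppose that $\mathbb E|X_i|<\infty$, $\int\sqrt{\mathbb F_T(1-\mathbb F_T)}\,dy<\infty$ and $\iint[\mathbb F_T(\min(x,y))-\mathbb F_T(x)\mathbb F_T(y)]\,dx\,dy<\infty$. Suppose also that 1. $(\hat\phi,\xi_n(\hat\phi))\to(\phi^*,0)$ in probability; 2. $\phi^*\in\operatorname{int}(\Phi)$; 3. $\alpha\mapsto m(\alpha)$ is of class $\mathcal C^2$ on $\mathcal A$; 4. for $\theta$ in a neighbourhood of $\theta^*$ and all $y$, $\theta\mapsto\mathbb F_1(y|\theta)$ is twice differentiable, and there is an integrable $B_1$ with $\|\nabla_\theta\mathbb F_1(y|\theta)\|\le B_1(y)$ for all $y$ and all such $\theta$;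 5. there are integrable $B_{2,1},B_{2,2}$ with $\|\nabla_\theta\mathbb F_1(y|\theta)\nabla_\theta\mathbb F_1(y|\theta)^t\|\le B_{2,2}(y)$ and $\|J_{\mathbb F_1(y|\theta)}\|\le B_{2,1}(y)$ for all $y$ and all $\theta$ in a neighbourhood of $\theta^*$, where $J_{\mathbb F_1(y|\theta)}$ is the matrix of second derivatives in $\theta$; 6. $y\mapsto\mathbb F_T(y)-\mathbb F_1(y|\theta^*)$ is integrable; 7. the matrices $J_{\xi^*,\xi^*}$ and $J_{\phi^*,\xi^*}^tJ_{\xi^*,\xi^*}^{-1}J_{\phi^*,\xi^*}$ are invertible. Then $$\begin{pmatrix}\sqrt n(\hat\phi-\phi^*)\\ \sqrt n\,\xi_n(\hat\phi)\end{pmatrix}\xrightarrow{\ \mathcal L\ }\mathcal N\left(0,\begin{pmatrix}-H\\P\end{pmatrix}\Sigma\begin{pmatrix}-H^t&P^t\end{pmatrix}\right).$$ -/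

import Mathlib

open MeasureTheory ProbabilityTheory Filter Topology
open scoped ENNReal NNReal Matrix

noncomputable section

namespace LMomentMixture

/-! ### Shifted Legendre polynomials and L-moment constraints -/

/-- The shifted Legendre polynomial `L_r` on `[0, 1]`. -/
def shiftedLegendre (r : ℕ) (u : ℝ) : ℝ :=
  ∑ k ∈ Finset.range (r + 1), (-1 : ℝ) ^ (r - k) * (r.choose k) * ((r + k).choose k) * u ^ k

/-- The integrated shifted Legendre polynomial `K_r (t) = ∫₀ᵗ L_{r-1}(u) du` (used for `r ≥ 2`). -/
def integratedLegendre (r : ℕ) (t : ℝ) : ℝ :=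
  ∫ u in (0 : ℝ)..t, shiftedLegendre (r - 1) u

/-- The vector `K = (K_2, …, K_ℓ)`; the coordinate with index `i` is `K_{i+2}`. -/
def vecK (ℓ : ℕ) (t : ℝ) : EuclideanSpace ℝ (Fin (ℓ - 1)) :=
  WithLp.toLp 2 fun i => integratedLegendre (i + 2) t

/-- The quantile function `u ↦ inf {x | u ≤ F(x)}`, `u ∈ (0, 1)`, of a law on the real line. -/
def quantile (P : Measure ℝ) (u : Set.Ioo (0 : ℝ) 1) : ℝ :=
  sInf {x : ℝ | (u : ℝ) ≤ cdf P x}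

theorem quantile_mono (P : Measure ℝ) : Monotone (quantile P) := by
  intro u v huv
  refine csInf_le_csInf ?_ ?_ ?_
  · obtain ⟨x, hx⟩ := ((tendsto_cdf_atBot P).eventually (gt_mem_nhds u.2.1)).exists
    refine ⟨x, fun y hy => ?_⟩
    by_contra! h
    exact absurd (hy.trans (monotone_cdf P h.le)) (not_le.mpr hx)
  · obtain ⟨x, hx⟩ := ((tendsto_cdf_atTop P).eventually (lt_mem_nhds v.2.2)).exists
    exact ⟨x, hx.le⟩
  · intro x hx
    exact le_trans (Subtype.coe_le_coe.mpr huv) hx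

instance compactIccSpace_Ioo : CompactIccSpace (Set.Ioo (0 : ℝ) 1) where
  isCompact_Icc := by
    intro a b
    rw [Subtype.isCompact_iff]
    have h : (Subtype.val '' Set.Icc a b : Set ℝ) = Set.Icc (a : ℝ) b := by
      ext x
      constructor
      · rintro ⟨y, hy, rfl⟩
        exact ⟨hy.1, hy.2⟩
      · intro hx
        exact ⟨⟨x, a.2.1.trans_le hx.1, hx.2.trans_lt b.2.2⟩, ⟨hx.1, hx.2⟩, rfl⟩
    rw [h]
    exact isCompact_Icc

/-- The quantile measure: the Lebesgue-Stieltjes measure on `(0, 1)` of the quantile function. -/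
def quantileMeasure (P : Measure ℝ) : Measure (Set.Ioo (0 : ℝ) 1) :=
  (quantile_mono P).stieltjesFunction.measure

/-- The set `M_α`, for the value `c = m(α)` of the constraints: the σ-finite measures on `(0, 1)`
which are absolutely continuous with respect to `F₀inv` and satisfy `∫ K(u) Q(du) = c`. -/
def constraintSet (ℓ : ℕ) (c : EuclideanSpace ℝ (Fin (ℓ - 1)))
    (F₀inv : Measure (Set.Ioo (0 : ℝ) 1)) : Set (Measure (Set.Ioo (0 : ℝ) 1)) :=
  {Q | SigmaFinite Q ∧ Q ≪ F₀inv ∧ Integrable (fun u : Set.Ioo (0 : ℝ) 1 => vecK ℓ u) Q ∧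
    ∫ u : Set.Ioo (0 : ℝ) 1, vecK ℓ u ∂Q = c}

/-! ### Divergence generators -/

/-- A strictly convex generator `φ : ℝ → [0, ∞]` with `φ(1) = 0`, finite in a neighbourhood
of `1`. -/
structure IsDivergenceGenerator (φ : ℝ → ℝ≥0∞) : Prop where
  strictConvexOn : StrictConvexOn ℝ≥0 {x | φ x ≠ ∞} φ
  convexOn : ConvexOn ℝ≥0 Set.univ φ
  apply_one : φ 1 = 0
  finite_near_one : ∀ᶠ x in 𝓝 (1 : ℝ), φ x ≠ ∞

/-- The Fenchel-Legendre transform `t ↦ sup_x (t x - φ(x))`. -/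
def fenchelLegendre (φ : ℝ → ℝ≥0∞) (t : ℝ) : EReal :=
  ⨆ x : ℝ, (((t * x : ℝ) : EReal) - (φ x : EReal))

/-! ### Parameters and the criterion -/

/-- Indices of the parameter vector `(λ, θ, α) ∈ ℝ × ℝ^d × ℝ^s`. -/
abbrev ParamIdx (d s : ℕ) : Type := Fin 1 ⊕ (Fin d ⊕ Fin s)

/-- The space of parameter vectors `(λ, θ, α)`. -/
abbrev Param (d s : ℕ) : Type := EuclideanSpace ℝ (ParamIdx d s)

/-- The proportion `λ`. -/
def Param.lam {d s : ℕ} (p : Param d s) : ℝ := p (Sum.inl 0)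

/-- The parameter `θ` of the parametric component. -/
def Param.theta {d s : ℕ} (p : Param d s) : EuclideanSpace ℝ (Fin d) :=
  WithLp.toLp 2 fun i => p (Sum.inr (Sum.inl i))

/-- The parameter `α` of the constraints. -/
def Param.alpha {d s : ℕ} (p : Param d s) : EuclideanSpace ℝ (Fin s) :=
  WithLp.toLp 2 fun i => p (Sum.inr (Sum.inr i))

/-- The function `F / (1 - λ) - λ F₁(· | θ) / (1 - λ)`, for a function `F` in the place of the
cdf of the mixture. -/
def F0 {d s : ℕ} (P₁ : EuclideanSpace ℝ (Fin d) → Measure ℝ) (F : ℝ → ℝ) (p : Param d s)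
    (y : ℝ) : ℝ :=
  1 / (1 - p.lam) * F y - p.lam / (1 - p.lam) * cdf (P₁ p.theta) y

/-- The empirical cdf of the first `n` observations. -/
def empiricalCdf {Ω : Type*} (X : ℕ → Ω → ℝ) (n : ℕ) (ω : Ω) (y : ℝ) : ℝ :=
  (∑ i ∈ Finset.range n, Set.indicator (Set.Iic y) (fun _ => (1 : ℝ)) (X i ω)) / n

/-- The criterion `ξᵗ m(α) - ∫ ψ(ξᵗ K(F / (1 - λ) - λ F₁(· | θ) / (1 - λ))) dy`. -/
def criterion {d s ℓ : ℕ} (ψ : ℝ → ℝ) (P₁ : EuclideanSpace ℝ (Fin d) → Measure ℝ)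
    (m : EuclideanSpace ℝ (Fin s) → EuclideanSpace ℝ (Fin (ℓ - 1))) (F : ℝ → ℝ)
    (p : Param d s) (ξ : EuclideanSpace ℝ (Fin (ℓ - 1))) : ℝ :=
  inner ℝ ξ (m p.alpha) - ∫ y : ℝ, ψ (inner ℝ ξ (vecK ℓ (F0 P₁ F p y)))

/-- `p` is an arginf over `Φ` of `p ↦ sup_ξ criterion(p, ξ)` (the supremum is taken in the
extended reals), and `ξ` is an argsup of `criterion(p, ·)` over the whole space. -/
def IsEstimate {d s ℓ : ℕ} (Φ : Set (Param d s)) (ψ : ℝ → ℝ)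
    (P₁ : EuclideanSpace ℝ (Fin d) → Measure ℝ)
    (m : EuclideanSpace ℝ (Fin s) → EuclideanSpace ℝ (Fin (ℓ - 1))) (F : ℝ → ℝ)
    (p : Param d s) (ξ : EuclideanSpace ℝ (Fin (ℓ - 1))) : Prop :=
  p ∈ Φ ∧
  IsMinOn (fun q => ⨆ ζ, ((criterion ψ P₁ m F q ζ : ℝ) : EReal)) Φ p ∧
  IsMaxOn (criterion ψ P₁ m F p) Set.univ ξ

/-! ### The matrices of the limit law -/

section Matrices

variable {d s ℓ : ℕ} (P₁ : EuclideanSpace ℝ (Fin d) → Measure ℝ)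
  (m : EuclideanSpace ℝ (Fin s) → EuclideanSpace ℝ (Fin (ℓ - 1))) (FT : ℝ → ℝ) (p : Param d s)

/-- `J_{φ,ξ}`, with columns indexed by the coordinates of `(λ, θ, α)`. -/
def matJphixi : Matrix (Fin (ℓ - 1)) (ParamIdx d s) ℝ :=
  Matrix.of fun i => Sum.elim
    (fun _ => -∫ y : ℝ, (1 / (1 - p.lam) ^ 2 * FT y
        - 1 / (1 - p.lam) ^ 2 * cdf (P₁ p.theta) y) *
      deriv (integratedLegendre (i + 2)) (F0 P₁ FT p y))
    (Sum.elim
      (fun j => p.lam / (1 - p.lam) * ∫ y : ℝ,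
        (gradient (fun θ => cdf (P₁ θ) y) p.theta) j *
          deriv (integratedLegendre (i + 2)) (F0 P₁ FT p y))
      (fun k => (fderiv ℝ m p.alpha (EuclideanSpace.single k 1)) i))

/-- `J_{ξ,ξ} = ∫ K(F₀) K(F₀)ᵗ dy`. -/
def matJxixi (ℓ : ℕ) : Matrix (Fin (ℓ - 1)) (Fin (ℓ - 1)) ℝ :=
  Matrix.of fun i j => ∫ y : ℝ, integratedLegendre (i + 2) (F0 P₁ FT p y) *
    integratedLegendre (j + 2) (F0 P₁ FT p y)

/-- `Jᵗ J_{ξ,ξ}⁻¹ J`, the inverse of `Σ̃`. -/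
def matInfo : Matrix (ParamIdx d s) (ParamIdx d s) ℝ :=
  (matJphixi P₁ m FT p)ᵀ * (matJxixi P₁ FT p ℓ)⁻¹ * matJphixi P₁ m FT p

/-- `Σ̃ = (Jᵗ J_{ξ,ξ}⁻¹ J)⁻¹`. -/
def matSigmaTilde : Matrix (ParamIdx d s) (ParamIdx d s) ℝ := (matInfo P₁ m FT p)⁻¹

/-- `H = Σ̃ Jᵗ J_{ξ,ξ}⁻¹`. -/
def matH : Matrix (ParamIdx d s) (Fin (ℓ - 1)) ℝ :=
  matSigmaTilde P₁ m FT p * (matJphixi P₁ m FT p)ᵀ * (matJxixi P₁ FT p ℓ)⁻¹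

/-- `P = J_{ξ,ξ}⁻¹ - J_{ξ,ξ}⁻¹ J Σ̃ Jᵗ J_{ξ,ξ}⁻¹`. -/
def matP : Matrix (Fin (ℓ - 1)) (Fin (ℓ - 1)) ℝ :=
  (matJxixi P₁ FT p ℓ)⁻¹ - (matJxixi P₁ FT p ℓ)⁻¹ * matJphixi P₁ m FT p *
    matSigmaTilde P₁ m FT p * (matJphixi P₁ m FT p)ᵀ * (matJxixi P₁ FT p ℓ)⁻¹

/-- The limiting covariance matrix of `√n (∫ K(F̂₀) dy - ∫ K(F₀) dy)`; the polynomial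
`∑ₖ c_{r,k} uᵏ` is the shifted Legendre polynomial `L_{r-1}`. -/
def matSigma (ℓ : ℕ) : Matrix (Fin (ℓ - 1)) (Fin (ℓ - 1)) ℝ :=
  Matrix.of fun i j => 1 / (1 - p.lam) ^ 2 *
    ∫ x : ℝ, ∫ y : ℝ, (FT (min x y) - FT x * FT y) *
      shiftedLegendre (i + 1) (F0 P₁ FT p x) * shiftedLegendre (j + 1) (F0 P₁ FT p y)

/-- The covariance matrix `(-H; P) Σ (-Hᵗ Pᵗ)` of the limit law. -/
def asymptoticCov : Matrix (ParamIdx d s ⊕ Fin (ℓ - 1)) (ParamIdx d s ⊕ Fin (ℓ - 1)) ℝ :=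
  Matrix.fromRows (-matH P₁ m FT p) (matP P₁ m FT p) * matSigma P₁ FT p ℓ *
    (Matrix.fromRows (-matH P₁ m FT p) (matP P₁ m FT p))ᵀ

end Matrices

end LMomentMixture

end

/-!
The argument has a deterministic part and a probabilistic part, joined by the vector
`Z(F) = ∫ K (F₀(y | φ*)) dy - m(α*)`, in which `F` takes the place of the cdf of the mixture in `F₀`.

*Deterministic part.* Suppose that `F` is close to `F_T` in `L¹`. The constraint functional
`φ ↦ m(α) - ∫ K (F₀(y | φ)) dy` is then strictly differentiable at `φ*`, with derivative `J`,
uniformly in `F` (`exists_isRegularNear`), and `ξ ↦ criterion(φ, ξ)` is concave, and strongly concave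
near the origin because the Gram matrix `S = J_{ξ,ξ}` is invertible. The first-order condition in `ξ`
reads `J (φ̂ - φ*) - Z(F) ≈ S ξ̂`. Minimality in `φ` is used without differentiating the profile
`φ ↦ sup_ξ criterion(φ, ξ)`: comparing the value at `φ̂` with the value at the nearby parameter
`φ̂ + t v`, whose supremum is again attained close to `ξ̂` by strong concavity, gives `Jᵗ ξ̂ ≈ 0`
(`abs_inner_le_of_minimax`). Both errors are small relative to `‖φ̂ - φ*‖ + ‖ξ̂‖`
(`exists_estimating_equations`), so the invertible linear system can be solved:
`φ̂ - φ* = H Z(F) + o(‖Z(F)‖)` and `ξ̂ = -P Z(F) + o(‖Z(F)‖)` (`exists_asymptotic_linearity`).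

*Probabilistic part.* `Z(F_T) = 0`, because `F₀(· | φ*)` is the cdf of the second component and the
quantile measure is the image of Lebesgue measure under that cdf (`quantileMeasure_eq_map`). A Taylor
expansion gives `Z(F) = (1 - λ*)⁻¹ ∫ (F - F_T) L(F₀) dy + O(∫ (F - F_T)²)`. For the empirical cdf the
`L¹` distance to `F_T` has mean of order `n ^ (-1/2)` and the quadratic term has mean of order `1 / n`,
both controlled by `∫ √(F_T (1 - F_T))`. The linear term is a mean of independent, centred,
square-integrable vectors, whose covariance matrix is `Σ` by Fubini's theorem
(`integral_influence_mul`); the multivariate central limit theorem follows from the real one by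
characteristic functions (`tendstoInDistribution_inv_sqrt_smul_sum`). The remainders vanish in
probability by Markov's inequality, which yields the limit law of `√n (φ̂ - φ*, ξ̂)`. Its linear map
`(H; -P)` and the map `(-H; P)` of the statement give the same covariance matrix.
-/

namespace LMomentMixture

/-! ### The Fenchel-Legendre transform near the origin -/

section Transform

variable {φ : ℝ → ℝ≥0∞} {ψ : ℝ → ℝ}

theorem sub_le_of_fenchelLegendre (hψ : ∀ t, fenchelLegendre φ t = (ψ t : EReal)) {x : ℝ}
    (hx : φ x ≠ ∞) (t : ℝ) : t * x - (φ x).toReal ≤ ψ t := by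
  have h : ((t * x : ℝ) : EReal) - (φ x : EReal) ≤ ψ t := by
    rw [← hψ t]
    exact le_iSup (fun x : ℝ => ((t * x : ℝ) : EReal) - (φ x : EReal)) x
  lift φ x to ℝ≥0 using hx with r hr
  have h2 : ((r : ℝ≥0∞) : EReal) = ((r : ℝ) : EReal) := rfl
  rw [h2, ← EReal.coe_sub, EReal.coe_le_coe_iff] at h
  simpa using h

theorem le_of_fenchelLegendre (hψ : ∀ t, fenchelLegendre φ t = (ψ t : EReal)) {t c : ℝ}
    (h : ∀ x, φ x ≠ ∞ → t * x - (φ x).toReal ≤ c) : ψ t ≤ c := by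
  rw [← EReal.coe_le_coe_iff, ← hψ t]
  refine iSup_le fun x => ?_
  by_cases hx : φ x = ∞
  · simp [hx]
  · have := h x hx
    lift φ x to ℝ≥0 using hx with r hr
    have h2 : ((r : ℝ≥0∞) : EReal) = ((r : ℝ) : EReal) := rfl
    rw [h2, ← EReal.coe_sub, EReal.coe_le_coe_iff]
    simpa using this

theorem convexOn_of_fenchelLegendre (hψ : ∀ t, fenchelLegendre φ t = (ψ t : EReal)) :
    ConvexOn ℝ Set.univ ψ := by
  refine ⟨convex_univ, fun a _ b _ u v hu hv huv => le_of_fenchelLegendre hψ fun x hx => ?_⟩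
  have h1 := mul_le_mul_of_nonneg_left (sub_le_of_fenchelLegendre hψ hx a) hu
  have h2 := mul_le_mul_of_nonneg_left (sub_le_of_fenchelLegendre hψ hx b) hv
  simp only [smul_eq_mul]
  have : (φ x).toReal = u * (φ x).toReal + v * (φ x).toReal := by rw [← add_mul, huv, one_mul]
  nlinarith

theorem apply_zero_of_fenchelLegendre (h1 : φ 1 = 0)
    (hψ : ∀ t, fenchelLegendre φ t = (ψ t : EReal)) : ψ 0 = 0 := by
  apply le_antisymm
  · exact le_of_fenchelLegendre hψ fun x _ => by simp
  · simpa [h1] using sub_le_of_fenchelLegendre hψ (x := 1) (by simp [h1]) 0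

/-- Since `φ 1 = 0`, the line `t ↦ t` supports the graph of `ψ` at the origin. -/
theorem deriv_zero_of_fenchelLegendre (h1 : φ 1 = 0)
    (hψ : ∀ t, fenchelLegendre φ t = (ψ t : EReal)) (hd : Differentiable ℝ ψ) :
    deriv ψ 0 = 1 := by
  have hmin : IsLocalMin (fun t => ψ t - t) 0 := by
    refine Filter.Eventually.of_forall fun t => ?_
    have := sub_le_of_fenchelLegendre hψ (x := 1) (by simp [h1]) t
    simp only [apply_zero_of_fenchelLegendre h1 hψ]
    simp only [h1, ENNReal.toReal_zero] at this
    linarith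
  have h := hmin.deriv_eq_zero
  rw [deriv_fun_sub (hd 0) differentiableAt_fun_id, deriv_id''] at h
  linarith

theorem deriv_sub_isLittleO (hC2 : ContDiff ℝ 2 ψ) (h1 : deriv ψ 0 = 1)
    (h2 : iteratedDeriv 2 ψ 0 = 1) {ε : ℝ} (hε : 0 < ε) :
    ∃ τ > 0, ∀ t, |t| ≤ τ → |deriv ψ t - 1 - t| ≤ ε * |t| := by
  have hd : HasDerivAt (deriv ψ) 1 0 := by
    have : ContDiff ℝ 1 (deriv ψ) := ((contDiff_succ_iff_deriv (n := 1)).1 hC2).2.2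
    have h3 := (this.differentiable one_ne_zero 0).hasDerivAt
    rw [iteratedDeriv_succ, iteratedDeriv_one] at h2
    rwa [h2] at h3
  have := (hasDerivAt_iff_isLittleO.1 hd).def hε
  obtain ⟨τ, hτ, h⟩ := Metric.eventually_nhds_iff.1 this
  refine ⟨τ / 2, by positivity, fun t ht => ?_⟩
  have := @h t (by rw [Real.dist_eq, sub_zero]; linarith)
  simpa [h1] using this

theorem abs_sub_sub_le_near_zero (hC2 : ContDiff ℝ 2 ψ) (h1 : deriv ψ 0 = 1)
    {ε : ℝ} (hε : 0 < ε) :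
    ∃ τ > 0, ∀ a b, |a| ≤ τ → |b| ≤ τ → |ψ b - ψ a - (b - a)| ≤ ε * |b - a| := by
  have hc : Continuous (deriv ψ) := hC2.continuous_deriv (by norm_num)
  obtain ⟨τ, hτ, h⟩ := Metric.continuous_iff.1 hc 0 ε hε
  refine ⟨τ / 2, by positivity, fun a b ha hb => ?_⟩
  have := (convex_Icc (-(τ / 2)) (τ / 2)).norm_image_sub_le_of_norm_hasDerivWithin_le
    (f := fun t => ψ t - t) (f' := fun t => deriv ψ t - 1) (C := ε) (x := a) (y := b)
    (fun x _ => (((hC2.differentiable (by norm_num)) x).hasDerivAt.sub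
      (hasDerivAt_id x)).hasDerivWithinAt) (fun x hx => ?_) (abs_le.1 ha) (abs_le.1 hb)
  · simp only [Real.norm_eq_abs] at this
    convert this using 2
    ring
  · have := h x (by rw [Real.dist_eq, sub_zero]; have := abs_le.2 hx; linarith)
    rw [h1, Real.dist_eq] at this
    exact this.le

/-- Strong convexity of `ψ` near the origin, in midpoint form. -/
theorem midpoint_strongConvex_near_zero (hC2 : ContDiff ℝ 2 ψ)
    (h2 : iteratedDeriv 2 ψ 0 = 1) :
    ∃ τ > 0, ∀ a b, |a| ≤ τ → |b| ≤ τ →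
      ψ ((a + b) / 2) ≤ (ψ a + ψ b) / 2 - (b - a) ^ 2 / 16 := by
  have hc : Continuous (iteratedDeriv 2 ψ) := hC2.continuous_iteratedDeriv 2 (by norm_num)
  obtain ⟨τ, hτ, h⟩ := Metric.continuous_iff.1 hc 0 (1 / 2) (by norm_num)
  have hC1 : ContDiff ℝ 1 (deriv ψ) := ((contDiff_succ_iff_deriv (n := 1)).1 hC2).2.2
  have hd : ∀ x, HasDerivAt (fun t => ψ t - t ^ 2 / 4) (deriv ψ x - x / 2) x := fun x => by
    refine (((hC2.differentiable (by norm_num)) x).hasDerivAt.sub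
      ((hasDerivAt_pow 2 x).div_const 4)).congr_deriv ?_
    simp; ring
  have hd2 : ∀ x, HasDerivAt (fun x => deriv ψ x - x / 2) (iteratedDeriv 2 ψ x - 1 / 2) x :=
    fun x => by
      rw [iteratedDeriv_succ, iteratedDeriv_one]
      exact ((hC1.differentiable one_ne_zero) x).hasDerivAt.sub ((hasDerivAt_id x).div_const 2)
  have hconv : ConvexOn ℝ (Set.Icc (-(τ / 2)) (τ / 2)) (fun t => ψ t - t ^ 2 / 4) := by
    refine convexOn_of_hasDerivWithinAt2_nonneg (convex_Icc _ _)
      (fun x _ => (hd x).continuousAt.continuousWithinAt)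
      (fun x _ => (hd x).hasDerivWithinAt) (fun x _ => (hd2 x).hasDerivWithinAt) (fun x hx => ?_)
    rw [interior_Icc] at hx
    have := h x (by rw [Real.dist_eq, sub_zero, abs_lt]; constructor <;> linarith [hx.1, hx.2])
    rw [h2, Real.dist_eq, abs_lt] at this
    linarith [this.1]
  refine ⟨τ / 2, by positivity, fun a b ha hb => ?_⟩
  have := hconv.2 (abs_le.1 ha) (abs_le.1 hb) (show (0 : ℝ) ≤ 1 / 2 by norm_num)
    (show (0 : ℝ) ≤ 1 / 2 by norm_num) (by norm_num)
  simp only [smul_eq_mul] at this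
  rw [show 1 / 2 * a + 1 / 2 * b = (a + b) / 2 by ring] at this
  nlinarith

end Transform

/-! ### The vector of integrated Legendre polynomials -/

theorem continuous_shiftedLegendre (r : ℕ) : Continuous (shiftedLegendre r) := by
  unfold shiftedLegendre
  fun_prop

theorem hasDerivAt_integratedLegendre (r : ℕ) (t : ℝ) :
    HasDerivAt (integratedLegendre r) (shiftedLegendre (r - 1) t) t :=
  intervalIntegral.integral_hasDerivAt_right
    ((continuous_shiftedLegendre _).intervalIntegrable _ _)
    (continuous_shiftedLegendre _).stronglyMeasurable.stronglyMeasurableAtFilter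
    (continuous_shiftedLegendre _).continuousAt

/-- The vector `(L_1, …, L_{ℓ-1})` of shifted Legendre polynomials, the derivative of `vecK`. -/
noncomputable def vecL (ℓ : ℕ) (t : ℝ) : EuclideanSpace ℝ (Fin (ℓ - 1)) :=
  WithLp.toLp 2 fun i => shiftedLegendre (i + 1) t

theorem hasDerivAt_vecK (ℓ : ℕ) (t : ℝ) : HasDerivAt (vecK ℓ) (vecL ℓ t) t := by
  exact (PiLp.continuousLinearEquiv 2 ℝ
    (fun _ : Fin (ℓ - 1) => ℝ)).symm.hasFDerivAt.comp_hasDerivAt t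
    (hasDerivAt_pi.2 fun i : Fin (ℓ - 1) => hasDerivAt_integratedLegendre (i + 2) t)

theorem contDiff_vecL (ℓ : ℕ) : ContDiff ℝ 1 (vecL ℓ) := by
  rw [contDiff_euclidean]
  intro i
  simp only [vecL, shiftedLegendre]
  fun_prop

theorem vecK_zero (ℓ : ℕ) : vecK ℓ 0 = 0 := by
  ext i
  simp [vecK, integratedLegendre]

/-- Rodrigues' formula. -/
theorem factorial_mul_shiftedLegendre (r : ℕ) (u : ℝ) :
    (r.factorial : ℝ) * shiftedLegendre r u = (-1) ^ r *
      (Polynomial.derivative^[r] ((Polynomial.X : Polynomial ℝ) ^ r *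
        (1 - Polynomial.X) ^ r)).eval u := by
  have h := congrArg (fun q : Polynomial ℤ => (q.map (Int.castRingHom ℝ)).eval u)
    (Polynomial.factorial_mul_shiftedLegendre_eq r)
  simp only [Polynomial.map_mul, Polynomial.eval_mul, Polynomial.map_natCast,
    Polynomial.eval_natCast, ← Polynomial.iterate_derivative_map] at h
  simp only [Polynomial.map_pow, Polynomial.map_sub, Polynomial.map_X, Polynomial.map_one] at h
  rw [← h, mul_left_comm]
  congr 1
  rw [shiftedLegendre, Polynomial.shiftedLegendre, Polynomial.map_sum, Polynomial.eval_finsetSum,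
    Finset.mul_sum]
  refine Finset.sum_congr rfl fun k hk => ?_
  have hk' : k ≤ r := by simpa [Nat.lt_succ_iff] using hk
  have h1 : (-1 : ℝ) ^ (r - k) = (-1) ^ r * (-1) ^ k := by
    obtain ⟨j, rfl⟩ := Nat.exists_eq_add_of_le hk'
    rw [Nat.add_sub_cancel_left, pow_add, mul_comm ((-1 : ℝ) ^ k), mul_assoc, ← mul_pow]
    simp
  rw [h1, Nat.choose_symm_add]
  simp
  ring

/-- By the Rodrigues formula, the Legendre polynomials of positive degree integrate to zero. -/
theorem integral_shiftedLegendre {r : ℕ} (hr : r ≠ 0) :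
    ∫ u in (0 : ℝ)..1, shiftedLegendre r u = 0 := by
  obtain ⟨n, rfl⟩ := Nat.exists_eq_succ_of_ne_zero hr
  set p : Polynomial ℝ := (Polynomial.X : Polynomial ℝ) ^ (n + 1) * (1 - Polynomial.X) ^ (n + 1)
  have h0 : (Polynomial.derivative^[n] p).eval 0 = 0 := by
    have := Polynomial.pow_sub_dvd_iterate_derivative_of_pow_dvd n
      (dvd_mul_right ((Polynomial.X : Polynomial ℝ) ^ (n + 1)) ((1 - Polynomial.X) ^ (n + 1)))
    exact Polynomial.eval_eq_zero_of_dvd_of_eval_eq_zero this (by simp)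
  have h1 : (Polynomial.derivative^[n] p).eval 1 = 0 := by
    have := Polynomial.pow_sub_dvd_iterate_derivative_of_pow_dvd n
      (dvd_mul_left ((1 - Polynomial.X : Polynomial ℝ) ^ (n + 1)) (Polynomial.X ^ (n + 1)))
    exact Polynomial.eval_eq_zero_of_dvd_of_eval_eq_zero this (by simp)
  have h2 : ∫ u in (0 : ℝ)..1, ((n + 1).factorial : ℝ) * shiftedLegendre (n + 1) u = 0 := by
    simp only [factorial_mul_shiftedLegendre, Function.iterate_succ_apply']
    rw [intervalIntegral.integral_const_mul, intervalIntegral.integral_eq_sub_of_hasDerivAt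
      (fun x _ => (Polynomial.derivative^[n] p).hasDerivAt x)
      ((Polynomial.continuous _).intervalIntegrable _ _), h0, h1]
    simp
  rw [intervalIntegral.integral_const_mul] at h2
  exact (mul_eq_zero.1 h2).resolve_left (by positivity)

theorem vecK_one (ℓ : ℕ) : vecK ℓ 1 = 0 := by
  ext i
  exact integral_shiftedLegendre (by simp)

/-! ### Coordinates of the parameter vector -/

section Coordinates

variable {d s : ℕ}

theorem Param.abs_lam_le (p : Param d s) : |p.lam| ≤ ‖p‖ :=
  PiLp.norm_apply_le p (Sum.inl 0)

theorem Param.norm_theta_le (p : Param d s) : ‖p.theta‖ ≤ ‖p‖ := by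
  rw [EuclideanSpace.norm_eq, EuclideanSpace.norm_eq]
  refine Real.sqrt_le_sqrt ?_
  simp only [Fintype.sum_sum_type, Param.theta]
  have h1 : 0 ≤ ∑ x : Fin 1, ‖p (Sum.inl x)‖ ^ 2 := by positivity
  have h2 : 0 ≤ ∑ x : Fin s, ‖p (Sum.inr (Sum.inr x))‖ ^ 2 := by positivity
  linarith

theorem Param.norm_alpha_le (p : Param d s) : ‖p.alpha‖ ≤ ‖p‖ := by
  rw [EuclideanSpace.norm_eq, EuclideanSpace.norm_eq]
  refine Real.sqrt_le_sqrt ?_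
  simp only [Fintype.sum_sum_type, Param.alpha]
  have h1 : 0 ≤ ∑ x : Fin 1, ‖p (Sum.inl x)‖ ^ 2 := by positivity
  have h2 : 0 ≤ ∑ x : Fin d, ‖p (Sum.inr (Sum.inl x))‖ ^ 2 := by positivity
  linarith

theorem Param.lam_sub (p q : Param d s) : (p - q).lam = p.lam - q.lam := rfl
theorem Param.theta_sub (p q : Param d s) : (p - q).theta = p.theta - q.theta := rfl
theorem Param.alpha_sub (p q : Param d s) : (p - q).alpha = p.alpha - q.alpha := rfl

end Coordinates

/-! ### Parametric components with integrable derivatives -/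

/-- First- and second-order control of a family `G θ y` for `θ` in the ball of radius `ρ` about
`θ₀`: `g y` is the gradient at `θ₀`, and `B₁`, `B₂` are integrable envelopes of the first and
second derivatives in `θ`. -/
structure IsSmoothFamily {T : Type*} [NormedAddCommGroup T] [InnerProductSpace ℝ T]
    (G : T → ℝ → ℝ) (θ₀ : T) (g : ℝ → T) (B₁ B₂ : ℝ → ℝ) (ρ : ℝ) : Prop where
  pos : 0 < ρ
  integrable₁ : Integrable B₁
  integrable₂ : Integrable B₂
  nonneg₂ : ∀ y, 0 ≤ B₂ y
  norm_grad_le : ∀ y, ‖g y‖ ≤ B₁ y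
  lipschitz : ∀ θ θ' y, ‖θ - θ₀‖ < ρ → ‖θ' - θ₀‖ < ρ → |G θ' y - G θ y| ≤ B₁ y * ‖θ' - θ‖
  expansion : ∀ δ ≤ ρ, ∀ θ θ' y, ‖θ - θ₀‖ < δ → ‖θ' - θ₀‖ < δ →
    |G θ' y - G θ y - inner ℝ (g y) (θ' - θ)| ≤ δ * B₂ y * ‖θ' - θ‖

/-- Both bounds come from the mean value inequality on a ball about `θ₀`, applied to the function
and to its gradient. -/
theorem exists_isSmoothFamily {T : Type*} [NormedAddCommGroup T] [InnerProductSpace ℝ T]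
    [CompleteSpace T] {G : T → ℝ → ℝ} {θ₀ : T} {B₁ B₂ : ℝ → ℝ}
    (hG : ∀ᶠ θ in 𝓝 θ₀, ∀ y : ℝ, DifferentiableAt ℝ (fun t => G t y) θ ∧
      DifferentiableAt ℝ (gradient (fun t => G t y)) θ)
    (hi₁ : Integrable B₁) (hB₁ : ∀ᶠ θ in 𝓝 θ₀, ∀ y : ℝ, ‖gradient (fun t => G t y) θ‖ ≤ B₁ y)
    (hi₂ : Integrable B₂)
    (hB₂ : ∀ᶠ θ in 𝓝 θ₀, ∀ y : ℝ, ‖fderiv ℝ (gradient (fun t => G t y)) θ‖ ≤ B₂ y) :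
    ∃ ρ, IsSmoothFamily G θ₀ (fun y => gradient (fun t => G t y) θ₀) B₁ B₂ ρ := by
  obtain ⟨ρ, hρ, h⟩ := Metric.eventually_nhds_iff_ball.1 (hG.and (hB₁.and hB₂))
  have hderiv : ∀ θ ∈ Metric.ball θ₀ ρ, ∀ y, HasFDerivAt (fun t => G t y)
      (InnerProductSpace.toDual ℝ T (gradient (fun t => G t y) θ)) θ := fun θ hθ y =>
    ((h θ hθ).1 y).1.hasGradientAt.hasFDerivAt
  refine ⟨ρ, hρ, hi₁, hi₂, ?_, ?_, ?_, ?_⟩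
  · exact fun y => (norm_nonneg _).trans ((h θ₀ (Metric.mem_ball_self hρ)).2.2 y)
  · exact fun y => (h θ₀ (Metric.mem_ball_self hρ)).2.1 y
  · intro θ θ' y hθ hθ'
    refine (convex_ball θ₀ ρ).norm_image_sub_le_of_norm_hasFDerivWithin_le
      (fun x hx => (hderiv x hx y).hasFDerivWithinAt) (fun x hx => ?_)
      (mem_ball_iff_norm.2 hθ) (mem_ball_iff_norm.2 hθ')
    rw [LinearIsometryEquiv.norm_map]
    exact (h x hx).2.1 y
  · intro δ hδ θ θ' y hθ hθ'
    have hsub := Metric.ball_subset_ball (x := θ₀) hδ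
    have hgrad : ∀ x ∈ Metric.ball θ₀ δ, ‖gradient (fun t => G t y) x
        - gradient (fun t => G t y) θ₀‖ ≤ δ * B₂ y := by
      intro x hx
      have h0 : θ₀ ∈ Metric.ball θ₀ δ := Metric.mem_ball_self (dist_nonneg.trans_lt hx)
      have := (convex_ball θ₀ δ).norm_image_sub_le_of_norm_hasFDerivWithin_le
        (fun x hx => ((h x (hsub hx)).1 y).2.hasFDerivAt.hasFDerivWithinAt)
        (fun x hx => (h x (hsub hx)).2.2 y) h0 hx
      refine this.trans ?_
      rw [mul_comm]
      exact mul_le_mul_of_nonneg_right (mem_ball_iff_norm.1 hx).le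
        ((norm_nonneg _).trans ((h θ₀ (hsub h0)).2.2 y))
    refine (convex_ball θ₀ δ).norm_image_sub_le_of_norm_hasFDerivWithin_le'
      (φ := InnerProductSpace.toDual ℝ T (gradient (fun t => G t y) θ₀))
      (fun x hx => (hderiv x (hsub hx) y).hasFDerivWithinAt) (fun x hx => ?_)
      (mem_ball_iff_norm.2 hθ) (mem_ball_iff_norm.2 hθ')
    rw [← map_sub, LinearIsometryEquiv.norm_map]
    exact hgrad x hx

theorem measurable_inner_gradient {T : Type*} [NormedAddCommGroup T] [InnerProductSpace ℝ T]
    [CompleteSpace T] {G : T → ℝ → ℝ} {θ₀ : T} (hG : ∀ θ, Measurable (G θ))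
    (hd : ∀ y, DifferentiableAt ℝ (fun t => G t y) θ₀) (v : T) :
    Measurable fun y => inner ℝ (gradient (fun t => G t y) θ₀) v := by
  have hlim : ∀ y, Tendsto (fun n : ℕ => (1 / ((n : ℝ) + 1))⁻¹ •
      (G (θ₀ + (1 / ((n : ℝ) + 1)) • v) y - G θ₀ y)) atTop
      (𝓝 (inner ℝ (gradient (fun t => G t y) θ₀) v)) := by
    intro y
    have h1 := (hd y).hasGradientAt.hasFDerivAt.hasLineDerivAt v
    have h2 := h1.tendsto_slope_zero_right
    have h3 : Tendsto (fun n : ℕ => 1 / ((n : ℝ) + 1)) atTop (𝓝[>] 0) :=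
      tendsto_nhdsWithin_iff.2 ⟨tendsto_one_div_add_atTop_nhds_zero_nat,
        Eventually.of_forall fun n => by
          show (0 : ℝ) < 1 / ((n : ℝ) + 1)
          positivity⟩
    simpa [Function.comp_def] using h2.comp h3
  refine measurable_of_tendsto_metrizable (fun n => ?_) (tendsto_pi_nhds.2 hlim)
  exact ((hG _).sub (hG _)).const_mul _

/-! ### Integrals against a fixed integrable envelope -/

/-- Integrating a bounded function that is small in `L¹` against a fixed integrable function gives
a small value. -/
theorem exists_integral_mul_le {B : ℝ → ℝ} (hB : Integrable B)
    (R : ℝ) {ε : ℝ} (hε : 0 < ε) :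
    ∃ N, 0 ≤ N ∧ ∀ f : ℝ → ℝ, Integrable f → (∀ y, 0 ≤ f y) → (∀ y, f y ≤ R) →
      ∫ y, f y * B y ≤ N * (∫ y, f y) + ε := by
  have hdom : ∀ (n : ℕ) (y : ℝ), ‖R * max (B y - n) 0‖ ≤ |R| * |B y| := fun n y => by
    have : (0 : ℝ) ≤ n := n.cast_nonneg
    have hm : (0 : ℝ) ≤ max (B y - n) 0 := le_max_right _ _
    rw [norm_mul, Real.norm_eq_abs, Real.norm_eq_abs, abs_of_nonneg hm]
    exact mul_le_mul_of_nonneg_left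
      (max_le (by linarith [le_abs_self (B y)]) (abs_nonneg _)) (abs_nonneg _)
  have hlim : Tendsto (fun n : ℕ => ∫ y, R * max (B y - n) 0) atTop (𝓝 (∫ _ : ℝ, (0 : ℝ))) := by
    refine tendsto_integral_of_dominated_convergence (fun y => |R| * |B y|) ?_
      (hB.abs.const_mul _) ?_ ?_
    · exact fun n => (((hB.1.sub aestronglyMeasurable_const).sup
        aestronglyMeasurable_const).const_mul R)
    · exact fun n => Eventually.of_forall (hdom n)
    · refine Eventually.of_forall fun y => ?_
      obtain ⟨n, hn⟩ := exists_nat_ge (B y)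
      refine tendsto_const_nhds.congr' ?_
      filter_upwards [eventually_ge_atTop n] with m hm
      have : (n : ℝ) ≤ m := by exact_mod_cast hm
      rw [max_eq_right (by linarith), mul_zero]
  rw [integral_zero] at hlim
  obtain ⟨n, hn⟩ := (hlim.eventually (gt_mem_nhds hε)).exists
  refine ⟨n, n.cast_nonneg, fun f hf h0 hR => ?_⟩
  have hRi : Integrable fun y => R * max (B y - n) 0 :=
    Integrable.mono' (hB.abs.const_mul |R|) (((hB.1.sub aestronglyMeasurable_const).sup
        aestronglyMeasurable_const).const_mul R) (Eventually.of_forall (hdom n))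
  have hle : ∀ y, f y * B y ≤ n * f y + R * max (B y - n) 0 := fun y => by
    have h1 : f y * (B y - n) ≤ f y * max (B y - n) 0 :=
      mul_le_mul_of_nonneg_left (le_max_left _ _) (h0 y)
    have h2 : f y * max (B y - n) 0 ≤ R * max (B y - n) 0 :=
      mul_le_mul_of_nonneg_right (hR y) (le_max_right _ _)
    linarith
  have hfB : Integrable fun y => f y * B y :=
    hB.bdd_mul (c := R) hf.1 (Eventually.of_forall fun y => by
      rw [Real.norm_eq_abs, abs_of_nonneg (h0 y)]; exact hR y)
  calc ∫ y, f y * B y ≤ ∫ y, (n * f y + R * max (B y - n) 0) :=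
        integral_mono hfB ((hf.const_mul _).add hRi) hle
    _ = n * (∫ y, f y) + ∫ y, R * max (B y - n) 0 := by
        rw [integral_add (hf.const_mul _) hRi, integral_const_mul]
    _ ≤ _ := by linarith

/-! ### Second-order control of a smooth curve on an interval -/

/-- On a compact interval a `C²` curve is bounded and Lipschitz, and its linearisation at a third
point `w` has a second-order error. The point `w` is needed since increments between two perturbed
components are linearised at the true one. -/
theorem exists_curve_bound {E : Type*} [NormedAddCommGroup E] [NormedSpace ℝ E] {k k' : ℝ → E}
    (hk : ∀ t, HasDerivAt k (k' t) t) (hk' : ContDiff ℝ 1 k') (R : ℝ) :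
    ∃ C, 0 ≤ C ∧ ∀ u v w, |u| ≤ R → |v| ≤ R → |w| ≤ R →
      ‖k u‖ ≤ C ∧ ‖k' u‖ ≤ C ∧ ‖k v - k u‖ ≤ C * |v - u| ∧
      ‖k v - k u - (v - u) • k' w‖ ≤ C * (|u - w| + |v - w|) * |v - u| := by
  have hkc : Continuous k := continuous_iff_continuousAt.2 fun t => (hk t).continuousAt
  obtain ⟨C₀, h₀⟩ := (isCompact_Icc (a := -R) (b := R)).exists_bound_of_continuousOn
    hkc.continuousOn
  obtain ⟨C₁, h₁⟩ := (isCompact_Icc (a := -R) (b := R)).exists_bound_of_continuousOn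
    hk'.continuous.continuousOn
  obtain ⟨C₂, h₂⟩ := (isCompact_Icc (a := -R) (b := R)).exists_bound_of_continuousOn
    (hk'.continuous_deriv le_rfl).continuousOn
  set C := max 0 (max C₀ (max C₁ C₂)) with hC
  have hC₀ : C₀ ≤ C := by simp [hC]
  have hC₁ : C₁ ≤ C := by simp [hC]
  have hC₂ : C₂ ≤ C := by simp [hC]
  have hlip' : ∀ u v, |u| ≤ R → |v| ≤ R → ‖k' v - k' u‖ ≤ C * |v - u| := fun u v hu hv =>
    (convex_Icc (-R) R).norm_image_sub_le_of_norm_hasDerivWithin_le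
      (fun x _ => ((hk'.differentiable one_ne_zero) x).hasDerivAt.hasDerivWithinAt)
      (fun x hx => (h₂ x hx).trans hC₂) (abs_le.1 hu) (abs_le.1 hv)
  refine ⟨C, le_max_left _ _, fun u v w hu hv hw => ⟨(h₀ u (abs_le.1 hu)).trans hC₀,
    (h₁ u (abs_le.1 hu)).trans hC₁, ?_, ?_⟩⟩
  · exact (convex_Icc (-R) R).norm_image_sub_le_of_norm_hasDerivWithin_le
      (fun x _ => (hk x).hasDerivWithinAt)
      (fun x hx => (h₁ x hx).trans hC₁) (abs_le.1 hu) (abs_le.1 hv)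
  · have hseg : ∀ x ∈ Set.uIcc u v, |x| ≤ R ∧ |x - w| ≤ |u - w| + |v - w| := by
      intro x hx
      rw [abs_le] at hu hv
      rcases Set.mem_uIcc.1 hx with h | h
      · refine ⟨abs_le.2 ⟨by linarith, by linarith⟩, abs_le.2 ⟨?_, ?_⟩⟩
        · linarith [neg_abs_le (u - w), abs_nonneg (v - w)]
        · linarith [le_abs_self (v - w), abs_nonneg (u - w)]
      · refine ⟨abs_le.2 ⟨by linarith, by linarith⟩, abs_le.2 ⟨?_, ?_⟩⟩
        · linarith [neg_abs_le (v - w), abs_nonneg (u - w)]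
        · linarith [le_abs_self (u - w), abs_nonneg (v - w)]
    have := (convex_uIcc u v).norm_image_sub_le_of_norm_hasDerivWithin_le
      (f := fun x => k x - x • k' w) (f' := fun x => k' x - (1 : ℝ) • k' w)
      (C := C * (|u - w| + |v - w|)) (x := u) (y := v)
      (fun x _ => ((hk x).sub ((hasDerivAt_id x).smul_const (k' w))).hasDerivWithinAt)
      (fun x hx => by
        rw [one_smul]
        exact (hlip' w x hw (hseg x hx).1).trans
          (mul_le_mul_of_nonneg_left (hseg x hx).2 (le_max_left _ _)))
      Set.left_mem_uIcc Set.right_mem_uIcc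
    rw [sub_smul]
    rw [Real.norm_eq_abs] at this
    convert this using 2
    abel

/-! ### Perturbation of the nonparametric component -/

section Perturbation

variable {d s : ℕ} {P₁ : EuclideanSpace ℝ (Fin d) → Measure ℝ} {FT : ℝ → ℝ} {p₀ : Param d s}
  {g : ℝ → EuclideanSpace ℝ (Fin d)} {B₁ B₂ : ℝ → ℝ} {ρ : ℝ}

/-- The differential at `p₀` of `p ↦ F0 P₁ FT p y` in the direction `v`, where `g` stands for the
gradient in `θ` of the cdf of the parametric component at `p₀.theta`. -/
noncomputable def linF0 (P₁ : EuclideanSpace ℝ (Fin d) → Measure ℝ) (FT : ℝ → ℝ) (p₀ : Param d s)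
    (g : ℝ → EuclideanSpace ℝ (Fin d)) (v : Param d s) (y : ℝ) : ℝ :=
  v.lam * (1 / (1 - p₀.lam)) ^ 2 * (FT y - cdf (P₁ p₀.theta) y)
    + (1 - 1 / (1 - p₀.lam)) * inner ℝ (g y) v.theta

/-- The envelope that dominates all first- and second-order increments of `p ↦ F0 P₁ F p y`. -/
noncomputable def envelope (P₁ : EuclideanSpace ℝ (Fin d) → Measure ℝ) (FT : ℝ → ℝ)
    (p₀ : Param d s) (B₁ B₂ : ℝ → ℝ) (y : ℝ) : ℝ :=
  |FT y - cdf (P₁ p₀.theta) y| + B₁ y + B₂ y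

/-- The affine form of `F0`, in which the mixture proportion enters through `1 / (1 - λ)` only. -/
theorem F0_eq (F : ℝ → ℝ) (p : Param d s) (hp : p.lam ≠ 1) (y : ℝ) :
    F0 P₁ F p y = cdf (P₁ p.theta) y + 1 / (1 - p.lam) * (F y - cdf (P₁ p.theta) y) := by
  have : 1 - p.lam ≠ 0 := sub_ne_zero.2 (Ne.symm hp)
  rw [F0]
  field_simp
  ring

/-- Near `p₀` the perturbed component `F0 P₁ F p` is bounded, close to `F0 P₁ FT p₀`, and Lipschitz
and approximately linear in `p`. The constant is uniform in `F` and in `δ` because `1 - λ` stays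
away from `0`. -/
theorem F0_bounds (hp₀ : p₀.lam < 1)
    (hG : IsSmoothFamily (fun θ y => cdf (P₁ θ) y) p₀.theta g B₁ B₂ ρ) :
    ∃ C δ₀, 0 ≤ C ∧ 0 < δ₀ ∧ δ₀ ≤ 1 ∧ ∀ δ ≤ δ₀, ∀ F : ℝ → ℝ, (∀ y, 0 ≤ F y ∧ F y ≤ 1) →
      ∀ p p' : Param d s, ‖p - p₀‖ < δ → ‖p' - p₀‖ < δ → ∀ y,
      |F0 P₁ F p y| ≤ C ∧
      |F0 P₁ F p y - F0 P₁ FT p₀ y| ≤ C * (|F y - FT y| + δ * envelope P₁ FT p₀ B₁ B₂ y) ∧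
      |F0 P₁ F p' y - F0 P₁ F p y| ≤
        C * ‖p' - p‖ * (|F y - FT y| + envelope P₁ FT p₀ B₁ B₂ y) ∧
      |F0 P₁ F p' y - F0 P₁ F p y - linF0 P₁ FT p₀ g (p' - p) y| ≤
        C * ‖p' - p‖ * (|F y - FT y| + δ * envelope P₁ FT p₀ B₁ B₂ y) := by
  set c₀ := 1 / (1 - p₀.lam) with hc₀
  have hl₀ : 0 < 1 - p₀.lam := by linarith
  set A := 2 * c₀ with hA
  have hc₀pos : 0 < c₀ := by positivity
  set C := A ^ 2 + 1 + A with hC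
  set C' := C + A + A ^ 2 + 2 * A ^ 2 + 2 * A ^ 3 + 1 + A with hC'
  have hA0 : 0 ≤ A := by positivity
  have hC0 : 0 ≤ C := by rw [hC]; positivity
  have hC'0 : 0 ≤ C' := by
    have : 0 ≤ A ^ 2 + 2 * A ^ 2 + 2 * A ^ 3 + 1 + A := by positivity
    rw [hC']; linarith
  set δ₀ := min (min 1 ρ) ((1 - p₀.lam) / 2) with hδ₀
  have hδ₀1 : δ₀ ≤ 1 := (min_le_left _ _).trans (min_le_left _ _)
  have hδ₀ρ : δ₀ ≤ ρ := (min_le_left _ _).trans (min_le_right _ _)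
  have hδ₀l : δ₀ ≤ (1 - p₀.lam) / 2 := min_le_right _ _
  refine ⟨C', δ₀, hC'0, lt_min (lt_min one_pos hG.pos) (by linarith), hδ₀1, ?_⟩
  intro δ hδ F hF p p' hp hp' y
  have hδpos : 0 < δ := (norm_nonneg _).trans_lt hp
  -- the proportions stay away from one
  have hc : ∀ q : Param d s, ‖q - p₀‖ < δ → q.lam ≠ 1 ∧ 0 < 1 / (1 - q.lam) ∧
      1 / (1 - q.lam) ≤ A ∧ ∀ q' : Param d s, q'.lam ≠ 1 → 1 / (1 - q'.lam) - 1 / (1 - q.lam) =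
        (q'.lam - q.lam) * (1 / (1 - q.lam)) * (1 / (1 - q'.lam)) := by
    intro q hq
    have h1 : |q.lam - p₀.lam| ≤ ‖q - p₀‖ := Param.abs_lam_le (q - p₀)
    have h2 : (1 - p₀.lam) / 2 ≤ 1 - q.lam := by
      linarith [le_abs_self (q.lam - p₀.lam)]
    have h3 : 0 < 1 - q.lam := by linarith
    refine ⟨fun h => by linarith, by positivity, ?_, fun q' hq' => ?_⟩
    · rw [hA, hc₀, div_le_iff₀ h3]
      have : 2 * (1 / (1 - p₀.lam)) * ((1 - p₀.lam) / 2) = 1 := by field_simp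
      exact this.ge.trans (mul_le_mul_of_nonneg_left h2 hA0)
    · have : 1 - q'.lam ≠ 0 := sub_ne_zero.2 (Ne.symm hq')
      field_simp
      ring
  have hθ : ∀ q : Param d s, ‖q - p₀‖ < δ → ‖q.theta - p₀.theta‖ < δ := fun q hq =>
    (Param.norm_theta_le (q - p₀)).trans_lt hq
  have hp00 : ‖p₀ - p₀‖ < δ := by simpa using hδpos
  set D := |F y - FT y| with hD
  set E := |FT y - cdf (P₁ p₀.theta) y| with hE
  have hD0 : 0 ≤ D := abs_nonneg _
  have hE0 : 0 ≤ E := abs_nonneg _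
  have hB₁0 : 0 ≤ B₁ y := (norm_nonneg _).trans (hG.norm_grad_le y)
  have hB₂0 : 0 ≤ B₂ y := hG.nonneg₂ y
  have henv : envelope P₁ FT p₀ B₁ B₂ y = E + B₁ y + B₂ y := rfl
  -- the increments between two parameters
  have hinc : ∀ q q' : Param d s, ‖q - p₀‖ < δ → ‖q' - p₀‖ < δ →
      F0 P₁ F q' y - F0 P₁ F q y =
        (q'.lam - q.lam) * (1 / (1 - q.lam)) * (1 / (1 - q'.lam)) *
          (F y - cdf (P₁ q'.theta) y)
        + (1 - 1 / (1 - q.lam)) * (cdf (P₁ q'.theta) y - cdf (P₁ q.theta) y) := by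
    intro q q' hq hq'
    rw [← (hc q hq).2.2.2 q' (hc q' hq').1, F0_eq _ _ (hc q hq).1, F0_eq _ _ (hc q' hq').1]
    ring
  have hlip : ∀ q q' : Param d s, ‖q - p₀‖ < δ → ‖q' - p₀‖ < δ →
      |cdf (P₁ q'.theta) y - cdf (P₁ q.theta) y| ≤ B₁ y * ‖q' - q‖ := by
    intro q q' hq hq'
    refine (hG.lipschitz q.theta q'.theta y ((hθ q hq).trans_le (hδ.trans hδ₀ρ))
      ((hθ q' hq').trans_le (hδ.trans hδ₀ρ))).trans ?_
    exact mul_le_mul_of_nonneg_left (Param.norm_theta_le (q' - q)) hB₁0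
  have hlipδ : ∀ q : Param d s, ‖q - p₀‖ < δ →
      |cdf (P₁ q.theta) y - cdf (P₁ p₀.theta) y| ≤ δ * B₁ y := by
    intro q hq
    rw [mul_comm]
    exact (hlip p₀ q hp00 hq).trans (mul_le_mul_of_nonneg_left hq.le hB₁0)
  have hFG : ∀ q : Param d s, ‖q - p₀‖ < δ → |F y - cdf (P₁ q.theta) y| ≤ D + E + δ * B₁ y := by
    intro q hq
    have := hlipδ q hq
    calc |F y - cdf (P₁ q.theta) y| = |(F y - FT y) + (FT y - cdf (P₁ p₀.theta) y)
          - (cdf (P₁ q.theta) y - cdf (P₁ p₀.theta) y)| := by congr 1; ring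
      _ ≤ D + E + |cdf (P₁ q.theta) y - cdf (P₁ p₀.theta) y| :=
          (abs_sub _ _).trans (add_le_add_left (abs_add_le _ _) _)
      _ ≤ _ := by linarith
  have h1c : ∀ q : Param d s, ‖q - p₀‖ < δ → |1 - 1 / (1 - q.lam)| ≤ 1 + A := by
    intro q hq
    obtain ⟨-, h1, h2, -⟩ := hc q hq
    exact abs_le.2 ⟨by linarith, by linarith⟩
  have hlam : ∀ q q' : Param d s, |q'.lam - q.lam| ≤ ‖q' - q‖ := fun q q' =>
    Param.abs_lam_le (q' - q)
  have hδ1 : δ ≤ 1 := hδ.trans hδ₀1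
  have hincb : ∀ q q' : Param d s, ‖q - p₀‖ < δ → ‖q' - p₀‖ < δ →
      |F0 P₁ F q' y - F0 P₁ F q y| ≤ C * ‖q' - q‖ * (D + (E + B₁ y + B₂ y)) := by
    intro q q' hq hq'
    obtain ⟨-, h1, h2, -⟩ := hc q hq
    obtain ⟨-, h1', h2', -⟩ := hc q' hq'
    rw [hinc q q' hq hq']
    calc _ ≤ |q'.lam - q.lam| * (1 / (1 - q.lam)) * (1 / (1 - q'.lam)) *
          |F y - cdf (P₁ q'.theta) y|
          + |1 - 1 / (1 - q.lam)| * |cdf (P₁ q'.theta) y - cdf (P₁ q.theta) y| := by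
            refine (abs_add_le _ _).trans (le_of_eq ?_)
            rw [abs_mul, abs_mul, abs_mul, abs_mul, abs_of_pos h1, abs_of_pos h1']
      _ ≤ ‖q' - q‖ * A * A * (D + E + δ * B₁ y) + (1 + A) * (B₁ y * ‖q' - q‖) := by
            gcongr
            · exact hlam q q'
            · exact hFG q' hq'
            · exact h1c q hq
            · exact hlip q q' hq hq'
      _ ≤ ‖q' - q‖ * A * A * (D + E + 1 * B₁ y) + (1 + A) * (B₁ y * ‖q' - q‖) := by gcongr
      _ ≤ _ := by
            have hn := norm_nonneg (q' - q)
            have : C * ‖q' - q‖ * (D + (E + B₁ y + B₂ y)) -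
              (‖q' - q‖ * A * A * (D + E + 1 * B₁ y) + (1 + A) * (B₁ y * ‖q' - q‖)) =
              ‖q' - q‖ * ((1 + A) * (D + E) + C * B₂ y) := by rw [hC]; ring
            have h0 : 0 ≤ ‖q' - q‖ * ((1 + A) * (D + E) + C * B₂ y) := by positivity
            linarith
  refine ⟨?_, ?_, ?_, ?_⟩
  · obtain ⟨h0, h1, h2, -⟩ := hc p hp
    rw [F0_eq _ _ h0]
    have hg0 := cdf_nonneg (P₁ p.theta) y
    have hg1 := cdf_le_one (P₁ p.theta) y
    have hF1 : |F y - cdf (P₁ p.theta) y| ≤ 1 :=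
      abs_le.2 ⟨by linarith [(hF y).1], by linarith [(hF y).2]⟩
    calc _ ≤ |(cdf (P₁ p.theta) y : ℝ)| + (1 / (1 - p.lam)) * |F y - cdf (P₁ p.theta) y| := by
            refine (abs_add_le _ _).trans (le_of_eq ?_)
            rw [abs_mul, abs_of_pos h1]
      _ ≤ 1 + A * 1 := by
            gcongr
            rw [abs_of_nonneg hg0]; exact hg1
      _ ≤ C' := by
            have : 0 ≤ C + A ^ 2 + 2 * A ^ 2 + 2 * A ^ 3 + A := by positivity
            linarith
  · have h1 : |F0 P₁ F p y - F0 P₁ F p₀ y| ≤ C * δ * (D + (E + B₁ y + B₂ y)) :=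
      (hincb p₀ p hp00 hp).trans (by gcongr)
    have h2 : |F0 P₁ F p₀ y - F0 P₁ FT p₀ y| ≤ A * D := by
      rw [F0_eq _ _ (hc p₀ hp00).1, F0_eq _ _ (hc p₀ hp00).1]
      rw [show cdf (P₁ p₀.theta) y + 1 / (1 - p₀.lam) * (F y - cdf (P₁ p₀.theta) y)
        - (cdf (P₁ p₀.theta) y + 1 / (1 - p₀.lam) * (FT y - cdf (P₁ p₀.theta) y))
        = 1 / (1 - p₀.lam) * (F y - FT y) by ring, abs_mul, abs_of_pos (hc p₀ hp00).2.1]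
      exact mul_le_mul_of_nonneg_right (hc p₀ hp00).2.2.1 hD0
    have h3 : |F0 P₁ F p y - F0 P₁ FT p₀ y| ≤ C * δ * (D + (E + B₁ y + B₂ y)) + A * D :=
      (abs_sub_le _ _ _).trans (add_le_add h1 h2)
    rw [henv]
    refine h3.trans ?_
    have hm : C * δ * D ≤ C * D := by
      have : C * δ * D = C * D * δ := by ring
      rw [this]
      exact mul_le_of_le_one_right (by positivity) hδ1
    have h0 : 0 ≤ (A ^ 2 + 2 * A ^ 2 + 2 * A ^ 3 + 1 + A) * (D + δ * (E + B₁ y + B₂ y)) +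
      A * (δ * (E + B₁ y + B₂ y)) := by positivity
    rw [hC']
    linarith
  · rw [henv]
    refine (hincb p p' hp hp').trans ?_
    have : C ≤ C' := by
      have : 0 ≤ A + A ^ 2 + 2 * A ^ 2 + 2 * A ^ 3 + 1 + A := by positivity
      linarith
    gcongr
  · obtain ⟨hl, h1, h2, h3⟩ := hc p hp
    obtain ⟨hl', h1', h2', h3'⟩ := hc p' hp'
    obtain ⟨hl0, h10, h20, h30⟩ := hc p₀ hp00
    have hexp := hG.expansion δ (hδ.trans hδ₀ρ) p.theta p'.theta y (hθ p hp) (hθ p' hp')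
    have hexp' : |cdf (P₁ p'.theta) y - cdf (P₁ p.theta) y - inner ℝ (g y) (p'.theta - p.theta)|
        ≤ δ * B₂ y * ‖p' - p‖ :=
      hexp.trans (mul_le_mul_of_nonneg_left (Param.norm_theta_le (p' - p)) (by positivity))
    have hinner : |inner ℝ (g y) (p'.theta - p.theta)| ≤ B₁ y * ‖p' - p‖ :=
      (abs_real_inner_le_norm _ _).trans (mul_le_mul (hG.norm_grad_le y)
        (Param.norm_theta_le (p' - p)) (norm_nonneg _) hB₁0)
    have hdc : ∀ q : Param d s, ‖q - p₀‖ < δ →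
        |1 / (1 - q.lam) - 1 / (1 - p₀.lam)| ≤ δ * A ^ 2 := by
      intro q hq
      rw [h30 q (hc q hq).1, abs_mul, abs_mul, abs_of_pos h10, abs_of_pos (hc q hq).2.1]
      calc _ ≤ δ * A * A := by
            have := (hc q hq).2.1
            gcongr
            · exact (hlam p₀ q).trans hq.le
            · exact (hc q hq).2.2.1
        _ = _ := by ring
    have hcc : |1 / (1 - p.lam) * (1 / (1 - p'.lam)) - (1 / (1 - p₀.lam)) ^ 2| ≤
        δ * (2 * A ^ 3) := by
      rw [show 1 / (1 - p.lam) * (1 / (1 - p'.lam)) - (1 / (1 - p₀.lam)) ^ 2 =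
        (1 / (1 - p.lam) - 1 / (1 - p₀.lam)) * (1 / (1 - p'.lam)) +
        1 / (1 - p₀.lam) * (1 / (1 - p'.lam) - 1 / (1 - p₀.lam)) by ring]
      refine (abs_add_le _ _).trans ?_
      rw [abs_mul, abs_mul, abs_of_pos h1', abs_of_pos h10]
      calc _ ≤ δ * A ^ 2 * A + A * (δ * A ^ 2) := by
            gcongr
            · exact hdc p hp
            · exact hdc p' hp'
        _ = _ := by ring
    have hdiff : |F y - cdf (P₁ p'.theta) y - (FT y - cdf (P₁ p₀.theta) y)| ≤ D + δ * B₁ y := by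
      rw [show F y - cdf (P₁ p'.theta) y - (FT y - cdf (P₁ p₀.theta) y) = (F y - FT y) -
        (cdf (P₁ p'.theta) y - cdf (P₁ p₀.theta) y) by ring]
      exact (abs_sub _ _).trans (add_le_add le_rfl (hlipδ p' hp'))
    have hdec : F0 P₁ F p' y - F0 P₁ F p y - linF0 P₁ FT p₀ g (p' - p) y =
        (p'.lam - p.lam) * ((1 / (1 - p.lam)) * (1 / (1 - p'.lam)) *
          (F y - cdf (P₁ p'.theta) y - (FT y - cdf (P₁ p₀.theta) y))
          + (1 / (1 - p.lam) * (1 / (1 - p'.lam)) - (1 / (1 - p₀.lam)) ^ 2) *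
            (FT y - cdf (P₁ p₀.theta) y))
        + (1 - 1 / (1 - p.lam)) * (cdf (P₁ p'.theta) y - cdf (P₁ p.theta) y
          - inner ℝ (g y) (p'.theta - p.theta))
        - (1 / (1 - p.lam) - 1 / (1 - p₀.lam)) * inner ℝ (g y) (p'.theta - p.theta) := by
      rw [hinc p p' hp hp', linF0, Param.lam_sub, Param.theta_sub]
      ring
    rw [hdec, henv]
    have hn := norm_nonneg (p' - p)
    calc _ ≤ |p'.lam - p.lam| * ((1 / (1 - p.lam)) * (1 / (1 - p'.lam)) *
          |F y - cdf (P₁ p'.theta) y - (FT y - cdf (P₁ p₀.theta) y)|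
          + |1 / (1 - p.lam) * (1 / (1 - p'.lam)) - (1 / (1 - p₀.lam)) ^ 2| * E)
        + |1 - 1 / (1 - p.lam)| * |cdf (P₁ p'.theta) y - cdf (P₁ p.theta) y
          - inner ℝ (g y) (p'.theta - p.theta)|
        + |1 / (1 - p.lam) - 1 / (1 - p₀.lam)| * |inner ℝ (g y) (p'.theta - p.theta)| := by
          refine (abs_sub _ _).trans (add_le_add ((abs_add_le _ _).trans (add_le_add ?_ ?_)) ?_)
          · rw [abs_mul]
            refine mul_le_mul_of_nonneg_left ((abs_add_le _ _).trans ?_) (abs_nonneg _)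
            rw [abs_mul, abs_mul, abs_mul, abs_of_pos h1, abs_of_pos h1']
          · rw [abs_mul]
          · rw [abs_mul]
      _ ≤ ‖p' - p‖ * (A * A * (D + δ * B₁ y) + δ * (2 * A ^ 3) * E)
        + (1 + A) * (δ * B₂ y * ‖p' - p‖) + δ * A ^ 2 * (B₁ y * ‖p' - p‖) := by
          gcongr
          · exact hlam p p'
          · exact h1c p hp
          · exact hdc p hp
      _ ≤ _ := by
          have : C' * ‖p' - p‖ * (D + δ * (E + B₁ y + B₂ y)) -
            (‖p' - p‖ * (A * A * (D + δ * B₁ y) + δ * (2 * A ^ 3) * E)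
            + (1 + A) * (δ * B₂ y * ‖p' - p‖) + δ * A ^ 2 * (B₁ y * ‖p' - p‖)) =
            ‖p' - p‖ * ((C + 2 * A + 2 * A ^ 2 + 2 * A ^ 3 + 1) * D
              + δ * ((C + 2 * A + 3 * A ^ 2 + 1) * E
              + (C + 2 * A + A ^ 2 + 2 * A ^ 3 + 1) * B₁ y
              + (C + A + 3 * A ^ 2 + 2 * A ^ 3) * B₂ y)) := by
            rw [hC']; ring
          have h0 : 0 ≤ ‖p' - p‖ * ((C + 2 * A + 2 * A ^ 2 + 2 * A ^ 3 + 1) * D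
              + δ * ((C + 2 * A + 3 * A ^ 2 + 1) * E
              + (C + 2 * A + A ^ 2 + 2 * A ^ 3 + 1) * B₁ y
              + (C + A + 3 * A ^ 2 + 2 * A ^ 3) * B₂ y)) := by positivity
          linarith

end Perturbation

/-! ### Regularity of the constraint functional near the true value -/

/-- `F` is a measurable function with values in `[0, 1]` at `L¹`-distance at most `δ` from `FT`. -/
structure IsNear (FT : ℝ → ℝ) (δ : ℝ) (F : ℝ → ℝ) : Prop where
  measurable : Measurable F
  mem_Icc : ∀ y, 0 ≤ F y ∧ F y ≤ 1
  integrable : Integrable fun y => F y - FT y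
  integral_le : ∫ y, |F y - FT y| ≤ δ

/-- The functionals of the perturbed nonparametric component `F0 P₁ F p` that enter the criterion
are Lipschitz, and asymptotically linear, in `p`, uniformly for `F` near `FT`. The constant `C` does
not depend on `ε`. -/
structure IsRegularNear {d s : ℕ} {E : Type*} [NormedAddCommGroup E] [InnerProductSpace ℝ E]
    (k k' : ℝ → E) (P₁ : EuclideanSpace ℝ (Fin d) → Measure ℝ) (FT : ℝ → ℝ) (p₀ : Param d s)
    (g : ℝ → EuclideanSpace ℝ (Fin d)) (C ε δ : ℝ) : Prop where
  integrable : ∀ F, IsNear FT δ F → ∀ p, ‖p - p₀‖ < δ →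
    Integrable fun y => k (F0 P₁ F p y)
  norm_le : ∀ F, IsNear FT δ F → ∀ p, ‖p - p₀‖ < δ → ∀ y, ‖k (F0 P₁ F p y)‖ ≤ C
  integral_norm_le : ∀ F, IsNear FT δ F → ∀ p, ‖p - p₀‖ < δ → ∫ y, ‖k (F0 P₁ F p y)‖ ≤ C
  integral_norm_sub_le : ∀ F, IsNear FT δ F → ∀ p p', ‖p - p₀‖ < δ → ‖p' - p₀‖ < δ →
    ∫ y, ‖k (F0 P₁ F p' y) - k (F0 P₁ F p y)‖ ≤ C * ‖p' - p‖
  norm_integral_sub_le : ∀ F, IsNear FT δ F → ∀ p p', ‖p - p₀‖ < δ → ‖p' - p₀‖ < δ →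
    ‖(∫ y, k (F0 P₁ F p' y)) - (∫ y, k (F0 P₁ F p y))
      - ∫ y, linF0 P₁ FT p₀ g (p' - p) y • k' (F0 P₁ FT p₀ y)‖ ≤ ε * ‖p' - p‖
  abs_integral_inner_le : ∀ F, IsNear FT δ F → ∀ p, ‖p - p₀‖ < δ → ∀ v w,
    |(∫ y, inner ℝ v (k (F0 P₁ F p y)) * inner ℝ w (k (F0 P₁ F p y)))
      - ∫ y, inner ℝ v (k (F0 P₁ FT p₀ y)) * inner ℝ w (k (F0 P₁ FT p₀ y))|
      ≤ ε * ‖v‖ * ‖w‖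

section Regular

variable {d s : ℕ} {P₁ : EuclideanSpace ℝ (Fin d) → Measure ℝ} {FT : ℝ → ℝ} {p₀ : Param d s}
  {g : ℝ → EuclideanSpace ℝ (Fin d)} {B₁ B₂ : ℝ → ℝ} {ρ : ℝ}
  {E : Type*} [NormedAddCommGroup E] [InnerProductSpace ℝ E] [MeasurableSpace E]
  [BorelSpace E] [SecondCountableTopology E] {k k' : ℝ → E}

theorem measurable_F0 {F : ℝ → ℝ} (hF : Measurable F) (p : Param d s) :
    Measurable (F0 P₁ F p) :=
  (hF.const_mul _).sub ((monotone_cdf (P₁ p.theta)).measurable.const_mul _)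

theorem integrable_linF0 (hG : IsSmoothFamily (fun θ y => cdf (P₁ θ) y) p₀.theta g B₁ B₂ ρ)
    (hg : ∀ v, Measurable fun y => inner ℝ (g y) v)
    (hdiff : Integrable fun y => FT y - cdf (P₁ p₀.theta) y) (v : Param d s) :
    Integrable (linF0 P₁ FT p₀ g v) := by
  refine (hdiff.const_mul _).add (Integrable.const_mul ?_ _)
  refine (hG.integrable₁.mul_const ‖v.theta‖).mono' (hg _).aestronglyMeasurable
    (Eventually.of_forall fun y => ?_)
  exact (abs_real_inner_le_norm _ _).trans
    (mul_le_mul_of_nonneg_right (hG.norm_grad_le y) (norm_nonneg _))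

/-- The increments of `k (F0 P₁ F p y)` are dominated by an integrable envelope `B`. What is left of
the linearisation is an integral `∫ V * B` with `V` bounded and small only in `L¹`, which is made
small by truncating `B`. -/
theorem exists_isRegularNear (hp₀ : p₀.lam < 1)
    (hG : IsSmoothFamily (fun θ y => cdf (P₁ θ) y) p₀.theta g B₁ B₂ ρ)
    (hg : ∀ v, Measurable fun y => inner ℝ (g y) v)
    (hdiff : Integrable fun y => FT y - cdf (P₁ p₀.theta) y)
    (hFT : Measurable FT) (hFT01 : ∀ y, 0 ≤ FT y ∧ FT y ≤ 1)
    (hk : ∀ t, HasDerivAt k (k' t) t) (hk' : ContDiff ℝ 1 k')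
    (hki : Integrable fun y => k (F0 P₁ FT p₀ y)) :
    ∃ C, 0 ≤ C ∧ ∀ ε > 0, ∃ δ₀ > 0, ∀ δ ≤ δ₀, IsRegularNear k k' P₁ FT p₀ g C ε δ := by
  obtain ⟨C₁, δ₁, hC₁, hδ₁, hδ₁1, hb⟩ := F0_bounds (FT := FT) hp₀ hG
  obtain ⟨C₂, hC₂, hc⟩ := exists_curve_bound hk hk' C₁
  set B := envelope P₁ FT p₀ B₁ B₂ with hB
  have hBi : Integrable B := (hdiff.abs.add hG.integrable₁).add hG.integrable₂
  have hB0 : ∀ y, 0 ≤ B y := fun y =>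
    add_nonneg (add_nonneg (abs_nonneg _) ((norm_nonneg _).trans (hG.norm_grad_le y)))
      (hG.nonneg₂ y)
  set I := ∫ y, B y with hI
  have hI0 : 0 ≤ I := integral_nonneg hB0
  have hkc : Continuous k := continuous_iff_continuousAt.2 fun t => (hk t).continuousAt
  have hkm : ∀ F, Measurable F → ∀ p : Param d s, Measurable fun y => k (F0 P₁ F p y) :=
      fun F hF p =>
    hkc.measurable.comp (measurable_F0 hF p)
  have hU₀ : ∀ y, |F0 P₁ FT p₀ y| ≤ C₁ := fun y =>
    (hb δ₁ le_rfl FT hFT01 p₀ p₀ (by simpa) (by simpa) y).1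
  set N₀ := ∫ y, ‖k (F0 P₁ FT p₀ y)‖ with hN₀
  have hN₀0 : 0 ≤ N₀ := integral_nonneg fun _ => norm_nonneg _
  set C := C₂ + (C₂ * C₁ * (1 + I) + N₀) with hC
  have hC0 : 0 ≤ C := by rw [hC]; positivity
  -- the common `L¹` estimate of the deviation from the true component
  have hdev : ∀ δ ≤ δ₁, ∀ F, IsNear FT δ F → ∀ p, ‖p - p₀‖ < δ →
      Integrable (fun y => F0 P₁ F p y - F0 P₁ FT p₀ y) ∧
      ∫ y, |F0 P₁ F p y - F0 P₁ FT p₀ y| ≤ C₁ * (1 + I) * δ := by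
    intro δ hδ F hF p hp
    have hmaj : Integrable fun y => C₁ * (|F y - FT y| + δ * B y) :=
      (hF.integrable.abs.add (hBi.const_mul δ)).const_mul C₁
    have hle := fun y => (hb δ hδ F hF.mem_Icc p p hp hp y).2.1
    have hint : Integrable (fun y => F0 P₁ F p y - F0 P₁ FT p₀ y) :=
      hmaj.mono' ((measurable_F0 hF.measurable p).sub
        (measurable_F0 hFT p₀)).aestronglyMeasurable (Eventually.of_forall hle)
    refine ⟨hint, (integral_mono hint.abs hmaj hle).trans ?_⟩
    rw [integral_const_mul, integral_add hF.integrable.abs (hBi.const_mul δ), integral_const_mul]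
    have := hF.integral_le
    calc C₁ * ((∫ y, |F y - FT y|) + δ * I) ≤ C₁ * (δ + δ * I) := by gcongr
      _ = _ := by ring
  -- the integrals of `k`
  have hint : ∀ δ ≤ δ₁, ∀ F, IsNear FT δ F → ∀ p, ‖p - p₀‖ < δ →
      Integrable (fun y => k (F0 P₁ F p y)) ∧ (∀ y, ‖k (F0 P₁ F p y)‖ ≤ C) ∧
        ∫ y, ‖k (F0 P₁ F p y)‖ ≤ C := by
    intro δ hδ F hF p hp
    obtain ⟨hd, hd'⟩ := hdev δ hδ F hF p hp
    have hU := fun y => (hb δ hδ F hF.mem_Icc p p hp hp y).1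
    have hδpos : 0 < δ := (norm_nonneg _).trans_lt hp
    have hle : ∀ y, ‖k (F0 P₁ F p y) - k (F0 P₁ FT p₀ y)‖ ≤
        C₂ * |F0 P₁ F p y - F0 P₁ FT p₀ y| := fun y =>
      (hc _ _ _ (hU₀ y) (hU y) (hU y)).2.2.1
    have hsub : Integrable fun y => k (F0 P₁ F p y) - k (F0 P₁ FT p₀ y) :=
      (hd.abs.const_mul C₂).mono' ((hkm F hF.measurable p).sub
        (hkm FT hFT p₀)).aestronglyMeasurable (Eventually.of_forall hle)
    have hi : Integrable fun y => k (F0 P₁ F p y) :=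
      (hsub.add hki).congr (Eventually.of_forall fun y => sub_add_cancel _ _)
    refine ⟨hi, fun y => ((hc _ _ _ (hU y) (hU y) (hU y)).1).trans ?_, ?_⟩
    · have : 0 ≤ C₂ * C₁ * (1 + I) + N₀ := by positivity
      linarith
    · have hle' : ∀ y, ‖k (F0 P₁ F p y)‖ ≤ C₂ * |F0 P₁ F p y - F0 P₁ FT p₀ y| +
          ‖k (F0 P₁ FT p₀ y)‖ := fun y => by
        have := norm_le_norm_sub_add (k (F0 P₁ F p y)) (k (F0 P₁ FT p₀ y))
        linarith [hle y]
      refine (integral_mono hi.norm ((hd.abs.const_mul C₂).add hki.norm) hle').trans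
        ((integral_add (hd.abs.const_mul C₂) hki.norm).trans_le ?_)
      rw [integral_const_mul]
      have : C₂ * ∫ y, |F0 P₁ F p y - F0 P₁ FT p₀ y| ≤ C₂ * (C₁ * (1 + I) * 1) := by
        gcongr
        refine hd'.trans ?_
        gcongr
        exact hδ.trans hδ₁1
      linarith
  refine ⟨C, hC0, fun ε hε => ?_⟩
  -- `N` is the level at which the envelope is truncated: below it the remainder is `N` times an
  -- `L¹`-norm of order `δ`, above it a tail of `∫ B`
  have hC₂₁ : 0 < C₂ * C₁ + 1 := by positivity
  obtain ⟨N, hN, htr⟩ := exists_integral_mul_le hBi (4 * C₁)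
    (show 0 < ε / (2 * (C₂ * C₁ + 1)) by positivity)
  set K := C₂ * C₁ * (N * (2 * (C₁ * (1 + I))) + 4 * C₁ + 1 + I) + 2 * C₂ * C₂ * (C₁ * (1 + I))
    with hK
  have hK0 : 0 ≤ K := by rw [hK]; positivity
  refine ⟨min δ₁ (ε / (2 * (K + 1))), lt_min hδ₁ (by positivity), fun δ hδ => ?_⟩
  have hδ' : δ ≤ δ₁ := hδ.trans (min_le_left _ _)
  have hKδ : K * δ ≤ ε / 2 := by
    have h1 : δ ≤ ε / (2 * (K + 1)) := hδ.trans (min_le_right _ _)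
    rw [le_div_iff₀ (by positivity)] at h1
    rcases le_total δ 0 with h | h
    · exact (mul_nonpos_of_nonneg_of_nonpos hK0 h).trans (by positivity)
    · nlinarith
  refine ⟨fun F hF p hp => (hint δ hδ' F hF p hp).1, fun F hF p hp => (hint δ hδ' F hF p hp).2.1,
    fun F hF p hp => (hint δ hδ' F hF p hp).2.2, ?_, ?_, ?_⟩
  · intro F hF p p' hp hp'
    have hbd := hb δ hδ' F hF.mem_Icc p p' hp hp'
    have hbd' := hb δ hδ' F hF.mem_Icc p' p hp' hp
    have hle : ∀ y, ‖k (F0 P₁ F p' y) - k (F0 P₁ F p y)‖ ≤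
        C₂ * (C₁ * ‖p' - p‖ * (|F y - FT y| + B y)) := fun y =>
      ((hc _ _ _ (hbd y).1 (hbd' y).1 (hbd y).1).2.2.1).trans
        (mul_le_mul_of_nonneg_left (hbd y).2.2.1 hC₂)
    have hmaj : Integrable fun y => C₂ * (C₁ * ‖p' - p‖ * (|F y - FT y| + B y)) :=
      ((hF.integrable.abs.add hBi).const_mul _).const_mul _
    refine (integral_mono (((hint δ hδ' F hF p' hp').1.sub (hint δ hδ' F hF p hp).1).norm)
      hmaj hle).trans ?_
    rw [integral_const_mul, integral_const_mul, integral_add hF.integrable.abs hBi]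
    have h1 : (∫ y, |F y - FT y|) ≤ 1 := hF.integral_le.trans (hδ'.trans hδ₁1)
    calc _ ≤ C₂ * (C₁ * ‖p' - p‖ * (1 + I)) := by gcongr
      _ = C₂ * C₁ * (1 + I) * ‖p' - p‖ := by ring
      _ ≤ C * ‖p' - p‖ := by
        gcongr
        rw [hC]; linarith
  · intro F hF p p' hp hp'
    have hδpos : 0 < δ := (norm_nonneg _).trans_lt hp
    have hbd := hb δ hδ' F hF.mem_Icc p p' hp hp'
    have hbd' := hb δ hδ' F hF.mem_Icc p' p hp' hp
    obtain ⟨hi, -, -⟩ := hint δ hδ' F hF p hp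
    obtain ⟨hi', -, -⟩ := hint δ hδ' F hF p' hp'
    obtain ⟨hd, hdI⟩ := hdev δ hδ' F hF p hp
    obtain ⟨hd', hdI'⟩ := hdev δ hδ' F hF p' hp'
    have hl : Integrable fun y => linF0 P₁ FT p₀ g (p' - p) y • k' (F0 P₁ FT p₀ y) :=
      (integrable_linF0 hG hg hdiff _).smul_bdd C₂
        (hk'.continuous.measurable.comp (measurable_F0 hFT p₀)).aestronglyMeasurable
        (Eventually.of_forall fun y => (hc _ _ _ (hU₀ y) (hU₀ y) (hU₀ y)).2.1)
    have hs : Integrable fun y => k (F0 P₁ F p' y) - k (F0 P₁ F p y) := hi'.sub hi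
    rw [← integral_sub hi' hi, ← integral_sub hs hl]
    set V : ℝ → ℝ := fun y => |F0 P₁ F p y - F0 P₁ FT p₀ y| + |F0 P₁ F p' y - F0 P₁ FT p₀ y|
      with hV
    have hVi : Integrable V := hd.abs.add hd'.abs
    have hV0 : ∀ y, 0 ≤ V y := fun y => add_nonneg (abs_nonneg _) (abs_nonneg _)
    have hV4 : ∀ y, V y ≤ 4 * C₁ := fun y => by
      have h1 := abs_sub (F0 P₁ F p y) (F0 P₁ FT p₀ y)
      have h2 := abs_sub (F0 P₁ F p' y) (F0 P₁ FT p₀ y)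
      simp only [hV]
      linarith [(hbd y).1, (hbd' y).1, hU₀ y]
    have hVI : ∫ y, V y ≤ 2 * (C₁ * (1 + I)) * δ := by
      rw [hV, integral_add hd.abs hd'.abs]
      linarith
    have hVB : Integrable fun y => V y * B y :=
      hBi.bdd_mul (c := 4 * C₁) hVi.1 (Eventually.of_forall fun y => by
        rw [Real.norm_eq_abs, abs_of_nonneg (hV0 y)]; exact hV4 y)
    set W : ℝ → ℝ := fun y => V y * B y + ((4 * C₁ + 1) * |F y - FT y| + δ * B y) with hW
    have hWi : Integrable W :=
      hVB.add ((hF.integrable.abs.const_mul _).add (hBi.const_mul _))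
    have hle : ∀ y, ‖k (F0 P₁ F p' y) - k (F0 P₁ F p y)
        - linF0 P₁ FT p₀ g (p' - p) y • k' (F0 P₁ FT p₀ y)‖ ≤ C₂ * C₁ * ‖p' - p‖ * W y := by
      intro y
      have hq := hc _ _ _ (hbd y).1 (hbd' y).1 (hU₀ y)
      have hD1 : |F y - FT y| ≤ 1 := abs_le.2
        ⟨by linarith [(hF.mem_Icc y).1, (hFT01 y).2], by linarith [(hF.mem_Icc y).2, (hFT01 y).1]⟩
      have hkb := (hc _ _ _ (hU₀ y) (hU₀ y) (hU₀ y)).2.1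
      rw [show k (F0 P₁ F p' y) - k (F0 P₁ F p y)
        - linF0 P₁ FT p₀ g (p' - p) y • k' (F0 P₁ FT p₀ y) =
        (k (F0 P₁ F p' y) - k (F0 P₁ F p y) - (F0 P₁ F p' y - F0 P₁ F p y) • k' (F0 P₁ FT p₀ y))
        + (F0 P₁ F p' y - F0 P₁ F p y - linF0 P₁ FT p₀ g (p' - p) y) • k' (F0 P₁ FT p₀ y) by
          rw [sub_smul (F0 P₁ F p' y - F0 P₁ F p y)]; abel]
      refine (norm_add_le _ _).trans ?_
      rw [norm_smul, Real.norm_eq_abs]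
      calc _ ≤ C₂ * V y * (C₁ * ‖p' - p‖ * (|F y - FT y| + B y)) +
            C₁ * ‖p' - p‖ * (|F y - FT y| + δ * B y) * C₂ := by
              refine add_le_add (hq.2.2.2.trans ?_) ?_
              · exact mul_le_mul_of_nonneg_left (hbd y).2.2.1 (mul_nonneg hC₂ (hV0 y))
              · exact mul_le_mul (hbd y).2.2.2 hkb (norm_nonneg _)
                  ((abs_nonneg _).trans (hbd y).2.2.2)
        _ = C₂ * C₁ * ‖p' - p‖ * (V y * B y + (V y * |F y - FT y| + 1 * |F y - FT y|
              + δ * B y)) := by ring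
        _ ≤ C₂ * C₁ * ‖p' - p‖ * (V y * B y + (4 * C₁ * |F y - FT y| + 1 * |F y - FT y|
              + δ * B y)) := by
              gcongr
              exact hV4 y
        _ = _ := by simp only [hW]; ring
    refine (norm_integral_le_of_norm_le (hWi.const_mul _) (Eventually.of_forall hle)).trans ?_
    have hWI : ∫ y, W y = (∫ y, V y * B y) + ((4 * C₁ + 1) * (∫ y, |F y - FT y|) + δ * I) := by
      have h2 : Integrable fun y => (4 * C₁ + 1) * |F y - FT y| + δ * B y :=
        (hF.integrable.abs.const_mul _).add (hBi.const_mul _)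
      simp only [hW]
      rw [integral_add hVB h2, integral_add (hF.integrable.abs.const_mul _) (hBi.const_mul _),
        integral_const_mul, integral_const_mul]
    rw [integral_const_mul, hWI]
    have h1 := htr V hVi hV0 hV4
    have h2 : N * ∫ y, V y ≤ N * (2 * (C₁ * (1 + I)) * δ) := mul_le_mul_of_nonneg_left hVI hN
    have h3 : (4 * C₁ + 1) * ∫ y, |F y - FT y| ≤ (4 * C₁ + 1) * δ :=
      mul_le_mul_of_nonneg_left hF.integral_le (by positivity)
    have h4 : C₂ * C₁ * (ε / (2 * (C₂ * C₁ + 1))) ≤ ε / 2 := by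
      rw [mul_div_assoc', div_le_div_iff₀ (by positivity) (by positivity)]
      have : 0 ≤ C₂ * C₁ := by positivity
      nlinarith
    calc _ ≤ C₂ * C₁ * ‖p' - p‖ * ((N * (2 * (C₁ * (1 + I)) * δ) + ε / (2 * (C₂ * C₁ + 1)))
            + ((4 * C₁ + 1) * δ + δ * I)) := by
              have : 0 ≤ C₂ * C₁ * ‖p' - p‖ := by positivity
              refine mul_le_mul_of_nonneg_left ?_ this
              linarith
      _ = (C₂ * C₁ * (N * (2 * (C₁ * (1 + I))) + 4 * C₁ + 1 + I) * δ
            + C₂ * C₁ * (ε / (2 * (C₂ * C₁ + 1)))) * ‖p' - p‖ := by ring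
      _ ≤ (K * δ + ε / 2) * ‖p' - p‖ := by
            have h5 : C₂ * C₁ * (N * (2 * (C₁ * (1 + I))) + 4 * C₁ + 1 + I) ≤ K := by
              have : 0 ≤ 2 * C₂ * C₂ * (C₁ * (1 + I)) := by positivity
              linarith
            gcongr
      _ ≤ ε * ‖p' - p‖ := by
            gcongr
            linarith
  · intro F hF p hp v w
    have hδpos : 0 < δ := (norm_nonneg _).trans_lt hp
    obtain ⟨hi, hCb, -⟩ := hint δ hδ' F hF p hp
    obtain ⟨hd, hdI⟩ := hdev δ hδ' F hF p hp
    have hU := fun y => (hb δ hδ' F hF.mem_Icc p p hp hp y).1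
    have hprod : ∀ f : ℝ → E, Measurable f → Integrable f → (∀ y, ‖f y‖ ≤ C₂) →
        Integrable fun y => inner ℝ v (f y) * inner ℝ w (f y) := by
      intro f hfm hf hfb
      refine (hf.norm.const_mul (‖v‖ * ‖w‖ * C₂)).mono'
        ((hfm.const_inner).mul (hfm.const_inner)).aestronglyMeasurable
        (Eventually.of_forall fun y => ?_)
      rw [norm_mul]
      calc _ ≤ (‖v‖ * ‖f y‖) * (‖w‖ * ‖f y‖) :=
            mul_le_mul (norm_inner_le_norm _ _) (norm_inner_le_norm _ _) (norm_nonneg _)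
              (by positivity)
        _ = ‖v‖ * ‖w‖ * ‖f y‖ * ‖f y‖ := by ring
        _ ≤ ‖v‖ * ‖w‖ * C₂ * ‖f y‖ := by gcongr; exact hfb y
    have hb1 : ∀ y, ‖k (F0 P₁ F p y)‖ ≤ C₂ := fun y => (hc _ _ _ (hU y) (hU y) (hU y)).1
    have hb0 : ∀ y, ‖k (F0 P₁ FT p₀ y)‖ ≤ C₂ := fun y => (hc _ _ _ (hU₀ y) (hU₀ y) (hU₀ y)).1
    rw [← integral_sub (hprod _ (hkm F hF.measurable p) hi hb1)
      (hprod _ (hkm FT hFT p₀) hki hb0)]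
    have hle : ∀ y, ‖inner ℝ v (k (F0 P₁ F p y)) * inner ℝ w (k (F0 P₁ F p y))
        - inner ℝ v (k (F0 P₁ FT p₀ y)) * inner ℝ w (k (F0 P₁ FT p₀ y))‖ ≤
        ‖v‖ * ‖w‖ * (2 * C₂ * C₂) * |F0 P₁ F p y - F0 P₁ FT p₀ y| := by
      intro y
      have hsub := (hc _ _ _ (hU₀ y) (hU y) (hU y)).2.2.1
      rw [show inner ℝ v (k (F0 P₁ F p y)) * inner ℝ w (k (F0 P₁ F p y))
        - inner ℝ v (k (F0 P₁ FT p₀ y)) * inner ℝ w (k (F0 P₁ FT p₀ y)) =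
        inner ℝ v (k (F0 P₁ F p y) - k (F0 P₁ FT p₀ y)) * inner ℝ w (k (F0 P₁ F p y))
        + inner ℝ v (k (F0 P₁ FT p₀ y)) * inner ℝ w (k (F0 P₁ F p y) - k (F0 P₁ FT p₀ y)) by
          rw [inner_sub_right, inner_sub_right]; ring]
      refine (norm_add_le _ _).trans ?_
      rw [norm_mul, norm_mul]
      calc _ ≤ ‖v‖ * (C₂ * |F0 P₁ F p y - F0 P₁ FT p₀ y|) * (‖w‖ * C₂)
            + ‖v‖ * C₂ * (‖w‖ * (C₂ * |F0 P₁ F p y - F0 P₁ FT p₀ y|)) := by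
              gcongr
              · exact (norm_inner_le_norm _ _).trans (by gcongr)
              · exact (norm_inner_le_norm _ _).trans (by gcongr; exact hb1 y)
              · exact (norm_inner_le_norm _ _).trans (by gcongr; exact hb0 y)
              · exact (norm_inner_le_norm _ _).trans (by gcongr)
        _ = _ := by ring
    refine (norm_integral_le_of_norm_le (hd.abs.const_mul _) (Eventually.of_forall hle)).trans ?_
    rw [integral_const_mul]
    calc _ ≤ ‖v‖ * ‖w‖ * (2 * C₂ * C₂) * (C₁ * (1 + I) * δ) := by gcongr
      _ = (2 * C₂ * C₂ * (C₁ * (1 + I)) * δ) * ‖v‖ * ‖w‖ := by ring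
      _ ≤ (K * δ) * ‖v‖ * ‖w‖ := by
          have : 0 ≤ C₂ * C₁ * (N * (2 * (C₁ * (1 + I))) + 4 * C₁ + 1 + I) := by positivity
          gcongr
          linarith
      _ ≤ ε * ‖v‖ * ‖w‖ := by
          gcongr
          linarith

end Regular

/-! ### The criterion as a concave function of the multiplier -/

section Criterion

variable {E : Type*} [NormedAddCommGroup E] [InnerProductSpace ℝ E]

/-- The criterion `ξ ↦ ⟪ξ, c⟫ - ∫ ψ(⟪ξ, K⟫)` for a fixed constraint value `c` and a fixed curve
`K`. -/
noncomputable def multiplierCriterion (ψ : ℝ → ℝ) (c : E) (K : ℝ → E) (ξ : E) : ℝ :=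
  inner ℝ ξ c - ∫ y, ψ (inner ℝ ξ (K y))

variable {ψ : ℝ → ℝ} {K K' : ℝ → E} {c c' : E} {C : ℝ}

theorem integrable_comp_inner (hψ : ContDiff ℝ 2 ψ) (h0 : ψ 0 = 0) (hK : Integrable K)
    (hC : ∀ y, ‖K y‖ ≤ C) (ξ : E) : Integrable fun y => ψ (inner ℝ ξ (K y)) := by
  obtain ⟨M, hM⟩ := (isCompact_Icc (a := -(‖ξ‖ * C)) (b := ‖ξ‖ * C)).exists_bound_of_continuousOn
    (hψ.continuous_deriv (by norm_num)).continuousOn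
  have hle : ∀ y, |inner ℝ ξ (K y)| ≤ ‖ξ‖ * C := fun y =>
    (abs_real_inner_le_norm _ _).trans (mul_le_mul_of_nonneg_left (hC y) (norm_nonneg _))
  refine ((hK.const_inner (𝕜 := ℝ) ξ).norm.const_mul M).mono'
    (hψ.continuous.comp_aestronglyMeasurable (hK.const_inner (𝕜 := ℝ) ξ).1)
    (Eventually.of_forall fun y => ?_)
  have h00 : (0 : ℝ) ∈ Set.Icc (-(‖ξ‖ * C)) (‖ξ‖ * C) := by
    have := (abs_nonneg _).trans (hle y)
    exact ⟨by linarith, this⟩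
  have := (convex_Icc (-(‖ξ‖ * C)) (‖ξ‖ * C)).norm_image_sub_le_of_norm_deriv_le
    (fun x _ => hψ.differentiable (by norm_num) x) hM h00 (abs_le.1 (hle y))
  simpa [h0] using this

theorem concaveOn_multiplierCriterion (hψ : ContDiff ℝ 2 ψ) (h0 : ψ 0 = 0)
    (hconv : ConvexOn ℝ Set.univ ψ) (hK : Integrable K) (hC : ∀ y, ‖K y‖ ≤ C) :
    ConcaveOn ℝ Set.univ (multiplierCriterion ψ c K) := by
  refine ⟨convex_univ, fun a _ b _ u v hu hv huv => ?_⟩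
  have hi := integrable_comp_inner hψ h0 hK hC
  have h : ∫ y, ψ (inner ℝ (u • a + v • b) (K y)) ≤
      u * (∫ y, ψ (inner ℝ a (K y))) + v * ∫ y, ψ (inner ℝ b (K y)) := by
    rw [← integral_const_mul, ← integral_const_mul,
      ← integral_add ((hi a).const_mul u) ((hi b).const_mul v)]
    refine integral_mono (hi _) (((hi a).const_mul u).add ((hi b).const_mul v)) fun y => ?_
    simpa [inner_add_left, real_inner_smul_left] using
      hconv.2 (Set.mem_univ (inner ℝ a (K y))) (Set.mem_univ (inner ℝ b (K y))) hu hv huv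
  simp only [multiplierCriterion, inner_add_left, real_inner_smul_left, smul_eq_mul] at h ⊢
  linarith

theorem integrable_inner_mul_inner (hK : Integrable K) (hC : ∀ y, ‖K y‖ ≤ C) (v w : E) :
    Integrable fun y => inner ℝ v (K y) * inner ℝ w (K y) :=
  (hK.const_inner (𝕜 := ℝ) w).bdd_mul (c := ‖v‖ * C) (hK.const_inner (𝕜 := ℝ) v).1
    (Eventually.of_forall fun y => (norm_inner_le_norm _ _).trans
      (mul_le_mul_of_nonneg_left (hC y) (norm_nonneg _)))

/-- Strong concavity of the criterion near the origin, seen from a maximiser. -/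
theorem multiplierCriterion_add_le (hψ : ContDiff ℝ 2 ψ) (h0 : ψ 0 = 0) (hK : Integrable K)
    (hC : ∀ y, ‖K y‖ ≤ C) {τ : ℝ} (hτ : ∀ a b, |a| ≤ τ → |b| ≤ τ →
      ψ ((a + b) / 2) ≤ (ψ a + ψ b) / 2 - (b - a) ^ 2 / 16) {ξ ζ : E}
    (hmax : ∀ η, multiplierCriterion ψ c K η ≤ multiplierCriterion ψ c K ξ)
    (hξ : ‖ξ‖ * C ≤ τ) (hζ : ‖ζ‖ * C ≤ τ) :
    multiplierCriterion ψ c K ζ + (∫ y, inner ℝ (ζ - ξ) (K y) * inner ℝ (ζ - ξ) (K y)) / 8 ≤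
      multiplierCriterion ψ c K ξ := by
  have hi := integrable_comp_inner hψ h0 hK hC
  have hq := integrable_inner_mul_inner hK hC (ζ - ξ) (ζ - ξ)
  have hle : ∀ η : E, ‖η‖ * C ≤ τ → ∀ y, |inner ℝ η (K y)| ≤ τ := fun η hη y =>
    ((abs_real_inner_le_norm _ _).trans
      (mul_le_mul_of_nonneg_left (hC y) (norm_nonneg _))).trans hη
  have hmid := hmax ((1 / 2 : ℝ) • (ξ + ζ))
  have h : ∫ y, ψ (inner ℝ ((1 / 2 : ℝ) • (ξ + ζ)) (K y)) ≤
      ∫ y, (((1 / 2) * ψ (inner ℝ ξ (K y)) + (1 / 2) * ψ (inner ℝ ζ (K y)))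
        - (1 / 16) * (inner ℝ (ζ - ξ) (K y) * inner ℝ (ζ - ξ) (K y))) := by
    refine integral_mono (hi _) ((((hi ξ).const_mul _).add ((hi ζ).const_mul _)).sub
      (hq.const_mul _)) fun y => ?_
    have := hτ _ _ (hle ξ hξ y) (hle ζ hζ y)
    simp only [real_inner_smul_left, inner_add_left, inner_sub_left]
    rw [show 1 / 2 * (inner ℝ ξ (K y) + inner ℝ ζ (K y)) =
      (inner ℝ ξ (K y) + inner ℝ ζ (K y)) / 2 by ring]
    linarith
  have h12 : Integrable fun y =>
      (1 / 2) * ψ (inner ℝ ξ (K y)) + (1 / 2) * ψ (inner ℝ ζ (K y)) :=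
    ((hi ξ).const_mul _).add ((hi ζ).const_mul _)
  rw [integral_sub h12 (hq.const_mul _), integral_add ((hi ξ).const_mul _) ((hi ζ).const_mul _),
    integral_const_mul, integral_const_mul, integral_const_mul] at h
  simp only [multiplierCriterion] at hmid ⊢
  rw [real_inner_smul_left, inner_add_left] at hmid
  linarith

/-- The first-order condition at a maximiser, with the derivative of `ψ` replaced by its linear
part. -/
theorem abs_inner_sub_le_of_max [CompleteSpace E] (hψ : ContDiff ℝ 2 ψ) (h0 : ψ 0 = 0)
    (hK : Integrable K) (hC : ∀ y, ‖K y‖ ≤ C) {τ ε : ℝ}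
    (hτ : ∀ t, |t| ≤ τ → |deriv ψ t - 1 - t| ≤ ε * |t|) {ξ : E}
    (hmax : ∀ η, multiplierCriterion ψ c K η ≤ multiplierCriterion ψ c K ξ)
    (hξ : ‖ξ‖ * C ≤ τ) (hε : 0 ≤ ε) (ζ : E) :
    |inner ℝ ζ (c - ∫ y, K y) - ∫ y, inner ℝ ζ (K y) * inner ℝ ξ (K y)| ≤
      ε * ‖ξ‖ * ‖ζ‖ * (C * ∫ y, ‖K y‖) := by
  have hi := integrable_comp_inner hψ h0 hK hC
  have hCnn : 0 ≤ C := (norm_nonneg _).trans (hC 0)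
  have hc' : Continuous (deriv ψ) := hψ.continuous_deriv (by norm_num)
  set R := (‖ξ‖ + ‖ζ‖) * C with hR
  obtain ⟨M, hM⟩ := (isCompact_Icc (a := -R) (b := R)).exists_bound_of_continuousOn
    hc'.continuousOn
  have hle : ∀ η : E, ∀ y, |inner ℝ η (K y)| ≤ ‖η‖ * C := fun η y =>
    (abs_real_inner_le_norm _ _).trans (mul_le_mul_of_nonneg_left (hC y) (norm_nonneg _))
  have hD : HasDerivAt (fun t : ℝ => ∫ y, ψ (inner ℝ (ξ + t • ζ) (K y)))
      (∫ y, deriv ψ (inner ℝ (ξ + (0 : ℝ) • ζ) (K y)) * inner ℝ ζ (K y)) 0 := by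
    refine (hasDerivAt_integral_of_dominated_loc_of_deriv_le
      (F := fun (t : ℝ) y => ψ (inner ℝ (ξ + t • ζ) (K y)))
      (F' := fun (t : ℝ) y => deriv ψ (inner ℝ (ξ + t • ζ) (K y)) * inner ℝ ζ (K y))
      (bound := fun y => M * |inner ℝ ζ (K y)|) (Metric.ball_mem_nhds (0 : ℝ) one_pos)
      (Eventually.of_forall fun t => (hi _).1) (hi _) ?_ ?_ ?_ ?_).2
    · exact (hc'.comp_aestronglyMeasurable (hK.const_inner (𝕜 := ℝ) _).1).mul
        (hK.const_inner (𝕜 := ℝ) _).1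
    · refine Eventually.of_forall fun y t ht => ?_
      rw [norm_mul, Real.norm_eq_abs (inner ℝ ζ (K y))]
      refine mul_le_mul_of_nonneg_right (hM _ (abs_le.1 ((hle _ y).trans ?_))) (abs_nonneg _)
      refine mul_le_mul_of_nonneg_right ((norm_add_le _ _).trans ?_) hCnn
      rw [norm_smul]
      have : ‖t‖ ≤ 1 := (mem_ball_zero_iff.1 ht).le
      have := mul_le_of_le_one_left (norm_nonneg ζ) this
      linarith
    · exact (hK.const_inner (𝕜 := ℝ) ζ).norm.const_mul M
    · refine Eventually.of_forall fun y t _ => ?_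
      have h1 : HasDerivAt (fun t : ℝ => inner ℝ (ξ + t • ζ) (K y)) (inner ℝ ζ (K y)) t := by
        simp only [inner_add_left, real_inner_smul_left]
        simpa using ((hasDerivAt_id t).mul_const (inner ℝ ζ (K y))).const_add (inner ℝ ξ (K y))
      exact ((hψ.differentiable (by norm_num)) _).hasDerivAt.comp t h1
  have hD2 : HasDerivAt (fun t : ℝ => multiplierCriterion ψ c K (ξ + t • ζ))
      (inner ℝ ζ c - ∫ y, deriv ψ (inner ℝ (ξ + (0 : ℝ) • ζ) (K y)) * inner ℝ ζ (K y)) 0 := by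
    refine HasDerivAt.sub ?_ hD
    simp only [inner_add_left, real_inner_smul_left]
    simpa using ((hasDerivAt_id (0 : ℝ)).mul_const (inner ℝ ζ c)).const_add (inner ℝ ξ c)
  have hloc : IsLocalMax (fun t : ℝ => multiplierCriterion ψ c K (ξ + t • ζ)) 0 :=
    Eventually.of_forall fun t => by simpa using hmax (ξ + t • ζ)
  have hz := hloc.hasDerivAt_eq_zero hD2
  rw [zero_smul, add_zero] at hz
  have hi1 : Integrable fun y => deriv ψ (inner ℝ ξ (K y)) * inner ℝ ζ (K y) := by
    refine (hK.const_inner (𝕜 := ℝ) ζ).bdd_mul (c := M)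
      (hc'.comp_aestronglyMeasurable (hK.const_inner (𝕜 := ℝ) _).1)
      (Eventually.of_forall fun y => ?_)
    refine hM _ (abs_le.1 ((hle _ y).trans ?_))
    exact mul_le_mul_of_nonneg_right (by linarith [norm_nonneg ζ]) hCnn
  have hi2 := integrable_inner_mul_inner hK hC ζ ξ
  have heq : inner ℝ ζ (c - ∫ y, K y) - ∫ y, inner ℝ ζ (K y) * inner ℝ ξ (K y) =
      ∫ y, (deriv ψ (inner ℝ ξ (K y)) * inner ℝ ζ (K y) - inner ℝ ζ (K y)
        - inner ℝ ζ (K y) * inner ℝ ξ (K y)) := by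
    have h3 : Integrable fun y => deriv ψ (inner ℝ ξ (K y)) * inner ℝ ζ (K y) - inner ℝ ζ (K y) :=
      hi1.sub (hK.const_inner (𝕜 := ℝ) ζ)
    rw [integral_sub h3 hi2, integral_sub hi1 (hK.const_inner (𝕜 := ℝ) ζ), integral_inner hK ζ,
      inner_sub_right]
    linarith
  rw [heq]
  have hfin : ∀ y, ‖deriv ψ (inner ℝ ξ (K y)) * inner ℝ ζ (K y) - inner ℝ ζ (K y)
        - inner ℝ ζ (K y) * inner ℝ ξ (K y)‖ ≤ ε * ‖ξ‖ * ‖ζ‖ * (C * ‖K y‖) := by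
    intro y
    rw [show deriv ψ (inner ℝ ξ (K y)) * inner ℝ ζ (K y) - inner ℝ ζ (K y)
        - inner ℝ ζ (K y) * inner ℝ ξ (K y) =
        (deriv ψ (inner ℝ ξ (K y)) - 1 - inner ℝ ξ (K y)) * inner ℝ ζ (K y) by ring, norm_mul]
    calc _ ≤ ε * (‖ξ‖ * C) * (‖ζ‖ * ‖K y‖) := by
          refine mul_le_mul ((hτ _ ((hle ξ y).trans hξ)).trans ?_) (norm_inner_le_norm _ _)
            (norm_nonneg _) (by positivity)
          exact mul_le_mul_of_nonneg_left (hle ξ y) hε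
      _ = _ := by ring
  refine (norm_integral_le_of_norm_le ((hK.norm.const_mul C).const_mul _)
    (Eventually.of_forall hfin)).trans_eq ?_
  rw [integral_const_mul, integral_const_mul]

/-- The criterion depends on the curve mainly through the linear functional
`⟪ξ, c - ∫ K⟫`. -/
theorem abs_multiplierCriterion_sub_le [CompleteSpace E] (hψ : ContDiff ℝ 2 ψ) (h0 : ψ 0 = 0)
    (hK : Integrable K) (hC : ∀ y, ‖K y‖ ≤ C) (hK' : Integrable K') (hC' : ∀ y, ‖K' y‖ ≤ C)
    {τ ε : ℝ} (hτ : ∀ a b, |a| ≤ τ → |b| ≤ τ → |ψ b - ψ a - (b - a)| ≤ ε * |b - a|) {ξ : E}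
    (hξ : ‖ξ‖ * C ≤ τ) (hε : 0 ≤ ε) :
    |multiplierCriterion ψ c' K' ξ - multiplierCriterion ψ c K ξ
      - inner ℝ ξ ((c' - ∫ y, K' y) - (c - ∫ y, K y))| ≤ ε * ‖ξ‖ * ∫ y, ‖K' y - K y‖ := by
  have hi := integrable_comp_inner hψ h0 hK hC ξ
  have hi' := integrable_comp_inner hψ h0 hK' hC' ξ
  have hle : ∀ x : E, ‖x‖ ≤ C → |inner ℝ ξ x| ≤ τ := fun x hx =>
    ((abs_real_inner_le_norm _ _).trans
      (mul_le_mul_of_nonneg_left hx (norm_nonneg _))).trans hξ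
  have hs1 : Integrable fun y => ψ (inner ℝ ξ (K' y)) - ψ (inner ℝ ξ (K y)) := hi'.sub hi
  have hs2 : Integrable fun y => inner ℝ ξ (K' y) - inner ℝ ξ (K y) :=
    (hK'.const_inner (𝕜 := ℝ) ξ).sub (hK.const_inner (𝕜 := ℝ) ξ)
  have heq : multiplierCriterion ψ c' K' ξ - multiplierCriterion ψ c K ξ
      - inner ℝ ξ ((c' - ∫ y, K' y) - (c - ∫ y, K y)) =
      -∫ y, (ψ (inner ℝ ξ (K' y)) - ψ (inner ℝ ξ (K y))
        - (inner ℝ ξ (K' y) - inner ℝ ξ (K y))) := by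
    rw [integral_sub hs1 hs2, integral_sub hi' hi,
      integral_sub (hK'.const_inner (𝕜 := ℝ) ξ) (hK.const_inner (𝕜 := ℝ) ξ), integral_inner hK ξ,
      integral_inner hK' ξ, multiplierCriterion, multiplierCriterion]
    simp only [inner_sub_right]
    ring
  rw [heq, abs_neg, ← integral_const_mul, ← Real.norm_eq_abs]
  have hs3 : Integrable fun y => K' y - K y := hK'.sub hK
  refine norm_integral_le_of_norm_le (hs3.norm.const_mul (ε * ‖ξ‖))
    (Eventually.of_forall fun y => ?_)
  refine (hτ _ _ (hle _ (hC y)) (hle _ (hC' y))).trans ?_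
  rw [← inner_sub_right, mul_assoc]
  exact mul_le_mul_of_nonneg_left (abs_real_inner_le_norm _ _) hε

end Criterion

/-! ### The first-order condition in the parameter -/

/-- A minimiser in `p` of `sup_ξ H(p, ξ)` is approximately stationary at the maximising `ξ`. The
value function is not differentiated: the maximisers at `p + t v` are compared with the one at
`p`, from which they differ by `O(√t)` thanks to the strong concavity `hsc`. -/
theorem abs_inner_le_of_minimax {E P : Type*} [NormedAddCommGroup E] [InnerProductSpace ℝ E]
    [FiniteDimensional ℝ E] [NormedAddCommGroup P] [NormedSpace ℝ P] {H : P → E → ℝ}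
    {p₀ p : P} {ξ : E} {J : P →L[ℝ] E} {δ r c ε : ℝ} (hc : 0 < c)
    (hε : 0 ≤ ε) (hp : ‖p - p₀‖ < δ) (hξ : ‖ξ‖ < r)
    (hmin : ∀ q, ‖q - p₀‖ < δ → ∀ ζ, (∀ ζ', H q ζ' ≤ H q ζ) → H p ξ ≤ H q ζ)
    (hconc : ∀ q, ‖q - p₀‖ < δ → ConcaveOn ℝ Set.univ (H q))
    (hinc : ∀ q q', ‖q - p₀‖ < δ → ‖q' - p₀‖ < δ → ∀ ζ, ‖ζ‖ ≤ r →
      |H q' ζ - H q ζ - inner ℝ ζ (J (q' - q))| ≤ ε * ‖ζ‖ * ‖q' - q‖)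
    (hsc : ∀ ζ, ‖ζ‖ ≤ r → H p ζ + c * ‖ζ - ξ‖ ^ 2 ≤ H p ξ) (v : P) :
    |inner ℝ ξ (J v)| ≤ ε * ‖ξ‖ * ‖v‖ := by
  suffices h : ∀ v, 0 ≤ inner ℝ ξ (J v) + ε * ‖ξ‖ * ‖v‖ by
    have h1 := h v
    have h2 := h (-v)
    rw [map_neg, inner_neg_right, norm_neg] at h2
    exact abs_le.2 ⟨by linarith, by linarith⟩
  intro v
  have hcl : IsClosed {ζ : E | 0 ≤ inner ℝ ζ (J v) + ε * ‖ζ‖ * ‖v‖} :=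
    isClosed_le continuous_const (by fun_prop)
  refine hcl.closure_subset (Metric.mem_closure_iff.2 fun η hη => ?_)
  have hr : 0 < r := (norm_nonneg _).trans_lt hξ
  set A := (‖J‖ + ε) * r * ‖v‖ with hA
  have hA0 : 0 ≤ A := by rw [hA]; positivity
  set m := min η (r - ‖ξ‖) with hm
  have hm0 : 0 < m := lt_min hη (by linarith)
  -- a step `t` for which the maximiser at `p + t v` stays inside the ball
  obtain ⟨t, ht, ht1, ht2⟩ : ∃ t > 0, ‖p + t • v - p₀‖ < δ ∧ 2 * t * A < c * m ^ 2 := by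
    have h1 : ∀ᶠ t in 𝓝 (0 : ℝ), ‖p + t • v - p₀‖ < δ := by
      have : Continuous fun t : ℝ => ‖p + t • v - p₀‖ := by fun_prop
      exact this.continuousAt.eventually_lt continuousAt_const (by simpa using hp)
    have h2 : ∀ᶠ t in 𝓝 (0 : ℝ), 2 * t * A < c * m ^ 2 := by
      have : Continuous fun t : ℝ => 2 * t * A := by fun_prop
      exact this.continuousAt.eventually_lt continuousAt_const (by simp; positivity)
    obtain ⟨t, ⟨h3, h4⟩, ht⟩ :=
      (((h1.and h2).filter_mono nhdsWithin_le_nhds).and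
        (self_mem_nhdsWithin : Set.Ioi (0 : ℝ) ∈ 𝓝[>] 0)).exists
    exact ⟨t, ht, h3, h4⟩
  set q := p + t • v with hq
  have hqp : q - p = t • v := by rw [hq]; abel
  have hJ : ∀ ζ : E, inner ℝ ζ (J (q - p)) = t * inner ℝ ζ (J v) := fun ζ => by
    rw [hqp, map_smul, real_inner_smul_right]
  have hn : ‖q - p‖ = t * ‖v‖ := by rw [hqp, norm_smul, Real.norm_of_nonneg ht.le]
  have hinc' : ∀ ζ, ‖ζ‖ ≤ r → |H q ζ - H p ζ| ≤ t * A := by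
    intro ζ hζ
    have h1 := hinc p q hp ht1 ζ hζ
    have h2 : |inner ℝ ζ (J (q - p))| ≤ ‖ζ‖ * (‖J‖ * (t * ‖v‖)) :=
      (abs_real_inner_le_norm _ _).trans
        (mul_le_mul_of_nonneg_left ((J.le_opNorm _).trans_eq (by rw [hn])) (norm_nonneg _))
    rw [hn] at h1
    calc |H q ζ - H p ζ| = |(H q ζ - H p ζ - inner ℝ ζ (J (q - p))) + inner ℝ ζ (J (q - p))| := by
          congr 1; ring
      _ ≤ ε * ‖ζ‖ * (t * ‖v‖) + ‖ζ‖ * (‖J‖ * (t * ‖v‖)) :=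
          (abs_add_le _ _).trans (add_le_add h1 h2)
      _ = t * ((‖J‖ + ε) * ‖ζ‖ * ‖v‖) := by ring
      _ ≤ t * A := by rw [hA]; gcongr
  obtain ⟨ζ, hζr, hζ⟩ := (isCompact_closedBall (0 : E) r).exists_isMaxOn
    ⟨0, Metric.mem_closedBall_self hr.le⟩
    (((hconc q ht1).continuousOn isOpen_univ).mono (Set.subset_univ _))
  have hζr' : ‖ζ‖ ≤ r := mem_closedBall_zero_iff.1 hζr
  have h1 : H q ξ ≤ H q ζ := hζ (mem_closedBall_zero_iff.2 hξ.le)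
  have h2 := abs_le.1 (hinc' ζ hζr')
  have h3 := abs_le.1 (hinc' ξ hξ.le)
  have h4 := hsc ζ hζr'
  have h5 : ‖ζ - ξ‖ < m := by
    have : c * ‖ζ - ξ‖ ^ 2 < c * m ^ 2 := by linarith
    exact lt_of_pow_lt_pow_left₀ 2 hm0.le (lt_of_mul_lt_mul_left this hc.le)
  have h6 : ‖ζ‖ < r := by
    have := norm_le_norm_sub_add ζ ξ
    linarith [min_le_right η (r - ‖ξ‖)]
  have hloc : IsLocalMax (H q) ζ := by
    filter_upwards [Metric.isOpen_ball.mem_nhds (mem_ball_zero_iff.2 h6)] with x hx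
    exact hζ (Metric.ball_subset_closedBall hx)
  have hglob := IsMaxOn.of_isLocalMax_of_convex_univ hloc (hconc q ht1)
  have h7 := hmin q ht1 ζ hglob
  have h8 := (abs_le.1 (hinc p q hp ht1 ζ hζr')).2
  rw [hJ, hn] at h8
  refine ⟨ζ, ?_, ?_⟩
  · have h9 : 0 ≤ t * (inner ℝ ζ (J v) + ε * ‖ζ‖ * ‖v‖) := by
      have : 0 ≤ c * ‖ζ - ξ‖ ^ 2 := by positivity
      linarith
    exact nonneg_of_mul_nonneg_right h9 ht
  · rw [dist_comm, dist_eq_norm]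
    exact h5.trans_le (min_le_left _ _)

/-! ### Linearisation of the estimating equations -/

section Linearisation

variable {d s ℓ : ℕ} {P₁ : EuclideanSpace ℝ (Fin d) → Measure ℝ} {FT : ℝ → ℝ} {p₀ : Param d s}
  {g : ℝ → EuclideanSpace ℝ (Fin d)} {ψ : ℝ → ℝ}
  {m : EuclideanSpace ℝ (Fin s) → EuclideanSpace ℝ (Fin (ℓ - 1))}
  {m' : EuclideanSpace ℝ (Fin s) →L[ℝ] EuclideanSpace ℝ (Fin (ℓ - 1))}
  {Φ : Set (Param d s)}

theorem criterion_eq (F : ℝ → ℝ) (p : Param d s) :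
    criterion ψ P₁ m F p =
      multiplierCriterion ψ (m p.alpha) (fun y => vecK ℓ (F0 P₁ F p y)) := rfl

/-- The saddle value of an estimate is at most the value of the criterion at a maximiser in the
multiplier, for every other admissible parameter. -/
theorem IsEstimate.le_of_max {F : ℝ → ℝ} {p q : Param d s}
    {ξ ζ : EuclideanSpace ℝ (Fin (ℓ - 1))} (h : IsEstimate Φ ψ P₁ m F p ξ) (hq : q ∈ Φ)
    (hζ : ∀ ζ', criterion ψ P₁ m F q ζ' ≤ criterion ψ P₁ m F q ζ) :
    criterion ψ P₁ m F p ξ ≤ criterion ψ P₁ m F q ζ := by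
  rw [← EReal.coe_le_coe_iff]
  calc ((criterion ψ P₁ m F p ξ : ℝ) : EReal)
      ≤ ⨆ ζ, ((criterion ψ P₁ m F p ζ : ℝ) : EReal) :=
        le_iSup (fun ζ => ((criterion ψ P₁ m F p ζ : ℝ) : EReal)) ξ
    _ ≤ ⨆ ζ, ((criterion ψ P₁ m F q ζ : ℝ) : EReal) := h.2.1 hq
    _ ≤ _ := iSup_le fun ζ' => EReal.coe_le_coe_iff.2 (hζ ζ')

theorem norm_le_of_abs_inner_le {E : Type*} [NormedAddCommGroup E] [InnerProductSpace ℝ E] {x : E}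
    {M : ℝ} (hM : 0 ≤ M) (h : ∀ ζ, |inner ℝ ζ x| ≤ M * ‖ζ‖) : ‖x‖ ≤ M := by
  have := h x
  rw [real_inner_self_eq_norm_sq, abs_of_nonneg (sq_nonneg _)] at this
  by_contra! hlt
  have hpos := hM.trans_lt hlt
  nlinarith

/-- The two estimating equations, up to errors that are small relative to the unknowns. -/
theorem exists_estimating_equations
    (hψC2 : ContDiff ℝ 2 ψ) (h0 : ψ 0 = 0) (h1 : deriv ψ 0 = 1) (h2 : iteratedDeriv 2 ψ 0 = 1)
    (hconv : ConvexOn ℝ Set.univ ψ)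
    {C : ℝ} (hC : 0 ≤ C) (hreg : ∀ ε > 0, ∃ δ₀ > 0, ∀ δ ≤ δ₀,
      IsRegularNear (vecK ℓ) (vecL ℓ) P₁ FT p₀ g C ε δ)
    (hm : HasStrictFDerivAt m m' p₀.alpha) (hΦ : p₀ ∈ interior Φ)
    (J : Param d s →L[ℝ] EuclideanSpace ℝ (Fin (ℓ - 1)))
    (hJ : ∀ v, J v = m' v.alpha - ∫ y, linF0 P₁ FT p₀ g v y • vecL ℓ (F0 P₁ FT p₀ y))
    (S : EuclideanSpace ℝ (Fin (ℓ - 1)) →L[ℝ] EuclideanSpace ℝ (Fin (ℓ - 1)))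
    (hS : ∀ v w, inner ℝ v (S w) =
      ∫ y, inner ℝ v (vecK ℓ (F0 P₁ FT p₀ y)) * inner ℝ w (vecK ℓ (F0 P₁ FT p₀ y)))
    {c : ℝ} (hc : 0 < c) (hcS : ∀ v, c * ‖v‖ ^ 2 ≤ inner ℝ v (S v)) {ε : ℝ} (hε : 0 < ε) :
    ∃ δ > 0, ∀ F, IsNear FT δ F → ∀ p ξ, ‖p - p₀‖ < δ → ‖ξ‖ < δ → IsEstimate Φ ψ P₁ m F p ξ →
      ‖J (p - p₀) - S ξ - ((∫ y, vecK ℓ (F0 P₁ F p₀ y)) - m p₀.alpha)‖ ≤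
        ε * (‖p - p₀‖ + ‖ξ‖) ∧
      ∀ v, |inner ℝ ξ (J v)| ≤ ε * ‖ξ‖ * ‖v‖ := by
  -- the choice of the tolerances
  set εr := min (ε / 3) (c / 2) with hεr
  have hεr0 : 0 < εr := lt_min (by positivity) (by positivity)
  set ε₁ := ε / (3 * (C + 1)) with hε₁
  have hε₁0 : 0 < ε₁ := by positivity
  set ε₂ := ε / (3 * (C * C + 1)) with hε₂
  have hε₂0 : 0 < ε₂ := by positivity
  have hε₁C : ε₁ * C ≤ ε / 3 := by
    rw [hε₁, div_mul_eq_mul_div, div_le_div_iff₀ (by positivity) (by positivity)]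
    nlinarith
  have hε₂C : ε₂ * (C * C) ≤ ε / 3 := by
    rw [hε₂, div_mul_eq_mul_div, div_le_div_iff₀ (by positivity) (by positivity)]
    nlinarith
  obtain ⟨τ₁, hτ₁, hψ1⟩ := abs_sub_sub_le_near_zero hψC2 h1 hε₁0
  obtain ⟨τ₂, hτ₂, hψ2⟩ := deriv_sub_isLittleO hψC2 h1 h2 hε₂0
  obtain ⟨τ₃, hτ₃, hψ3⟩ := midpoint_strongConvex_near_zero hψC2 h2
  set τ := min τ₁ (min τ₂ τ₃) with hτ
  have hτ0 : 0 < τ := lt_min hτ₁ (lt_min hτ₂ hτ₃)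
  have hττ₁ : τ ≤ τ₁ := min_le_left _ _
  have hττ₂ : τ ≤ τ₂ := (min_le_right _ _).trans (min_le_left _ _)
  have hττ₃ : τ ≤ τ₃ := (min_le_right _ _).trans (min_le_right _ _)
  set r := τ / (C + 1) with hr
  have hr0 : 0 < r := by positivity
  have hrC : ∀ x : EuclideanSpace ℝ (Fin (ℓ - 1)), ‖x‖ ≤ r → ‖x‖ * C ≤ τ := by
    intro x hx
    calc ‖x‖ * C ≤ r * (C + 1) := by gcongr; linarith
      _ = τ := by rw [hr]; field_simp
  obtain ⟨δ₁, hδ₁, hreg⟩ := hreg εr hεr0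
  obtain ⟨δ₂, hδ₂, hmδ⟩ : ∃ δ > 0, ∀ a b, ‖a - p₀.alpha‖ < δ → ‖b - p₀.alpha‖ < δ →
      ‖m b - m a - m' (b - a)‖ ≤ ε / 3 * ‖b - a‖ := by
    have h := (hasStrictFDerivAt_iff_isLittleO.1 hm).def (show 0 < ε / 3 by positivity)
    obtain ⟨δ, hδ, h⟩ := Metric.eventually_nhds_iff_ball.1 h
    refine ⟨δ, hδ, fun a b ha hb => h (b, a) ?_⟩
    rw [← ball_prod_same]
    exact ⟨mem_ball_iff_norm.2 hb, mem_ball_iff_norm.2 ha⟩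
  obtain ⟨δ₃, hδ₃, hΦδ⟩ := Metric.mem_nhds_iff.1 (mem_interior_iff_mem_nhds.1 hΦ)
  set δ := min r (min δ₁ (min δ₂ δ₃)) with hδ
  have hδr : δ ≤ r := min_le_left _ _
  have hδδ₁ : δ ≤ δ₁ := (min_le_right _ _).trans (min_le_left _ _)
  have hδδ₂ : δ ≤ δ₂ := (min_le_right _ _).trans ((min_le_right _ _).trans (min_le_left _ _))
  have hδδ₃ : δ ≤ δ₃ := (min_le_right _ _).trans ((min_le_right _ _).trans (min_le_right _ _))
  have hδ0 : 0 < δ := lt_min hr0 (lt_min hδ₁ (lt_min hδ₂ hδ₃))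
  refine ⟨δ, hδ0, fun F hF p ξ hp hξ hest => ?_⟩
  have R := hreg δ hδδ₁
  -- strict differentiability of the constraint functional
  have hsd : ∀ q q' : Param d s, ‖q - p₀‖ < δ → ‖q' - p₀‖ < δ →
      ‖((m q'.alpha - ∫ y, vecK ℓ (F0 P₁ F q' y)) - (m q.alpha - ∫ y, vecK ℓ (F0 P₁ F q y)))
        - J (q' - q)‖ ≤ (ε / 3 + ε / 3) * ‖q' - q‖ := by
    intro q q' hq hq'
    have e1 := R.norm_integral_sub_le F hF q q' hq hq'
    have e2 := hmδ q.alpha q'.alpha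
      (((Param.norm_alpha_le (q - p₀)).trans_lt hq).trans_le hδδ₂)
      (((Param.norm_alpha_le (q' - p₀)).trans_lt hq').trans_le hδδ₂)
    have e3 : ‖q'.alpha - q.alpha‖ ≤ ‖q' - q‖ := Param.norm_alpha_le (q' - q)
    rw [hJ, Param.alpha_sub]
    rw [show (m q'.alpha - ∫ y, vecK ℓ (F0 P₁ F q' y)) - (m q.alpha - ∫ y, vecK ℓ (F0 P₁ F q y))
        - (m' (q'.alpha - q.alpha)
          - ∫ y, linF0 P₁ FT p₀ g (q' - q) y • vecL ℓ (F0 P₁ FT p₀ y)) =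
        (m q'.alpha - m q.alpha - m' (q'.alpha - q.alpha))
        - ((∫ y, vecK ℓ (F0 P₁ F q' y)) - (∫ y, vecK ℓ (F0 P₁ F q y))
          - ∫ y, linF0 P₁ FT p₀ g (q' - q) y • vecL ℓ (F0 P₁ FT p₀ y)) by abel]
    refine (norm_sub_le _ _).trans ?_
    rw [add_mul]
    refine add_le_add (e2.trans (by gcongr)) (e1.trans ?_)
    gcongr
    exact min_le_left _ _
  have hmax : ∀ η, multiplierCriterion ψ (m p.alpha) (fun y => vecK ℓ (F0 P₁ F p y)) η ≤
      multiplierCriterion ψ (m p.alpha) (fun y => vecK ℓ (F0 P₁ F p y)) ξ := fun η =>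
    hest.2.2 (Set.mem_univ η)
  have hξr : ‖ξ‖ ≤ r := hξ.le.trans hδr
  have hKi := R.integrable F hF p hp
  have hKC := R.norm_le F hF p hp
  constructor
  · have hfoc : ‖(m p.alpha - ∫ y, vecK ℓ (F0 P₁ F p y)) - S ξ‖ ≤ (ε / 3 + ε / 3) * ‖ξ‖ := by
      refine norm_le_of_abs_inner_le (by positivity) fun ζ => ?_
      have e1 := abs_inner_sub_le_of_max hψC2 h0 hKi hKC
        (fun t ht => hψ2 t (ht.trans hττ₂)) hmax (hrC ξ hξr) hε₂0.le ζ
      have e2 := R.abs_integral_inner_le F hF p hp ζ ξ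
      have e3 : C * ∫ y, ‖vecK ℓ (F0 P₁ F p y)‖ ≤ C * C :=
        mul_le_mul_of_nonneg_left (R.integral_norm_le F hF p hp) hC
      rw [← hS] at e2
      rw [inner_sub_right]
      calc _ = |(inner ℝ ζ (m p.alpha - ∫ y, vecK ℓ (F0 P₁ F p y))
              - ∫ y, inner ℝ ζ (vecK ℓ (F0 P₁ F p y)) * inner ℝ ξ (vecK ℓ (F0 P₁ F p y)))
              + ((∫ y, inner ℝ ζ (vecK ℓ (F0 P₁ F p y)) * inner ℝ ξ (vecK ℓ (F0 P₁ F p y)))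
              - inner ℝ ζ (S ξ))| := by congr 1; ring
        _ ≤ ε₂ * ‖ξ‖ * ‖ζ‖ * (C * C) + εr * ‖ζ‖ * ‖ξ‖ := by
            refine (abs_add_le _ _).trans (add_le_add (e1.trans ?_) e2)
            gcongr
        _ = (ε₂ * (C * C) + εr) * ‖ξ‖ * ‖ζ‖ := by ring
        _ ≤ _ := by
            gcongr
            exact min_le_left _ _
    have e4 := hsd p₀ p (by simpa using hδ0) hp
    rw [show J (p - p₀) - S ξ - ((∫ y, vecK ℓ (F0 P₁ F p₀ y)) - m p₀.alpha) =
      ((m p.alpha - ∫ y, vecK ℓ (F0 P₁ F p y)) - S ξ)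
      - (((m p.alpha - ∫ y, vecK ℓ (F0 P₁ F p y))
        - (m p₀.alpha - ∫ y, vecK ℓ (F0 P₁ F p₀ y))) - J (p - p₀)) by abel]
    refine (norm_sub_le _ _).trans ((add_le_add hfoc e4).trans ?_)
    have := norm_nonneg (p - p₀)
    have := norm_nonneg ξ
    nlinarith
  · refine fun v => abs_inner_le_of_minimax (H := criterion ψ P₁ m F) (p₀ := p₀) (δ := δ) (r := δ)
      (c := c / 16) (by positivity) hε.le hp hξ ?_ ?_ ?_ ?_ v
    · exact fun q hq ζ hζ => hest.le_of_max (hΦδ (mem_ball_iff_norm.2 (hq.trans_le hδδ₃))) hζ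
    · exact fun q hq => concaveOn_multiplierCriterion hψC2 h0 hconv (R.integrable F hF q hq)
        (R.norm_le F hF q hq)
    · intro q q' hq hq' ζ hζ
      have e1 := abs_multiplierCriterion_sub_le (c := m q.alpha) (c' := m q'.alpha) hψC2 h0
        (R.integrable F hF q hq)
        (R.norm_le F hF q hq) (R.integrable F hF q' hq') (R.norm_le F hF q' hq')
        (fun a b ha hb => hψ1 a b (ha.trans hττ₁) (hb.trans hττ₁)) (hrC ζ (hζ.trans hδr)) hε₁0.le
      have e2 := hsd q q' hq hq'
      have e3 := R.integral_norm_sub_le F hF q q' hq hq'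
      rw [criterion_eq, criterion_eq]
      rw [← sub_add_sub_cancel _ (inner ℝ ζ ((m q'.alpha - ∫ y, vecK ℓ (F0 P₁ F q' y))
        - (m q.alpha - ∫ y, vecK ℓ (F0 P₁ F q y)))) (inner ℝ ζ (J (q' - q))), ← inner_sub_right]
      refine (abs_add_le _ _).trans ((add_le_add e1 (abs_real_inner_le_norm _ _)).trans ?_)
      calc _ ≤ ε₁ * ‖ζ‖ * (C * ‖q' - q‖) + ‖ζ‖ * ((ε / 3 + ε / 3) * ‖q' - q‖) := by gcongr
        _ = (ε₁ * C + (ε / 3 + ε / 3)) * ‖ζ‖ * ‖q' - q‖ := by ring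
        _ ≤ ε * ‖ζ‖ * ‖q' - q‖ := by
            gcongr
            linarith
    · intro ζ hζ
      have e1 := multiplierCriterion_add_le hψC2 h0 hKi hKC
        (fun a b ha hb => hψ3 a b (ha.trans hττ₃) (hb.trans hττ₃)) hmax (hrC ξ hξr)
        (hrC ζ (hζ.trans hδr))
      have e2 := (abs_le.1 (R.abs_integral_inner_le F hF p hp (ζ - ξ) (ζ - ξ))).1
      rw [← hS] at e2
      have e3 := hcS (ζ - ξ)
      have e4 : εr * ‖ζ - ξ‖ * ‖ζ - ξ‖ ≤ c / 2 * ‖ζ - ξ‖ * ‖ζ - ξ‖ := by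
        gcongr
        exact min_le_right _ _
      rw [criterion_eq]
      nlinarith

/-- Solving a perturbed linear saddle-point system. -/
theorem exists_solution_bound {X E : Type*} [NormedAddCommGroup X] [InnerProductSpace ℝ X]
    [NormedAddCommGroup E] [InnerProductSpace ℝ E]
    (J : X →L[ℝ] E) (Jt : E →L[ℝ] X) (S T : E →L[ℝ] E) (V : X →L[ℝ] X)
    (hJt : ∀ e x, inner ℝ e (J x) = inner ℝ (Jt e) x)
    (hTS : ∀ e, T (S e) = e) (hV : ∀ x, V (Jt (T (J x))) = x) {η : ℝ} (hη : 0 < η) :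
    ∃ ε > 0, ∀ x ξ Z, ‖J x - S ξ - Z‖ ≤ ε * (‖x‖ + ‖ξ‖) →
      (∀ v, |inner ℝ ξ (J v)| ≤ ε * ‖ξ‖ * ‖v‖) →
      ‖x - V (Jt (T Z))‖ + ‖ξ + (T Z - T (J (V (Jt (T Z)))))‖ ≤ η * ‖Z‖ := by
  set H : E →L[ℝ] X := V ∘L Jt ∘L T with hH
  set a := ‖H‖ + ‖V‖ with ha
  set M := a + (‖T ∘L J‖ * a + ‖T‖) with hM
  set N := ‖H‖ + ‖T - T ∘L J ∘L H‖ with hN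
  have ha0 : 0 ≤ a := by positivity
  have hM0 : 0 ≤ M := by positivity
  have hN0 : 0 ≤ N := by positivity
  refine ⟨min (1 / (4 * (M + 1))) (η / (4 * (M + 1) * (N + 1))), by positivity, ?_⟩
  intro x ξ Z h1 h2
  set ε := min (1 / (4 * (M + 1))) (η / (4 * (M + 1) * (N + 1))) with hε
  have hε0 : 0 < ε := by positivity
  have hεM : 2 * M * ε ≤ 1 / 2 := by
    have : ε ≤ 1 / (4 * (M + 1)) := min_le_left _ _
    rw [le_div_iff₀ (by positivity)] at this
    nlinarith
  have hεη : 4 * M * N * ε ≤ η := by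
    have : ε ≤ η / (4 * (M + 1) * (N + 1)) := min_le_right _ _
    rw [le_div_iff₀ (by positivity)] at this
    have h3 : 0 ≤ M * N * ε := by positivity
    have h4 : 0 ≤ M * ε := by positivity
    have h5 : 0 ≤ N * ε := by positivity
    nlinarith
  have h3 : ‖Jt ξ‖ ≤ ε * ‖ξ‖ := norm_le_of_abs_inner_le (by positivity) fun v => by
    rw [real_inner_comm, ← hJt]
    exact h2 v
  set r := J x - S ξ - Z with hr
  have hJx : J x = r + S ξ + Z := by rw [hr]; abel
  have hx : x - H Z = H r + V (Jt ξ) := by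
    have h4 : x = H (J x) := (hV x).symm
    have h5 : H (S ξ) = V (Jt ξ) := by simp only [hH, ContinuousLinearMap.comp_apply, hTS]
    rw [hJx, map_add, map_add, h5] at h4
    nth_rewrite 1 [h4]
    abel
  have hξ : ξ + (T Z - T (J (H Z))) = T (J (x - H Z)) - T r := by
    have h4 : ξ = T (J x) - T Z - T r := by
      rw [← map_sub, ← map_sub, hJx]
      rw [show r + S ξ + Z - Z - r = S ξ by abel, hTS]
    rw [map_sub, map_sub]
    nth_rewrite 1 [h4]
    abel
  have hb1 : ‖x - H Z‖ ≤ a * (‖r‖ + ‖Jt ξ‖) := by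
    rw [hx]
    calc _ ≤ ‖H‖ * ‖r‖ + ‖V‖ * ‖Jt ξ‖ :=
          (norm_add_le _ _).trans (add_le_add (H.le_opNorm _) (V.le_opNorm _))
      _ ≤ a * ‖r‖ + a * ‖Jt ξ‖ := by
          gcongr
          · rw [ha]; linarith [norm_nonneg V]
          · rw [ha]; linarith [norm_nonneg H]
      _ = _ := by ring
  have hb2 : ‖ξ + (T Z - T (J (H Z)))‖ ≤ (‖T ∘L J‖ * a + ‖T‖) * (‖r‖ + ‖Jt ξ‖) := by
    rw [hξ]
    calc _ ≤ ‖T ∘L J‖ * (a * (‖r‖ + ‖Jt ξ‖)) + ‖T‖ * (‖r‖ + ‖Jt ξ‖) := by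
          refine (norm_sub_le _ _).trans (add_le_add
            (((T ∘L J).le_opNorm _).trans (by gcongr)) ((T.le_opNorm _).trans ?_))
          gcongr
          linarith [norm_nonneg (Jt ξ)]
      _ = _ := by ring
  have hb : ‖x - H Z‖ + ‖ξ + (T Z - T (J (H Z)))‖ ≤ 2 * M * ε * (‖x‖ + ‖ξ‖) := by
    calc _ ≤ M * (‖r‖ + ‖Jt ξ‖) := by rw [hM, add_mul]; exact add_le_add hb1 hb2
      _ ≤ M * (ε * (‖x‖ + ‖ξ‖) + ε * (‖x‖ + ‖ξ‖)) := by
          gcongr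
          exact h3.trans (by gcongr; linarith [norm_nonneg x])
      _ = _ := by ring
  have hxξ : ‖x‖ + ‖ξ‖ ≤ N * ‖Z‖ + (‖x - H Z‖ + ‖ξ + (T Z - T (J (H Z)))‖) := by
    have h5 : ‖x‖ ≤ ‖x - H Z‖ + ‖H‖ * ‖Z‖ :=
      (norm_le_norm_sub_add x (H Z)).trans (add_le_add le_rfl (H.le_opNorm _))
    have h6 : ‖ξ‖ ≤ ‖ξ + (T Z - T (J (H Z)))‖ + ‖T - T ∘L J ∘L H‖ * ‖Z‖ := by
      have := norm_le_norm_add_norm_sub' ξ (-(T - T ∘L J ∘L H) Z)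
      have h7 : ξ - -(T - T ∘L J ∘L H) Z = ξ + (T Z - T (J (H Z))) := by
        rw [sub_neg_eq_add]; rfl
      rw [h7, norm_neg] at this
      linarith [(T - T ∘L J ∘L H).le_opNorm Z]
    rw [hN, add_mul]
    linarith
  have hs : ‖x‖ + ‖ξ‖ ≤ 2 * N * ‖Z‖ := by
    have : 2 * M * ε * (‖x‖ + ‖ξ‖) ≤ 1 / 2 * (‖x‖ + ‖ξ‖) := by gcongr
    linarith
  calc _ ≤ 2 * M * ε * (‖x‖ + ‖ξ‖) := hb
    _ ≤ 2 * M * ε * (2 * N * ‖Z‖) := by gcongr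
    _ = (4 * M * N * ε) * ‖Z‖ := by ring
    _ ≤ η * ‖Z‖ := by gcongr

end Linearisation

/-! ### The matrices of the limit law as linear maps -/

section MatrixMaps

variable {m n o : Type*} [Fintype m] [Fintype n] [Fintype o] [DecidableEq n]

/-- The continuous linear map between Euclidean spaces given by a rectangular matrix. -/
noncomputable def matCLM (M : Matrix m n ℝ) : EuclideanSpace ℝ n →L[ℝ] EuclideanSpace ℝ m :=
  LinearMap.toContinuousLinearMap (Matrix.toLpLin 2 2 M)

theorem matCLM_apply (M : Matrix m n ℝ) (v : EuclideanSpace ℝ n) (i : m) :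
    matCLM M v i = ∑ j, M i j * v j := by
  simp [matCLM, Matrix.toLpLin_apply, Matrix.mulVec, dotProduct]

theorem matCLM_mul [DecidableEq o] (M : Matrix m n ℝ) (N : Matrix n o ℝ) (v : EuclideanSpace ℝ o) :
    matCLM (M * N) v = matCLM M (matCLM N v) := by
  simp [matCLM, Matrix.toLpLin_apply]

theorem matCLM_one (v : EuclideanSpace ℝ n) : matCLM (1 : Matrix n n ℝ) v = v := by
  simp [matCLM]

theorem matCLM_sub (M N : Matrix m n ℝ) (v : EuclideanSpace ℝ n) :
    matCLM (M - N) v = matCLM M v - matCLM N v := by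
  simp [matCLM]

theorem inner_matCLM [DecidableEq m] (M : Matrix m n ℝ) (w : EuclideanSpace ℝ m)
    (v : EuclideanSpace ℝ n) :
    inner ℝ w (matCLM M v) = inner ℝ (matCLM Mᵀ w) v := by
  simp only [PiLp.inner_apply, matCLM_apply, RCLike.inner_apply, conj_trivial,
    Matrix.transpose_apply, Finset.mul_sum, Finset.sum_mul]
  rw [Finset.sum_comm]
  exact Finset.sum_congr rfl fun i _ => Finset.sum_congr rfl fun j _ => by ring

end MatrixMaps

section Maps

variable {d s ℓ : ℕ} {P₁ : EuclideanSpace ℝ (Fin d) → Measure ℝ} {FT : ℝ → ℝ} {p₀ : Param d s}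
  {B₁ B₂ : ℝ → ℝ} {ρ : ℝ}
  {m : EuclideanSpace ℝ (Fin s) → EuclideanSpace ℝ (Fin (ℓ - 1))}

theorem integrable_linF0_smul_vecL {g : ℝ → EuclideanSpace ℝ (Fin d)}
    (hG : IsSmoothFamily (fun θ y => cdf (P₁ θ) y) p₀.theta g B₁ B₂ ρ)
    (hg : ∀ v, Measurable fun y => inner ℝ (g y) v)
    (hdiff : Integrable fun y => FT y - cdf (P₁ p₀.theta) y)
    (hL : AEStronglyMeasurable fun y => vecL ℓ (F0 P₁ FT p₀ y)) {C : ℝ}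
    (hC : ∀ y, ‖vecL ℓ (F0 P₁ FT p₀ y)‖ ≤ C) (v : Param d s) :
    Integrable fun y => linF0 P₁ FT p₀ g v y • vecL ℓ (F0 P₁ FT p₀ y) :=
  (integrable_linF0 hG hg hdiff v).smul_bdd C hL (Eventually.of_forall hC)

theorem matCLM_matJphixi
    (hG : IsSmoothFamily (fun θ y => cdf (P₁ θ) y) p₀.theta
      (fun y => gradient (fun θ => cdf (P₁ θ) y) p₀.theta) B₁ B₂ ρ)
    (hg : ∀ v, Measurable fun y => inner ℝ (gradient (fun θ => cdf (P₁ θ) y) p₀.theta) v)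
    (hp₀ : p₀.lam ≠ 1)
    (hdiff : Integrable fun y => FT y - cdf (P₁ p₀.theta) y)
    (hL : AEStronglyMeasurable fun y => vecL ℓ (F0 P₁ FT p₀ y)) {C : ℝ}
    (hC : ∀ y, ‖vecL ℓ (F0 P₁ FT p₀ y)‖ ≤ C) (v : Param d s) :
    matCLM (matJphixi P₁ m FT p₀) v = fderiv ℝ m p₀.alpha v.alpha
      - ∫ y, linF0 P₁ FT p₀ (fun y => gradient (fun θ => cdf (P₁ θ) y) p₀.theta) v y
        • vecL ℓ (F0 P₁ FT p₀ y) := by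
  set g : ℝ → EuclideanSpace ℝ (Fin d) := fun y => gradient (fun θ => cdf (P₁ θ) y) p₀.theta
    with hgdef
  have hint := integrable_linF0_smul_vecL (ℓ := ℓ) hG hg hdiff hL hC v
  ext i
  have hderiv : ∀ u, deriv (integratedLegendre (i + 2)) u = vecL ℓ u i := fun u =>
    (hasDerivAt_integratedLegendre (i + 2) u).deriv
  have hLi : AEStronglyMeasurable fun y => vecL ℓ (F0 P₁ FT p₀ y) i :=
    (EuclideanSpace.proj (𝕜 := ℝ) i).continuous.comp_aestronglyMeasurable hL
  have hCi : ∀ y, ‖vecL ℓ (F0 P₁ FT p₀ y) i‖ ≤ C := fun y => (PiLp.norm_apply_le _ i).trans (hC y)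
  have hgj : ∀ j, Integrable fun y => g y j * vecL ℓ (F0 P₁ FT p₀ y) i := by
    intro j
    have hgi : Integrable fun y => g y j := by
      refine hG.integrable₁.mono' ?_ (Eventually.of_forall fun y =>
        (PiLp.norm_apply_le _ j).trans (hG.norm_grad_le y))
      have := hg (EuclideanSpace.single j 1)
      simp only [EuclideanSpace.inner_single_right] at this
      simpa using this.aestronglyMeasurable
    exact hgi.mul_bdd (c := C) hLi (Eventually.of_forall hCi)
  have hdi : Integrable fun y => (FT y - cdf (P₁ p₀.theta) y) * vecL ℓ (F0 P₁ FT p₀ y) i :=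
    hdiff.mul_bdd (c := C) hLi (Eventually.of_forall hCi)
  have hproj : (∫ y, linF0 P₁ FT p₀ g v y • vecL ℓ (F0 P₁ FT p₀ y)) i =
      ∫ y, linF0 P₁ FT p₀ g v y * vecL ℓ (F0 P₁ FT p₀ y) i :=
    ((EuclideanSpace.proj (𝕜 := ℝ) i).integral_comp_comm hint).symm
  have hsplit : ∫ y, linF0 P₁ FT p₀ g v y * vecL ℓ (F0 P₁ FT p₀ y) i =
      v.lam * (1 / (1 - p₀.lam)) ^ 2 *
        (∫ y, (FT y - cdf (P₁ p₀.theta) y) * vecL ℓ (F0 P₁ FT p₀ y) i)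
      + (1 - 1 / (1 - p₀.lam)) * ∑ j, v.theta j * ∫ y, g y j * vecL ℓ (F0 P₁ FT p₀ y) i := by
    have hs : Integrable fun y => ∑ j, v.theta j * (g y j * vecL ℓ (F0 P₁ FT p₀ y) i) :=
      integrable_finsetSum _ fun j _ => (hgj j).const_mul _
    simp_rw [← integral_const_mul]
    rw [← integral_finsetSum _ fun j _ => (hgj j).const_mul _, ← integral_const_mul,
      ← integral_add (hdi.const_mul _) (hs.const_mul _)]
    refine integral_congr_ae (Eventually.of_forall fun y => ?_)
    simp only [linF0, PiLp.inner_apply, RCLike.inner_apply, conj_trivial]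
    rw [add_mul, mul_assoc _ (∑ j, _), Finset.sum_mul]
    congr 1
    · ring
    · congr 1
      exact Finset.sum_congr rfl fun j _ => by ring
  have hfd : (fderiv ℝ m p₀.alpha v.alpha) i =
      ∑ j, v.alpha j * (fderiv ℝ m p₀.alpha (EuclideanSpace.single j 1)) i := by
    have : v.alpha = ∑ j, v.alpha j • EuclideanSpace.single j (1 : ℝ) := by
      ext k
      simp [Pi.single_apply]
    nth_rewrite 1 [this]
    simp [map_sum, map_smul]
  have hc : p₀.lam / (1 - p₀.lam) = -(1 - 1 / (1 - p₀.lam)) := by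
    have : 1 - p₀.lam ≠ 0 := sub_ne_zero.2 (Ne.symm hp₀)
    field_simp
    ring
  have hJ1 : ∫ y, (1 / (1 - p₀.lam) ^ 2 * FT y - 1 / (1 - p₀.lam) ^ 2 * cdf (P₁ p₀.theta) y) *
      vecL ℓ (F0 P₁ FT p₀ y) i = (1 / (1 - p₀.lam)) ^ 2 *
      ∫ y, (FT y - cdf (P₁ p₀.theta) y) * vecL ℓ (F0 P₁ FT p₀ y) i := by
    rw [← integral_const_mul]
    refine integral_congr_ae (Eventually.of_forall fun y => ?_)
    simp only [one_div, inv_pow]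
    ring
  rw [matCLM_apply, PiLp.sub_apply, hproj, hsplit, hfd, Fintype.sum_sum_type, Fintype.sum_sum_type]
  simp only [matJphixi, Matrix.of_apply, Sum.elim_inl, Sum.elim_inr, hderiv, hJ1, hc,
    Finset.univ_unique, Finset.sum_singleton]
  have hs2 : ∑ j, -(1 - 1 / (1 - p₀.lam)) * (∫ y, g y j * vecL ℓ (F0 P₁ FT p₀ y) i) *
      v (Sum.inr (Sum.inl j)) = -((1 - 1 / (1 - p₀.lam)) *
        ∑ j, v.theta j * ∫ y, g y j * vecL ℓ (F0 P₁ FT p₀ y) i) := by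
    rw [Finset.mul_sum, ← Finset.sum_neg_distrib]
    refine Finset.sum_congr rfl fun j _ => ?_
    change _ * _ * v.theta j = _
    ring
  have hs3 : ∑ j, (fderiv ℝ m p₀.alpha (EuclideanSpace.single j 1)) i * v (Sum.inr (Sum.inr j)) =
      ∑ j, v.alpha j * (fderiv ℝ m p₀.alpha (EuclideanSpace.single j 1)) i :=
    Finset.sum_congr rfl fun j _ => mul_comm _ _
  have hs1 : v (Sum.inl default) = v.lam := rfl
  rw [hs2, hs3, hs1]
  ring

theorem inner_matCLM_matJxixi (hki : ∀ i j : Fin (ℓ - 1), Integrable fun y =>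
      vecK ℓ (F0 P₁ FT p₀ y) i * vecK ℓ (F0 P₁ FT p₀ y) j)
    (v w : EuclideanSpace ℝ (Fin (ℓ - 1))) :
    inner ℝ v (matCLM (matJxixi P₁ FT p₀ ℓ) w) =
      ∫ y, inner ℝ v (vecK ℓ (F0 P₁ FT p₀ y)) * inner ℝ w (vecK ℓ (F0 P₁ FT p₀ y)) := by
  simp only [PiLp.inner_apply, RCLike.inner_apply, conj_trivial, matCLM_apply]
  simp_rw [Finset.sum_mul_sum]
  have hi : ∀ i j, Integrable fun y =>
      vecK ℓ (F0 P₁ FT p₀ y) i * v i * (vecK ℓ (F0 P₁ FT p₀ y) j * w j) := fun i j =>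
    ((hki i j).const_mul (v i * w j)).congr (Eventually.of_forall fun y => by ring)
  rw [integral_finsetSum _ fun i _ => integrable_finsetSum _ fun j _ => hi i j]
  refine Finset.sum_congr rfl fun i _ => ?_
  rw [integral_finsetSum _ fun j _ => hi i j, Finset.sum_mul]
  refine Finset.sum_congr rfl fun j _ => ?_
  have hJ : matJxixi P₁ FT p₀ ℓ i j =
    ∫ y, vecK ℓ (F0 P₁ FT p₀ y) i * vecK ℓ (F0 P₁ FT p₀ y) j := rfl
  rw [hJ, mul_assoc, ← integral_mul_const]
  exact integral_congr_ae (Eventually.of_forall fun y => by ring)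

/-- An invertible Gram matrix is uniformly positive definite. -/
theorem exists_le_inner_gram {E : Type*} [NormedAddCommGroup E] [InnerProductSpace ℝ E]
    [FiniteDimensional ℝ E] {K : ℝ → E} {C : ℝ} (hK : Integrable K) (hC : ∀ y, ‖K y‖ ≤ C)
    (S : E →L[ℝ] E) (hS : ∀ v w, inner ℝ v (S w) = ∫ y, inner ℝ v (K y) * inner ℝ w (K y))
    (hinj : ∀ v, S v = 0 → v = 0) :
    ∃ c > 0, ∀ v, c * ‖v‖ ^ 2 ≤ inner ℝ v (S v) := by
  have hpos : ∀ v, v ≠ 0 → 0 < inner ℝ v (S v) := by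
    intro v hv
    have hnn : ∀ y, 0 ≤ inner ℝ v (K y) * inner ℝ v (K y) := fun y => mul_self_nonneg _
    rw [hS]
    refine lt_of_le_of_ne (integral_nonneg hnn) fun h0 => hv (hinj v ?_)
    have hae := (integral_eq_zero_iff_of_nonneg hnn
      (integrable_inner_mul_inner hK hC v v)).1 h0.symm
    refine ext_inner_left ℝ fun w => ?_
    rw [hS, inner_zero_right]
    refine integral_eq_zero_of_ae (hae.mono fun y hy => ?_)
    have : inner ℝ v (K y) = 0 := mul_self_eq_zero.1 hy
    simp [this]
  rcases (Metric.sphere (0 : E) 1).eq_empty_or_nonempty with he | hne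
  · refine ⟨1, one_pos, fun v => ?_⟩
    have : v = 0 := by
      by_contra hv
      have : (‖v‖⁻¹ • v) ∈ Metric.sphere (0 : E) 1 := by
        simp [norm_smul, hv]
      simp [he] at this
    simp [this]
  · obtain ⟨x, hx, hmin⟩ := (isCompact_sphere (0 : E) 1).exists_isMinOn hne
      (f := fun v => inner ℝ v (S v)) (by fun_prop)
    have hx0 : x ≠ 0 := by
      rintro rfl
      simp at hx
    refine ⟨inner ℝ x (S x), hpos x hx0, fun v => ?_⟩
    by_cases hv : v = 0
    · simp [hv]
    have hn : ‖v‖ ≠ 0 := norm_ne_zero_iff.2 hv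
    have h1 : inner ℝ x (S x) ≤ inner ℝ (‖v‖⁻¹ • v) (S (‖v‖⁻¹ • v)) :=
      hmin (by simp [norm_smul, hv])
    rw [map_smul, real_inner_smul_left, real_inner_smul_right] at h1
    calc _ ≤ (‖v‖⁻¹ * (‖v‖⁻¹ * inner ℝ v (S v))) * ‖v‖ ^ 2 := by gcongr
      _ = _ := by field_simp

end Maps

/-! ### Asymptotic linearity of the estimator -/

section Linearity

variable {d s ℓ : ℕ} {P₁ : EuclideanSpace ℝ (Fin d) → Measure ℝ} {FT : ℝ → ℝ} {p₀ : Param d s}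
  {m : EuclideanSpace ℝ (Fin s) → EuclideanSpace ℝ (Fin (ℓ - 1))} {Φ : Set (Param d s)}
  {ψ : ℝ → ℝ}

/-- The projection of an interior point of the parameter set is an interior point. -/
theorem alpha_mem_nhds {A : Set (EuclideanSpace ℝ (Fin s))} (hA : ∀ p ∈ Φ, p.alpha ∈ A)
    (hΦ : p₀ ∈ interior Φ) : A ∈ 𝓝 p₀.alpha := by
  set q : EuclideanSpace ℝ (Fin s) → Param d s := fun a =>
    WithLp.toLp 2 (Sum.elim (fun _ => p₀.lam) (Sum.elim p₀.theta a)) with hq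
  have hqc : Continuous q := by
    refine (PiLp.continuous_toLp 2 _).comp (continuous_pi fun i => ?_)
    rcases i with i | i | i
    · exact continuous_const
    · exact continuous_const
    · exact (EuclideanSpace.proj (𝕜 := ℝ) i).continuous
  have hq0 : q p₀.alpha = p₀ := by
    ext i
    rcases i with i | i | i
    · rw [Subsingleton.elim i 0]
      rfl
    · rfl
    · rfl
  have h : ∀ᶠ a in 𝓝 p₀.alpha, q a ∈ Φ := by
    have := hqc.tendsto p₀.alpha
    rw [hq0] at this
    exact this (mem_interior_iff_mem_nhds.1 hΦ)
  exact h.mono fun a ha => hA _ ha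

/-- If the empirical cdf is close to the true one, every estimate close to the true value is the
solution of the linearised estimating equations, up to a relatively small error. -/
theorem exists_asymptotic_linearity
    (hψC2 : ContDiff ℝ 2 ψ) (h0 : ψ 0 = 0) (h1 : deriv ψ 0 = 1) (h2 : iteratedDeriv 2 ψ 0 = 1)
    (hconv : ConvexOn ℝ Set.univ ψ) (hFT : Measurable FT) (hFT01 : ∀ y, 0 ≤ FT y ∧ FT y ≤ 1)
    (hlam : p₀.lam < 1) (hΦ : p₀ ∈ interior Φ) (hm : ContDiffAt ℝ 2 m p₀.alpha)
    (hF₁ : ∀ᶠ θ in 𝓝 p₀.theta, ∀ y : ℝ,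
      DifferentiableAt ℝ (fun t => cdf (P₁ t) y) θ ∧
      DifferentiableAt ℝ (gradient (fun t => cdf (P₁ t) y)) θ)
    {B₁ B₂ : ℝ → ℝ} (hi₁ : Integrable B₁)
    (hB₁ : ∀ᶠ θ in 𝓝 p₀.theta, ∀ y : ℝ, ‖gradient (fun t => cdf (P₁ t) y) θ‖ ≤ B₁ y)
    (hi₂ : Integrable B₂)
    (hB₂ : ∀ᶠ θ in 𝓝 p₀.theta, ∀ y : ℝ,
      ‖fderiv ℝ (gradient (fun t => cdf (P₁ t) y)) θ‖ ≤ B₂ y)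
    (hdiff : Integrable fun y => FT y - cdf (P₁ p₀.theta) y)
    (hki : Integrable fun y => vecK ℓ (F0 P₁ FT p₀ y))
    (hJxixi : IsUnit (matJxixi P₁ FT p₀ ℓ)) (hInfo : IsUnit (matInfo P₁ m FT p₀))
    {η : ℝ} (hη : 0 < η) :
    ∃ δ > 0, ∀ F, IsNear FT δ F → ∀ p ξ, ‖p - p₀‖ < δ → ‖ξ‖ < δ → IsEstimate Φ ψ P₁ m F p ξ →
      ‖p - p₀ - matCLM (matH P₁ m FT p₀) ((∫ y, vecK ℓ (F0 P₁ F p₀ y)) - m p₀.alpha)‖ +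
      ‖ξ + matCLM (matP P₁ m FT p₀) ((∫ y, vecK ℓ (F0 P₁ F p₀ y)) - m p₀.alpha)‖ ≤
        η * ‖(∫ y, vecK ℓ (F0 P₁ F p₀ y)) - m p₀.alpha‖ := by
  obtain ⟨ρ, hG⟩ := exists_isSmoothFamily (G := fun θ y => cdf (P₁ θ) y) hF₁ hi₁ hB₁ hi₂ hB₂
  have hg : ∀ v, Measurable fun y =>
      inner ℝ (gradient (fun θ => cdf (P₁ θ) y) p₀.theta) v := fun v =>
    measurable_inner_gradient (G := fun θ y => cdf (P₁ θ) y)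
      (fun θ => (monotone_cdf (P₁ θ)).measurable) (fun y => (hF₁.self_of_nhds y).1) v
  obtain ⟨C, hC, hreg⟩ := exists_isRegularNear hlam hG hg hdiff hFT hFT01 (hasDerivAt_vecK ℓ)
    (contDiff_vecL ℓ) hki
  have hself : ∀ δ > 0, IsNear FT δ FT := fun δ hδ => by
    refine ⟨hFT, hFT01, by simp, by simpa using hδ.le⟩
  have hKC : ∀ y, ‖vecK ℓ (F0 P₁ FT p₀ y)‖ ≤ C := by
    obtain ⟨δ₀, hδ₀, h⟩ := hreg 1 one_pos
    exact (h δ₀ le_rfl).norm_le FT (hself _ hδ₀) p₀ (by simpa using hδ₀)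
  obtain ⟨C₁, δ₁, hC₁, hδ₁, -, hb⟩ := F0_bounds (FT := FT) hlam hG
  obtain ⟨C₂, hC₂, hc⟩ := exists_curve_bound (hasDerivAt_vecK ℓ) (contDiff_vecL ℓ) C₁
  have hU : ∀ y, |F0 P₁ FT p₀ y| ≤ C₁ := fun y =>
    (hb δ₁ le_rfl FT hFT01 p₀ p₀ (by simpa using hδ₁) (by simpa using hδ₁) y).1
  have hLC : ∀ y, ‖vecL ℓ (F0 P₁ FT p₀ y)‖ ≤ C₂ := fun y =>
    (hc _ _ _ (hU y) (hU y) (hU y)).2.1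
  have hLm : AEStronglyMeasurable fun y => vecL ℓ (F0 P₁ FT p₀ y) :=
    ((contDiff_vecL ℓ).continuous.measurable.comp
      (measurable_F0 hFT p₀)).aestronglyMeasurable
  set J := matCLM (matJphixi P₁ m FT p₀) with hJdef
  set S := matCLM (matJxixi P₁ FT p₀ ℓ) with hSdef
  have hJ := matCLM_matJphixi (m := m) hG hg hlam.ne hdiff hLm hLC
  have hkij : ∀ i j : Fin (ℓ - 1), Integrable fun y =>
      vecK ℓ (F0 P₁ FT p₀ y) i * vecK ℓ (F0 P₁ FT p₀ y) j := fun i j => by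
    have := integrable_inner_mul_inner hki hKC (EuclideanSpace.single i 1)
      (EuclideanSpace.single j 1)
    simpa [EuclideanSpace.inner_single_left] using this
  have hS := inner_matCLM_matJxixi hkij
  have hJxixi' := (Matrix.isUnit_iff_isUnit_det _).1 hJxixi
  have hInfo' := (Matrix.isUnit_iff_isUnit_det _).1 hInfo
  have hTS : ∀ e, matCLM (matJxixi P₁ FT p₀ ℓ)⁻¹ (S e) = e := fun e => by
    rw [hSdef, ← matCLM_mul, Matrix.nonsing_inv_mul _ hJxixi', matCLM_one]
  obtain ⟨c, hcpos, hcS⟩ := exists_le_inner_gram hki hKC S hS fun v hv => by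
    rw [← hTS v, hv, map_zero]
  obtain ⟨ε, hε, hsol⟩ := exists_solution_bound J (matCLM (matJphixi P₁ m FT p₀)ᵀ) S
    (matCLM (matJxixi P₁ FT p₀ ℓ)⁻¹) (matCLM (matSigmaTilde P₁ m FT p₀))
    (fun e x => inner_matCLM _ _ _) hTS (fun x => by
      have : matSigmaTilde P₁ m FT p₀ * (matJphixi P₁ m FT p₀)ᵀ * (matJxixi P₁ FT p₀ ℓ)⁻¹ *
          matJphixi P₁ m FT p₀ = (matInfo P₁ m FT p₀)⁻¹ * matInfo P₁ m FT p₀ := by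
        simp only [matSigmaTilde, matInfo, Matrix.mul_assoc]
      rw [hJdef, ← matCLM_mul, ← matCLM_mul, ← matCLM_mul, this,
        Matrix.nonsing_inv_mul _ hInfo', matCLM_one]) hη
  obtain ⟨δ, hδ, hmain⟩ := exists_estimating_equations hψC2 h0 h1 h2 hconv hC hreg
    (hm.hasStrictFDerivAt (by norm_num)) hΦ J hJ S hS hcpos hcS hε
  refine ⟨δ, hδ, fun F hF p ξ hp hξ hest => ?_⟩
  obtain ⟨e1, e2⟩ := hmain F hF p ξ hp hξ hest
  have := hsol _ _ _ e1 e2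
  simpa only [matH, matP, matCLM_mul, matCLM_sub] using this

end Linearity

/-- The first-order expansion of `F ↦ ∫ K (F₀(y)) dy`. -/
theorem exists_integral_vecK_expansion {d s : ℕ} (ℓ : ℕ)
    {P₁ : EuclideanSpace ℝ (Fin d) → Measure ℝ} {FT : ℝ → ℝ} {p₀ : Param d s}
    (hFT : Measurable FT) (hFT01 : ∀ y, 0 ≤ FT y ∧ FT y ≤ 1)
    (hki : Integrable fun y => vecK ℓ (F0 P₁ FT p₀ y)) :
    ∃ C, 0 ≤ C ∧ ∀ δ F, IsNear FT δ F →
      ‖(∫ y, vecK ℓ (F0 P₁ F p₀ y)) - ∫ y, vecK ℓ (F0 P₁ FT p₀ y)‖ ≤ C * ∫ y, |F y - FT y| ∧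
      ‖(∫ y, vecK ℓ (F0 P₁ F p₀ y)) - (∫ y, vecK ℓ (F0 P₁ FT p₀ y))
        - ∫ y, (1 / (1 - p₀.lam) * (F y - FT y)) • vecL ℓ (F0 P₁ FT p₀ y)‖ ≤
          C * ∫ y, (F y - FT y) ^ 2 := by
  set c := 1 / (1 - p₀.lam) with hcdef
  set R := |c| + |p₀.lam / (1 - p₀.lam)| with hR
  have hb : ∀ F : ℝ → ℝ, (∀ y, 0 ≤ F y ∧ F y ≤ 1) → ∀ y, |F0 P₁ F p₀ y| ≤ R := by
    intro F hF y
    refine (abs_sub _ _).trans (add_le_add ?_ ?_) <;> rw [abs_mul]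
    · exact mul_le_of_le_one_right (abs_nonneg _) (abs_le.2 ⟨by linarith [(hF y).1], (hF y).2⟩)
    · exact mul_le_of_le_one_right (abs_nonneg _)
        (abs_le.2 ⟨by linarith [cdf_nonneg (P₁ p₀.theta) y], cdf_le_one _ _⟩)
  obtain ⟨C, hC, hk⟩ := exists_curve_bound (hasDerivAt_vecK ℓ) (contDiff_vecL ℓ) R
  refine ⟨C * |c| + C * |c| * |c|, by positivity, fun δ F hF => ?_⟩
  have hdiff : ∀ y, F0 P₁ F p₀ y - F0 P₁ FT p₀ y = c * (F y - FT y) := fun y => by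
    simp only [F0, hcdef]
    ring
  have hd := hF.integrable
  have hKm : Measurable fun y => vecK ℓ (F0 P₁ F p₀ y) := by
    have : Continuous (vecK ℓ) := continuous_iff_continuousAt.2 fun t =>
      (hasDerivAt_vecK ℓ t).continuousAt
    exact this.measurable.comp (measurable_F0 hF.measurable p₀)
  have hsub : ∀ y, ‖vecK ℓ (F0 P₁ F p₀ y) - vecK ℓ (F0 P₁ FT p₀ y)‖ ≤ C * |c| * |F y - FT y| := by
    intro y
    refine (hk _ _ _ (hb FT hFT01 y) (hb F hF.mem_Icc y) (hb FT hFT01 y)).2.2.1.trans_eq ?_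
    rw [hdiff, abs_mul, mul_assoc]
  have hsi : Integrable fun y => vecK ℓ (F0 P₁ F p₀ y) - vecK ℓ (F0 P₁ FT p₀ y) :=
    (hd.abs.const_mul _).mono' (hKm.aestronglyMeasurable.sub hki.1)
      (Eventually.of_forall hsub)
  have hKi : Integrable fun y => vecK ℓ (F0 P₁ F p₀ y) :=
    (hsi.add hki).congr (Eventually.of_forall fun y => sub_add_cancel _ _)
  have hLi : Integrable fun y => (c * (F y - FT y)) • vecL ℓ (F0 P₁ FT p₀ y) :=
    (hd.const_mul c).smul_bdd C ((contDiff_vecL ℓ).continuous.measurable.comp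
      (measurable_F0 hFT p₀)).aestronglyMeasurable (Eventually.of_forall fun y =>
        (hk _ _ _ (hb FT hFT01 y) (hb FT hFT01 y) (hb FT hFT01 y)).2.1)
  have hsq : Integrable fun y => (F y - FT y) ^ 2 := by
    refine hd.abs.mono' (hd.1.pow 2) (Eventually.of_forall fun y => ?_)
    have h1 : |F y - FT y| ≤ 1 := abs_le.2
      ⟨by linarith [(hF.mem_Icc y).1, (hFT01 y).2], by linarith [(hF.mem_Icc y).2, (hFT01 y).1]⟩
    rw [Real.norm_eq_abs, abs_pow]
    nlinarith [abs_nonneg (F y - FT y)]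
  have hI1 : 0 ≤ ∫ y, |F y - FT y| := integral_nonneg fun y => abs_nonneg _
  have hI2 : 0 ≤ ∫ y, (F y - FT y) ^ 2 := integral_nonneg fun y => sq_nonneg _
  rw [← integral_sub hKi hki]
  constructor
  · refine (norm_integral_le_of_norm_le (hd.abs.const_mul _) (Eventually.of_forall hsub)).trans ?_
    rw [integral_const_mul]
    gcongr
    exact le_add_of_nonneg_right (by positivity)
  · rw [← integral_sub hsi hLi]
    refine (norm_integral_le_of_norm_le (hsq.const_mul (C * |c| * |c|))
      (Eventually.of_forall fun y => ?_)).trans ?_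
    · have h := (hk _ _ _ (hb FT hFT01 y) (hb F hF.mem_Icc y) (hb FT hFT01 y)).2.2.2
      rw [hdiff, sub_self, abs_zero, zero_add, abs_mul] at h
      refine h.trans_eq ?_
      rw [← sq_abs (F y - FT y)]
      ring
    · rw [integral_const_mul]
      gcongr
      exact le_add_of_nonneg_left (by positivity)

/-! ### Integrals against the quantile measure -/

section Quantile

variable {P : Measure ℝ}

theorem quantile_le_iff (u : Set.Ioo (0 : ℝ) 1) (x : ℝ) : quantile P u ≤ x ↔ (u : ℝ) ≤ cdf P x := by
  have hne : {x : ℝ | (u : ℝ) ≤ cdf P x}.Nonempty := by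
    obtain ⟨x, hx⟩ := ((tendsto_cdf_atTop P).eventually (lt_mem_nhds u.2.2)).exists
    exact ⟨x, hx.le⟩
  have hbdd : BddBelow {x : ℝ | (u : ℝ) ≤ cdf P x} := by
    obtain ⟨x, hx⟩ := ((tendsto_cdf_atBot P).eventually (gt_mem_nhds u.2.1)).exists
    refine ⟨x, fun y hy => ?_⟩
    by_contra! h
    exact absurd (hy.trans (monotone_cdf P h.le)) (not_le.mpr hx)
  constructor
  · intro h
    have h1 : ∀ᶠ y in 𝓝[>] x, (u : ℝ) ≤ cdf P y := by
      filter_upwards [self_mem_nhdsWithin] with y hy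
      obtain ⟨z, hz, hzy⟩ := (csInf_lt_iff hbdd hne).1 (lt_of_le_of_lt h hy)
      exact hz.trans (monotone_cdf P hzy.le)
    exact ge_of_tendsto (((cdf P).right_continuous x).tendsto.mono_left
      (nhdsWithin_mono _ Set.Ioi_subset_Ici_self)) h1
  · exact fun h => csInf_le hbdd h

theorem rightLim_quantile_le {u : Set.Ioo (0 : ℝ) 1} {x : ℝ} (h : (u : ℝ) < cdf P x) :
    Function.rightLim (quantile P) u ≤ x := by
  obtain ⟨v, hv, hvx⟩ := exists_between h
  have hv1 : v ∈ Set.Ioo (0 : ℝ) 1 := ⟨u.2.1.trans hv, hvx.trans_le (cdf_le_one P x)⟩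
  exact ((quantile_mono P).rightLim_le (y := ⟨v, hv1⟩) hv).trans ((quantile_le_iff _ _).2 hvx.le)

theorem lt_cdf_of_rightLim_quantile_lt {u : Set.Ioo (0 : ℝ) 1} {x : ℝ}
    (h : Function.rightLim (quantile P) u < x) : (u : ℝ) < cdf P x := by
  have hlim := (quantile_mono P).tendsto_rightLim u
  have : (𝓝[>] u).NeBot := inferInstance
  obtain ⟨v, hv, huv⟩ := ((hlim.eventually (gt_mem_nhds h)).and self_mem_nhdsWithin).exists
  exact (show (u : ℝ) < v from huv).trans_le ((quantile_le_iff v x).1 (le_of_lt hv))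

/-- The cdf as a map into `(0, 1)`, with the value `1 / 2` where the cdf is `0` or `1`. -/
noncomputable def cdfIoo (P : Measure ℝ) (y : ℝ) : Set.Ioo (0 : ℝ) 1 :=
  open scoped Classical in
  if h : cdf P y ∈ Set.Ioo (0 : ℝ) 1 then ⟨cdf P y, h⟩ else ⟨1 / 2, by norm_num, by norm_num⟩

theorem coe_cdfIoo (y : ℝ) (h : cdf P y ∈ Set.Ioo (0 : ℝ) 1) : (cdfIoo P y : ℝ) = cdf P y := by
  rw [cdfIoo, dif_pos h]

theorem measurableSet_cdf_mem_Ioo : MeasurableSet {y | cdf P y ∈ Set.Ioo (0 : ℝ) 1} :=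
  (monotone_cdf P).measurable measurableSet_Ioo

theorem measurable_cdfIoo : Measurable (cdfIoo P) := by
  classical
  have h : Measurable fun y => if cdf P y ∈ Set.Ioo (0 : ℝ) 1 then cdf P y else 1 / 2 :=
    Measurable.ite measurableSet_cdf_mem_Ioo (monotone_cdf P).measurable measurable_const
  refine (MeasurableEmbedding.subtype_coe measurableSet_Ioo).measurable_comp_iff.1 ?_
  convert h using 1
  ext y
  by_cases hy : cdf P y ∈ Set.Ioo (0 : ℝ) 1
  · rw [Function.comp_apply, coe_cdfIoo y hy, if_pos hy]
  · rw [Function.comp_apply, cdfIoo, dif_neg hy, if_neg hy]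

/-- The quantile measure is the image of Lebesgue measure under the cdf. -/
theorem quantileMeasure_eq_map : quantileMeasure P =
    (volume.restrict {y | cdf P y ∈ Set.Ioo (0 : ℝ) 1}).map (cdfIoo P) := by
  have hvol : ∀ a b : Set.Ioo (0 : ℝ) 1, volume {y | (a : ℝ) < cdf P y ∧ cdf P y ≤ b} =
      ENNReal.ofReal (Function.rightLim (quantile P) b - Function.rightLim (quantile P) a) := by
    intro a b
    refine le_antisymm ?_ ?_
    · rw [← Real.volume_Icc]
      refine measure_mono fun y hy => ⟨rightLim_quantile_le hy.1, ?_⟩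
      by_contra! h
      exact absurd hy.2 (not_le.2 (lt_cdf_of_rightLim_quantile_lt h))
    · rw [← Real.volume_Ioo]
      refine measure_mono fun y hy => ⟨lt_cdf_of_rightLim_quantile_lt hy.1, ?_⟩
      by_contra! h
      exact absurd hy.2 (not_lt.2 (rightLim_quantile_le h))
  have h1 : ∀ a b, quantileMeasure P (Set.Ioc a b) =
      ENNReal.ofReal (Function.rightLim (quantile P) b - Function.rightLim (quantile P) a) := by
    intro a b
    rw [quantileMeasure, StieltjesFunction.measure_Ioc]
    rfl
  refine Measure.ext_of_Ioc' _ _ (fun a b _ => ?_) (fun a b _ => ?_)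
  · rw [h1]
    exact ENNReal.ofReal_ne_top
  · rw [h1, Measure.map_apply measurable_cdfIoo measurableSet_Ioc,
      Measure.restrict_apply (measurable_cdfIoo measurableSet_Ioc), ← hvol]
    congr 1
    ext y
    constructor
    · intro h
      have hy : cdf P y ∈ Set.Ioo (0 : ℝ) 1 := ⟨a.2.1.trans h.1, h.2.trans_lt b.2.2⟩
      refine ⟨?_, hy⟩
      rw [Set.mem_preimage, Set.mem_Ioc, ← Subtype.coe_lt_coe, ← Subtype.coe_le_coe,
        coe_cdfIoo y hy]
      exact h
    · rintro ⟨h, hy⟩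
      rw [Set.mem_preimage, Set.mem_Ioc, ← Subtype.coe_lt_coe, ← Subtype.coe_le_coe,
        coe_cdfIoo y hy] at h
      exact h

theorem cdf_eq_zero_or_one {y : ℝ} (hy : cdf P y ∉ Set.Ioo (0 : ℝ) 1) :
    cdf P y = 0 ∨ cdf P y = 1 := by
  by_contra! h
  exact hy ⟨lt_of_le_of_ne (cdf_nonneg P y) h.1.symm, lt_of_le_of_ne (cdf_le_one P y) h.2⟩

/-- The change of variables `u = F(y)` in integrals of functions that vanish at `0` and `1`. -/
theorem integral_comp_cdf {E : Type*} [NormedAddCommGroup E] [NormedSpace ℝ E] {k : ℝ → E}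
    (hk : Continuous k) (h0 : k 0 = 0) (h1 : k 1 = 0)
    (hi : Integrable (fun u : Set.Ioo (0 : ℝ) 1 => k u) (quantileMeasure P)) :
    Integrable (fun y => k (cdf P y)) ∧
      ∫ y, k (cdf P y) = ∫ u : Set.Ioo (0 : ℝ) 1, k u ∂quantileMeasure P := by
  have hkc : Continuous fun u : Set.Ioo (0 : ℝ) 1 => k u := hk.comp continuous_subtype_val
  have hz : ∀ y, y ∉ {y | cdf P y ∈ Set.Ioo (0 : ℝ) 1} → k (cdf P y) = 0 := fun y hy => by
    rcases cdf_eq_zero_or_one hy with h | h <;> rw [h] <;> assumption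
  have hcongr : ∀ᵐ y ∂(volume.restrict {y | cdf P y ∈ Set.Ioo (0 : ℝ) 1}),
      k (cdfIoo P y) = k (cdf P y) :=
    (ae_restrict_iff' measurableSet_cdf_mem_Ioo).2 (Eventually.of_forall fun y hy => by
      rw [coe_cdfIoo y hy])
  rw [quantileMeasure_eq_map] at hi ⊢
  rw [integral_map measurable_cdfIoo.aemeasurable hi.1, integral_congr_ae hcongr,
    setIntegral_eq_integral_of_forall_compl_eq_zero hz]
  refine ⟨?_, rfl⟩
  have hi' := (hi.comp_measurable measurable_cdfIoo).congr hcongr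
  exact (integrableOn_iff_integrable_of_support_subset fun y hy => by
    by_contra h
    exact hy (hz y h)).1 hi'

end Quantile

/-- At the true parameter, the candidate nonparametric component is the true one. -/
theorem F0_eq_cdf_of_mixture {d s : ℕ} {P₁ : EuclideanSpace ℝ (Fin d) → Measure ℝ}
    {p : Param d s} {PT P₀ : Measure ℝ} [IsProbabilityMeasure PT] [IsProbabilityMeasure P₀]
    [IsProbabilityMeasure (P₁ p.theta)] (h0 : 0 < p.lam) (h1 : p.lam < 1)
    (hmix : PT = ENNReal.ofReal p.lam • P₁ p.theta + ENNReal.ofReal (1 - p.lam) • P₀) (y : ℝ) :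
    F0 P₁ (cdf PT) p y = cdf P₀ y := by
  have h : cdf PT y = p.lam * cdf (P₁ p.theta) y + (1 - p.lam) * cdf P₀ y := by
    rw [cdf_eq_real, cdf_eq_real, cdf_eq_real, hmix]
    rw [measureReal_def, Measure.add_apply, Measure.smul_apply, Measure.smul_apply, smul_eq_mul,
      smul_eq_mul, ENNReal.toReal_add (by finiteness) (by finiteness), ENNReal.toReal_mul,
      ENNReal.toReal_mul, ENNReal.toReal_ofReal h0.le, ENNReal.toReal_ofReal (by linarith)]
    rfl
  have : 1 - p.lam ≠ 0 := by linarith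
  rw [F0, h]
  field_simp
  ring

/-! ### Moments of the centred indicator process -/

section Residual

variable {P : Measure ℝ}

/-- The centred indicator `1{x ≤ y} - F(y)`, where `F` is the cdf of `P`. -/
noncomputable def cdfResidual (P : Measure ℝ) (x y : ℝ) : ℝ :=
  Set.indicator (Set.Iic y) (fun _ => (1 : ℝ)) x - cdf P y

theorem measurable_uncurry_indicator_Iic :
    Measurable fun z : ℝ × ℝ => Set.indicator (Set.Iic z.2) (fun _ => (1 : ℝ)) z.1 := by
  classical
  simp only [Set.indicator_apply, Set.mem_Iic]
  exact Measurable.ite (measurableSet_le measurable_fst measurable_snd) measurable_const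
    measurable_const

theorem measurable_uncurry_cdfResidual (P : Measure ℝ) :
    Measurable fun z : ℝ × ℝ => cdfResidual P z.1 z.2 :=
  measurable_uncurry_indicator_Iic.sub ((monotone_cdf P).measurable.comp measurable_snd)

theorem measurable_cdfResidual (P : Measure ℝ) (y : ℝ) : Measurable fun x => cdfResidual P x y :=
  (measurable_uncurry_cdfResidual P).comp measurable_prodMk_right

theorem indicator_Iic_mem_Icc (x y : ℝ) :
    0 ≤ Set.indicator (Set.Iic y) (fun _ => (1 : ℝ)) x ∧
      Set.indicator (Set.Iic y) (fun _ => (1 : ℝ)) x ≤ 1 :=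
  ⟨Set.indicator_nonneg (fun _ _ => zero_le_one) _,
    Set.indicator_le_self' (fun _ _ => zero_le_one) _⟩

theorem abs_cdfResidual_le (x y : ℝ) : |cdfResidual P x y| ≤ 1 := by
  have h := indicator_Iic_mem_Icc x y
  exact abs_le.2 ⟨by rw [cdfResidual]; linarith [cdf_le_one P y],
    by rw [cdfResidual]; linarith [cdf_nonneg P y]⟩

variable [IsProbabilityMeasure P]

theorem integral_indicator_Iic (y : ℝ) :
    ∫ x, Set.indicator (Set.Iic y) (fun _ => (1 : ℝ)) x ∂P = cdf P y := by
  rw [integral_indicator_const _ measurableSet_Iic, cdf_eq_real]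
  simp

theorem integrable_indicator_Iic (y : ℝ) :
    Integrable (fun x => Set.indicator (Set.Iic y) (fun _ => (1 : ℝ)) x) P :=
  (integrable_const _).indicator measurableSet_Iic

theorem memLp_cdfResidual (y : ℝ) (p : ℝ≥0∞) : MemLp (fun x => cdfResidual P x y) p P :=
  MemLp.of_bound (measurable_cdfResidual P y).aestronglyMeasurable 1
    (Eventually.of_forall fun x => abs_cdfResidual_le x y)

theorem integrable_cdfResidual (y : ℝ) : Integrable (fun x => cdfResidual P x y) P :=
  memLp_one_iff_integrable.1 (memLp_cdfResidual y 1)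

theorem integral_cdfResidual (y : ℝ) : ∫ x, cdfResidual P x y ∂P = 0 := by
  simp only [cdfResidual]
  rw [integral_sub (integrable_indicator_Iic y) (integrable_const _), integral_indicator_Iic]
  simp

theorem integral_cdfResidual_mul (y z : ℝ) :
    ∫ x, cdfResidual P x y * cdfResidual P x z ∂P = cdf P (min y z) - cdf P y * cdf P z := by
  have h : ∀ x, cdfResidual P x y * cdfResidual P x z =
      Set.indicator (Set.Iic (min y z)) (fun _ => (1 : ℝ)) x
        - cdf P y * Set.indicator (Set.Iic z) (fun _ => (1 : ℝ)) x
        - cdf P z * cdfResidual P x y := by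
    intro x
    have : Set.indicator (Set.Iic (min y z)) (fun _ => (1 : ℝ)) x =
        Set.indicator (Set.Iic y) (fun _ => (1 : ℝ)) x *
          Set.indicator (Set.Iic z) (fun _ => (1 : ℝ)) x := by
      rw [← Set.Iic_inter_Iic, ← Set.inter_indicator_mul, one_mul]
    rw [this]
    simp only [cdfResidual]
    ring
  simp_rw [h]
  have h1 := integrable_indicator_Iic (P := P) (min y z)
  have h2 := (integrable_indicator_Iic (P := P) z).const_mul (cdf P y)
  have h3 := (integrable_cdfResidual (P := P) y).const_mul (cdf P z)
  have h12 : Integrable (fun x => Set.indicator (Set.Iic (min y z)) (fun _ => (1 : ℝ)) x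
        - cdf P y * Set.indicator (Set.Iic z) (fun _ => (1 : ℝ)) x) P := h1.sub h2
  rw [integral_sub h12 h3, integral_sub h1 h2, integral_const_mul, integral_const_mul,
    integral_indicator_Iic, integral_indicator_Iic, integral_cdfResidual]
  ring

theorem integral_cdfResidual_sq (y : ℝ) :
    ∫ x, cdfResidual P x y ^ 2 ∂P = cdf P y * (1 - cdf P y) := by
  simp_rw [sq]
  rw [integral_cdfResidual_mul, min_self]
  ring

/-- The Cauchy-Schwarz inequality. -/
theorem integral_abs_mul_le_sqrt {α : Type*} [MeasurableSpace α] {μ : Measure α} {f g : α → ℝ}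
    (hf : MemLp f 2 μ) (hg : MemLp g 2 μ) :
    ∫ x, |f x * g x| ∂μ ≤ √(∫ x, f x ^ 2 ∂μ) * √(∫ x, g x ^ 2 ∂μ) := by
  have h := integral_mul_norm_le_Lp_mul_Lq (μ := μ) (f := f) (g := g) Real.HolderConjugate.two_two
    (by simpa using hf) (by simpa using hg)
  simpa [abs_mul, Real.sqrt_eq_rpow] using h

theorem integral_abs_le_sqrt {α : Type*} [MeasurableSpace α] {μ : Measure α}
    [IsProbabilityMeasure μ] {f : α → ℝ} (hf : MemLp f 2 μ) :
    ∫ x, |f x| ∂μ ≤ √(∫ x, f x ^ 2 ∂μ) := by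
  simpa using integral_abs_mul_le_sqrt hf (memLp_const (1 : ℝ))

theorem integral_abs_cdfResidual_le (y : ℝ) :
    ∫ x, |cdfResidual P x y| ∂P ≤ √(cdf P y * (1 - cdf P y)) := by
  rw [← integral_cdfResidual_sq]
  exact integral_abs_le_sqrt (memLp_cdfResidual y 2)

theorem integral_abs_cdfResidual_mul_le (y z : ℝ) :
    ∫ x, |cdfResidual P x y * cdfResidual P x z| ∂P ≤
      √(cdf P y * (1 - cdf P y)) * √(cdf P z * (1 - cdf P z)) := by
  rw [← integral_cdfResidual_sq, ← integral_cdfResidual_sq]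
  exact integral_abs_mul_le_sqrt (memLp_cdfResidual y 2) (memLp_cdfResidual z 2)

end Residual

/-! ### The influence function -/

section Influence

variable {P : Measure ℝ}

/-- The integral of the centred indicator process against a weight function. -/
noncomputable def influence {E : Type*} [NormedAddCommGroup E] [NormedSpace ℝ E] (P : Measure ℝ)
    (k : ℝ → E) (x : ℝ) : E :=
  ∫ y, cdfResidual P x y • k y

theorem measurable_influence {E : Type*} [NormedAddCommGroup E] [NormedSpace ℝ E]
    [MeasurableSpace E] [BorelSpace E] [SecondCountableTopology E] {k : ℝ → E}
    (hk : Measurable k) : Measurable (influence P k) := by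
  have h : Measurable fun z : ℝ × ℝ => cdfResidual P z.1 z.2 • k z.2 :=
    (measurable_uncurry_cdfResidual P).smul (hk.comp measurable_snd)
  exact h.stronglyMeasurable.integral_prod_right'.measurable

theorem measurable_cdfResidual_mul_mul {f g : ℝ → ℝ} (hf : Measurable f) (hg : Measurable g) :
    Measurable fun z : ℝ × ℝ × ℝ =>
      (cdfResidual P z.1 z.2.1 * f z.2.1) * (cdfResidual P z.1 z.2.2 * g z.2.2) := by
  have h1 : Measurable fun z : ℝ × ℝ × ℝ => cdfResidual P z.1 z.2.1 :=
    (measurable_uncurry_cdfResidual P).comp (g := fun z : ℝ × ℝ => cdfResidual P z.1 z.2)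
      (f := fun z : ℝ × ℝ × ℝ => (z.1, z.2.1)) (by fun_prop)
  have h2 : Measurable fun z : ℝ × ℝ × ℝ => cdfResidual P z.1 z.2.2 :=
    (measurable_uncurry_cdfResidual P).comp (g := fun z : ℝ × ℝ => cdfResidual P z.1 z.2)
      (f := fun z : ℝ × ℝ × ℝ => (z.1, z.2.2)) (by fun_prop)
  exact (h1.mul (hf.comp (by fun_prop))).mul (h2.mul (hg.comp (by fun_prop)))

variable [IsProbabilityMeasure P]

theorem integrable_prod_cdfResidual (hcond : Integrable fun y => √(cdf P y * (1 - cdf P y))) :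
    Integrable (fun z : ℝ × ℝ => cdfResidual P z.1 z.2) (P.prod volume) := by
  have hm := measurable_uncurry_cdfResidual P
  refine (integrable_prod_iff' hm.aestronglyMeasurable).2
    ⟨Eventually.of_forall fun y => integrable_cdfResidual y, ?_⟩
  refine hcond.mono' hm.norm.stronglyMeasurable.integral_prod_left'.aestronglyMeasurable
    (Eventually.of_forall fun y => ?_)
  rw [Real.norm_of_nonneg (integral_nonneg fun _ => norm_nonneg _)]
  exact integral_abs_cdfResidual_le y

theorem ae_integrable_cdfResidual (hcond : Integrable fun y => √(cdf P y * (1 - cdf P y))) :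
    ∀ᵐ x ∂P, Integrable fun y => cdfResidual P x y :=
  (integrable_prod_cdfResidual hcond).prod_right_ae

theorem integrable_prod_cdfResidual_mul (hcond : Integrable fun y => √(cdf P y * (1 - cdf P y)))
    {f g : ℝ → ℝ} (hf : Measurable f) (hg : Measurable g)
    {C : ℝ} (hfC : ∀ y, |f y| ≤ C) (hgC : ∀ y, |g y| ≤ C) :
    Integrable (fun z : ℝ × ℝ × ℝ =>
      (cdfResidual P z.1 z.2.1 * f z.2.1) * (cdfResidual P z.1 z.2.2 * g z.2.2))
      (P.prod (volume.prod volume)) := by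
  have hm := measurable_cdfResidual_mul_mul (P := P) hf hg
  have hrw : ∀ x y z, ‖(cdfResidual P x y * f y) * (cdfResidual P x z * g z)‖ ≤
      C * C * |cdfResidual P x y * cdfResidual P x z| := fun x y z => by
    rw [Real.norm_eq_abs, show (cdfResidual P x y * f y) * (cdfResidual P x z * g z) =
      (f y * g z) * (cdfResidual P x y * cdfResidual P x z) by ring, abs_mul, abs_mul (f y)]
    gcongr
    exacts [(abs_nonneg _).trans (hfC y), hfC y, hgC z]
  have hi : ∀ y z, Integrable (fun x => C * C * |cdfResidual P x y * cdfResidual P x z|) P :=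
    fun y z => ((memLp_cdfResidual y 2).integrable_mul (memLp_cdfResidual z 2)).abs.const_mul _
  have hi' : ∀ y z, Integrable
      (fun x => (cdfResidual P x y * f y) * (cdfResidual P x z * g z)) P := fun y z =>
    (hi y z).mono' (((measurable_cdfResidual P y).mul_const _).mul
      ((measurable_cdfResidual P z).mul_const _)).aestronglyMeasurable
      (Eventually.of_forall fun x => hrw x y z)
  refine (integrable_prod_iff' hm.aestronglyMeasurable).2
    ⟨Eventually.of_forall fun w => hi' w.1 w.2, ?_⟩
  have hm2 : AEStronglyMeasurable (fun w : ℝ × ℝ =>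
      ∫ x, ‖(cdfResidual P x w.1 * f w.1) * (cdfResidual P x w.2 * g w.2)‖ ∂P)
      (volume.prod volume) :=
    hm.norm.stronglyMeasurable.integral_prod_left'.aestronglyMeasurable
  have hdom := (hcond.mul_prod hcond).const_mul (C * C)
  refine hdom.mono' hm2 (Eventually.of_forall fun w => ?_)
  rw [Real.norm_of_nonneg (integral_nonneg fun _ => norm_nonneg _)]
  refine (integral_mono (hi' w.1 w.2).norm (hi w.1 w.2) fun x => hrw x w.1 w.2).trans ?_
  rw [integral_const_mul]
  exact mul_le_mul_of_nonneg_left (integral_abs_cdfResidual_mul_le _ _) (mul_self_nonneg C)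

theorem integrable_influence_mul (hcond : Integrable fun y => √(cdf P y * (1 - cdf P y)))
    {f g : ℝ → ℝ} (hf : Measurable f) (hg : Measurable g)
    {C : ℝ} (hfC : ∀ y, |f y| ≤ C) (hgC : ∀ y, |g y| ≤ C) :
    Integrable (fun x => influence P f x * influence P g x) P := by
  refine (integrable_prod_cdfResidual_mul hcond hf hg hfC hgC).integral_prod_left.congr
    (Eventually.of_forall fun x => ?_)
  exact integral_prod_mul (fun y => cdfResidual P x y * f y) (fun y => cdfResidual P x y * g y)

/-- The covariance of two influence functions, by Fubini's theorem. -/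
theorem integral_influence_mul (hcond : Integrable fun y => √(cdf P y * (1 - cdf P y)))
    {f g : ℝ → ℝ} (hf : Measurable f) (hg : Measurable g)
    {C : ℝ} (hfC : ∀ y, |f y| ≤ C) (hgC : ∀ y, |g y| ≤ C) :
    ∫ x, influence P f x * influence P g x ∂P =
      ∫ y, ∫ z, (cdf P (min y z) - cdf P y * cdf P z) * f y * g z := by
  have hi := integrable_prod_cdfResidual_mul hcond hf hg hfC hgC
  have hcov : ∀ w : ℝ × ℝ, ∫ x, (cdfResidual P x w.1 * f w.1) * (cdfResidual P x w.2 * g w.2) ∂P =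
      (cdf P (min w.1 w.2) - cdf P w.1 * cdf P w.2) * f w.1 * g w.2 := fun w => by
    rw [← integral_cdfResidual_mul, ← integral_mul_const, ← integral_mul_const]
    exact integral_congr_ae (Eventually.of_forall fun x => by ring)
  have hi2 := hi.integral_prod_right
  simp only [hcov] at hi2
  rw [← integral_prod _ hi2, ← integral_congr_ae (Eventually.of_forall hcov),
    ← integral_integral_swap hi]
  refine integral_congr_ae (Eventually.of_forall fun x => ?_)
  exact (integral_prod_mul (fun y => cdfResidual P x y * f y)
    (fun y => cdfResidual P x y * g y)).symm

theorem integral_influence (hcond : Integrable fun y => √(cdf P y * (1 - cdf P y)))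
    {f : ℝ → ℝ} (hf : Measurable f) {C : ℝ} (hfC : ∀ y, |f y| ≤ C) :
    ∫ x, influence P f x ∂P = 0 := by
  have hi : Integrable (Function.uncurry fun x y => cdfResidual P x y • f y) (P.prod volume) :=
    (integrable_prod_cdfResidual hcond).smul_bdd C
      (hf.comp measurable_snd).aestronglyMeasurable (Eventually.of_forall fun z => hfC z.2)
  simp only [influence]
  rw [integral_integral_swap hi]
  refine integral_eq_zero_of_ae (Eventually.of_forall fun y => ?_)
  simp only [smul_eq_mul, Pi.zero_apply]
  rw [integral_mul_const, integral_cdfResidual, zero_mul]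

end Influence

/-! ### Mean deviations of the empirical cdf -/

section Empirical

variable {Ω : Type*} {P : Measure ℝ} {X : ℕ → Ω → ℝ}

theorem empiricalCdf_mem_Icc (n : ℕ) (ω : Ω) (y : ℝ) :
    0 ≤ empiricalCdf X n ω y ∧ empiricalCdf X n ω y ≤ 1 := by
  constructor
  · exact div_nonneg (Finset.sum_nonneg fun i _ => (indicator_Iic_mem_Icc _ _).1)
      (Nat.cast_nonneg n)
  · refine div_le_one_of_le₀ ?_ (Nat.cast_nonneg n)
    refine (Finset.sum_le_sum fun i _ => (indicator_Iic_mem_Icc (X i ω) y).2).trans ?_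
    simp

theorem measurable_empiricalCdf (n : ℕ) (ω : Ω) : Measurable fun y => empiricalCdf X n ω y :=
  (Finset.measurable_fun_sum _ fun i _ => measurable_uncurry_indicator_Iic.comp
    (f := fun y => (X i ω, y)) (measurable_const.prodMk measurable_id)).div_const _

theorem empiricalCdf_sub_cdf {n : ℕ} (hn : n ≠ 0) (ω : Ω) (y : ℝ) :
    empiricalCdf X n ω y - cdf P y = (n : ℝ)⁻¹ * ∑ i ∈ Finset.range n, cdfResidual P (X i ω) y := by
  have : (n : ℝ) ≠ 0 := Nat.cast_ne_zero.2 hn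
  simp only [cdfResidual, Finset.sum_sub_distrib, Finset.sum_const, Finset.card_range,
    nsmul_eq_mul, empiricalCdf]
  field_simp

theorem abs_empiricalCdf_sub_le (n : ℕ) (ω : Ω) (y : ℝ) :
    |empiricalCdf X n ω y - cdf P y| ≤ 1 := by
  have h := empiricalCdf_mem_Icc (X := X) n ω y
  exact abs_le.2 ⟨by linarith [cdf_le_one P y], by linarith [cdf_nonneg P y]⟩

variable [MeasurableSpace Ω] {μ : Measure Ω}

theorem measurable_uncurry_empiricalCdf (hX : ∀ i, Measurable (X i)) (n : ℕ) :
    Measurable fun z : Ω × ℝ => empiricalCdf X n z.1 z.2 :=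
  (Finset.measurable_fun_sum _ fun i _ => measurable_uncurry_indicator_Iic.comp
    (f := fun z : Ω × ℝ => (X i z.1, z.2)) (((hX i).comp measurable_fst).prodMk
      measurable_snd)).div_const _

variable [IsProbabilityMeasure μ] [IsProbabilityMeasure P]

theorem integral_empiricalCdf_sub_sq (hXm : ∀ i, Measurable (X i)) (hX : ∀ i, HasLaw (X i) P μ)
    (hindep : iIndepFun X μ) {n : ℕ} (hn : n ≠ 0) (y : ℝ) :
    ∫ ω, (empiricalCdf X n ω y - cdf P y) ^ 2 ∂μ = (n : ℝ)⁻¹ * (cdf P y * (1 - cdf P y)) := by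
  have hn' : (n : ℝ) ≠ 0 := Nat.cast_ne_zero.2 hn
  set Y : ℕ → Ω → ℝ := fun i ω => cdfResidual P (X i ω) y with hY
  have hm := measurable_cdfResidual P y
  have hYL : ∀ i, MemLp (Y i) 2 μ := fun i =>
    MemLp.of_bound (hm.comp (hXm i)).aestronglyMeasurable 1
      (Eventually.of_forall fun ω => abs_cdfResidual_le _ y)
  have hY0 : ∀ i, ∫ ω, Y i ω ∂μ = 0 := fun i => by
    rw [← integral_cdfResidual (P := P) y]
    exact (hX i).integral_comp hm.aestronglyMeasurable
  have hY2 : ∀ i, ∫ ω, Y i ω ^ 2 ∂μ = cdf P y * (1 - cdf P y) := fun i => by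
    rw [← integral_cdfResidual_sq (P := P) y]
    exact (hX i).integral_comp (f := fun x => cdfResidual P x y ^ 2)
      (hm.pow_const 2).aestronglyMeasurable
  have hvar : Var[∑ i ∈ Finset.range n, Y i; μ] = n * (cdf P y * (1 - cdf P y)) := by
    rw [IndepFun.variance_sum (fun i _ => hYL i) fun i _ j _ hij =>
      (hindep.indepFun hij).comp hm hm]
    simp only [fun i => variance_of_integral_eq_zero (hYL i).1.aemeasurable (hY0 i), hY2]
    simp
  have hsum0 : ∫ ω, (∑ i ∈ Finset.range n, Y i) ω ∂μ = 0 := by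
    simp only [Finset.sum_apply]
    rw [integral_finsetSum _ fun i _ => (hYL i).integrable one_le_two]
    simp [hY0]
  rw [variance_of_integral_eq_zero
    (Finset.aemeasurable_sum _ fun i _ => (hYL i).1.aemeasurable) hsum0] at hvar
  simp_rw [empiricalCdf_sub_cdf (P := P) hn, mul_pow]
  rw [integral_const_mul]
  simp only [Finset.sum_apply] at hvar
  rw [hvar]
  field_simp

theorem integral_abs_empiricalCdf_sub_le (hXm : ∀ i, Measurable (X i)) (hX : ∀ i, HasLaw (X i) P μ)
    (hindep : iIndepFun X μ) {n : ℕ} (hn : n ≠ 0) (y : ℝ) :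
    ∫ ω, |empiricalCdf X n ω y - cdf P y| ∂μ ≤ (√n)⁻¹ * √(cdf P y * (1 - cdf P y)) := by
  rw [← Real.sqrt_inv, ← Real.sqrt_mul (by positivity),
    ← integral_empiricalCdf_sub_sq hXm hX hindep hn]
  refine integral_abs_le_sqrt (MemLp.of_bound ?_ 1
    (Eventually.of_forall fun ω => abs_empiricalCdf_sub_le n ω y))
  exact (((measurable_uncurry_empiricalCdf hXm n).comp
    measurable_prodMk_right).sub measurable_const).aestronglyMeasurable

theorem integrable_prod_empiricalCdf_sub
    (hcond : Integrable fun y => √(cdf P y * (1 - cdf P y)))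
    (hXm : ∀ i, Measurable (X i)) (hX : ∀ i, HasLaw (X i) P μ) (hindep : iIndepFun X μ)
    {n : ℕ} (hn : n ≠ 0) :
    Integrable (fun z : Ω × ℝ => empiricalCdf X n z.1 z.2 - cdf P z.2) (μ.prod volume) := by
  have hm : Measurable fun z : Ω × ℝ => empiricalCdf X n z.1 z.2 - cdf P z.2 :=
    (measurable_uncurry_empiricalCdf hXm n).sub ((monotone_cdf P).measurable.comp measurable_snd)
  have hi : ∀ y, Integrable (fun ω => empiricalCdf X n ω y - cdf P y) μ := fun y =>
    Integrable.of_bound (hm.comp measurable_prodMk_right).aestronglyMeasurable 1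
      (Eventually.of_forall fun ω => abs_empiricalCdf_sub_le n ω y)
  refine (integrable_prod_iff' hm.aestronglyMeasurable).2 ⟨Eventually.of_forall hi, ?_⟩
  refine (hcond.const_mul (√n)⁻¹).mono'
    hm.norm.stronglyMeasurable.integral_prod_left'.aestronglyMeasurable
    (Eventually.of_forall fun y => ?_)
  rw [Real.norm_of_nonneg (integral_nonneg fun _ => norm_nonneg _)]
  exact integral_abs_empiricalCdf_sub_le hXm hX hindep hn y

theorem ae_integrable_empiricalCdf_sub
    (hcond : Integrable fun y => √(cdf P y * (1 - cdf P y)))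
    (hXm : ∀ i, Measurable (X i)) (hX : ∀ i, HasLaw (X i) P μ) (hindep : iIndepFun X μ)
    {n : ℕ} (hn : n ≠ 0) :
    ∀ᵐ ω ∂μ, Integrable fun y => empiricalCdf X n ω y - cdf P y :=
  (integrable_prod_empiricalCdf_sub hcond hXm hX hindep hn).prod_right_ae

/-- The expected `L¹` distance of the empirical cdf to the true one is of order `n ^ (-1 / 2)`. -/
theorem integral_integral_abs_empiricalCdf_sub_le
    (hcond : Integrable fun y => √(cdf P y * (1 - cdf P y)))
    (hXm : ∀ i, Measurable (X i)) (hX : ∀ i, HasLaw (X i) P μ) (hindep : iIndepFun X μ)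
    {n : ℕ} (hn : n ≠ 0) :
    Integrable (fun ω => ∫ y, |empiricalCdf X n ω y - cdf P y|) μ ∧
      ∫ ω, (∫ y, |empiricalCdf X n ω y - cdf P y|) ∂μ ≤
        (√n)⁻¹ * ∫ y, √(cdf P y * (1 - cdf P y)) := by
  have hi := (integrable_prod_empiricalCdf_sub hcond hXm hX hindep hn).abs
  refine ⟨hi.integral_prod_left, ?_⟩
  rw [integral_integral_swap hi, ← integral_const_mul]
  exact integral_mono hi.integral_prod_right (hcond.const_mul _)
    fun y => integral_abs_empiricalCdf_sub_le hXm hX hindep hn y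

/-- The expected squared `L²` distance of the empirical cdf to the true one is of order `1 / n`. -/
theorem integral_integral_empiricalCdf_sub_sq_le
    (hcond : Integrable fun y => √(cdf P y * (1 - cdf P y)))
    (hXm : ∀ i, Measurable (X i)) (hX : ∀ i, HasLaw (X i) P μ) (hindep : iIndepFun X μ)
    {n : ℕ} (hn : n ≠ 0) :
    Integrable (fun ω => ∫ y, (empiricalCdf X n ω y - cdf P y) ^ 2) μ ∧
      ∫ ω, (∫ y, (empiricalCdf X n ω y - cdf P y) ^ 2) ∂μ ≤
        (n : ℝ)⁻¹ * ∫ y, √(cdf P y * (1 - cdf P y)) := by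
  have h := integrable_prod_empiricalCdf_sub hcond hXm hX hindep hn
  have hi : Integrable (fun z : Ω × ℝ => (empiricalCdf X n z.1 z.2 - cdf P z.2) ^ 2)
      (μ.prod volume) := by
    refine h.abs.mono' (h.1.pow 2) (Eventually.of_forall fun z => ?_)
    rw [Real.norm_eq_abs, abs_pow, sq]
    exact mul_le_of_le_one_right (abs_nonneg _) (abs_empiricalCdf_sub_le n z.1 z.2)
  refine ⟨hi.integral_prod_left, ?_⟩
  rw [integral_integral_swap hi, ← integral_const_mul]
  refine integral_mono hi.integral_prod_right (hcond.const_mul _) fun y => ?_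
  simp only
  rw [integral_empiricalCdf_sub_sq hXm hX hindep hn]
  have h0 : 0 ≤ cdf P y * (1 - cdf P y) :=
    mul_nonneg (cdf_nonneg P y) (sub_nonneg.2 (cdf_le_one P y))
  have h1 : cdf P y * (1 - cdf P y) ≤ 1 :=
    mul_le_one₀ (cdf_le_one P y) (sub_nonneg.2 (cdf_le_one P y))
      (by linarith [cdf_nonneg P y])
  gcongr
  exact Real.le_sqrt_of_sq_le (by nlinarith)

end Empirical

/-! ### Convergence in probability and in distribution -/

section Convergence

variable {Ω : Type*} [MeasurableSpace Ω] {μ : Measure Ω}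

/-- Markov's inequality as a criterion for convergence in probability to zero: it suffices to
dominate, outside sets of vanishing probability, by functions of arbitrarily small mean. -/
theorem tendstoInMeasure_zero_of_mean_bound {E : Type*} [NormedAddCommGroup E] [IsFiniteMeasure μ]
    {R : ℕ → Ω → E} (h : ∀ κ > 0, ∃ g : ℕ → Ω → ℝ, (∀ n ω, 0 ≤ g n ω) ∧
      (∀ᶠ n in atTop, Integrable (g n) μ ∧ ∫ ω, g n ω ∂μ ≤ κ) ∧
      Tendsto (fun n => μ {ω | ¬ ‖R n ω‖ ≤ g n ω}) atTop (𝓝 0)) :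
    TendstoInMeasure μ R atTop 0 := by
  rw [tendstoInMeasure_iff_norm]
  intro ε hε
  rw [ENNReal.tendsto_nhds_zero]
  intro τ hτ
  obtain ⟨κ, hκ0, hκ⟩ : ∃ κ : ℝ, 0 < κ ∧ ENNReal.ofReal κ ≤ τ / 2 := by
    rcases eq_or_ne τ ∞ with rfl | ht
    · exact ⟨1, one_pos, by simp [ENNReal.top_div]⟩
    · refine ⟨(τ / 2).toReal, ENNReal.toReal_pos (by simp [hτ.ne']) (by finiteness), ?_⟩
      rw [ENNReal.ofReal_toReal (by finiteness)]
  obtain ⟨g, hg0, hgi, hg⟩ := h (κ * ε) (by positivity)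
  have hb := (ENNReal.tendsto_nhds_zero.1 hg) (τ / 2) (ENNReal.half_pos hτ.ne')
  filter_upwards [hgi, hb] with n hn hbn
  have hM : μ {ω | ε ≤ g n ω} ≤ ENNReal.ofReal κ := by
    have := mul_meas_ge_le_integral_of_nonneg (Eventually.of_forall (hg0 n)) hn.1 ε
    rw [← ofReal_measureReal]
    refine ENNReal.ofReal_le_ofReal (le_of_mul_le_mul_left (this.trans hn.2 |>.trans_eq ?_) hε)
    ring
  calc μ {ω | ε ≤ ‖R n ω - (0 : Ω → E) ω‖}
      ≤ μ ({ω | ¬ ‖R n ω‖ ≤ g n ω} ∪ {ω | ε ≤ g n ω}) := by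
        refine measure_mono fun ω hω => ?_
        by_cases hc : ‖R n ω‖ ≤ g n ω
        · exact Or.inr (le_trans (by simpa using hω) hc)
        · exact Or.inl hc
    _ ≤ τ / 2 + τ / 2 := (measure_union_le _ _).trans (add_le_add hbn (hM.trans hκ))
    _ = τ := ENNReal.add_halves τ

/-- The multivariate central limit theorem for centred, square-integrable vectors. -/
theorem tendstoInDistribution_inv_sqrt_smul_sum [IsProbabilityMeasure μ] {ι : Type*} [Fintype ι]
    [DecidableEq ι] {V : ℕ → Ω → EuclideanSpace ℝ ι} {S : Matrix ι ι ℝ}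
    (hindep : iIndepFun V μ) (hident : ∀ i, IdentDistrib (V i) (V 0) μ μ)
    (hmem : ∀ t, MemLp (fun ω => inner ℝ t (V 0 ω)) 2 μ)
    (hmean : ∀ t, ∫ ω, inner ℝ t (V 0 ω) ∂μ = 0)
    (hcov : ∀ s t : EuclideanSpace ℝ ι,
      ∫ ω, inner ℝ s (V 0 ω) * inner ℝ t (V 0 ω) ∂μ = s ⬝ᵥ S *ᵥ t) :
    TendstoInDistribution (fun (n : ℕ) ω => (√n)⁻¹ • ∑ i ∈ Finset.range n, V i ω) atTop
      (id : EuclideanSpace ℝ ι → _) (fun _ => μ) (multivariateGaussian 0 S) := by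
  have hVm : ∀ i, AEMeasurable (V i) μ := fun i => (hident i).aemeasurable_fst
  have hWm : ∀ n : ℕ, AEMeasurable (fun ω => (√(n : ℝ))⁻¹ • ∑ i ∈ Finset.range n, V i ω)
      μ := fun n => by fun_prop
  have hS : S.PosSemidef := by
    have hsymm : S.IsHermitian := by
      ext i j
      have h1 := hcov (EuclideanSpace.single i (1 : ℝ)) (EuclideanSpace.single j (1 : ℝ))
      have h2 := hcov (EuclideanSpace.single j (1 : ℝ)) (EuclideanSpace.single i (1 : ℝ))
      simp_rw [mul_comm (inner ℝ (EuclideanSpace.single j (1 : ℝ)) _)] at h2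
      have h12 := h1.symm.trans h2
      simpa using h12.symm
    refine Matrix.PosSemidef.of_dotProduct_mulVec_nonneg hsymm fun x => ?_
    have := hcov (WithLp.toLp 2 x) (WithLp.toLp 2 x)
    simp only [star_trivial]
    refine le_of_le_of_eq (integral_nonneg fun ω => mul_self_nonneg _) this
  refine ⟨hWm, aemeasurable_id, ?_⟩
  refine ProbabilityMeasure.tendsto_iff_tendsto_charFun.2 fun t => ?_
  simp only [ProbabilityMeasure.coe_mk, Measure.map_id]
  rw [charFun_multivariateGaussian hS]
  have hm : Measurable fun v : EuclideanSpace ℝ ι => inner ℝ t v := by fun_prop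
  have hvar : Var[fun ω => inner ℝ t (V 0 ω); μ] = t ⬝ᵥ S *ᵥ t := by
    rw [variance_of_integral_eq_zero (hmem t).1.aemeasurable (hmean t), ← hcov]
    simp_rw [sq]
  have hclt := tendstoInDistribution_inv_sqrt_mul_sum_sub (P := μ) (Y := id)
    (X := fun i ω => inner ℝ t (V i ω))
    (HasLaw.id (μ := gaussianReal 0 Var[fun ω => inner ℝ t (V 0 ω); μ].toNNReal)) (hmem t)
    (hindep.comp (fun _ v => inner ℝ t v) fun _ => hm) (fun i => (hident i).comp hm)
  have hlim := ProbabilityMeasure.tendsto_iff_tendsto_charFun.1 hclt.tendsto 1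
  simp only [ProbabilityMeasure.coe_mk, Measure.map_id, charFun_gaussianReal, hmean] at hlim
  have hpos : 0 ≤ t ⬝ᵥ S *ᵥ t := hvar ▸ variance_nonneg _ _
  rw [hvar, Real.coe_toNNReal _ hpos] at hlim
  convert! hlim using 2 with n
  · have hUm : AEMeasurable (fun ω => (√(n : ℝ))⁻¹ *
        (∑ k ∈ Finset.range n, inner ℝ t (V k ω) - n * 0)) μ :=
      ((Finset.aemeasurable_fun_sum _ fun i _ =>
        hm.comp_aemeasurable (hVm i)).sub_const _).const_mul _
    rw [charFun_apply, charFun_apply_real, integral_map (hWm n) (by fun_prop),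
      integral_map hUm (by fun_prop)]
    simp only [real_inner_smul_right, inner_sum, real_inner_comm t, mul_zero, sub_zero,
      Complex.ofReal_one, one_mul]
  · simp

end Convergence

/-! ### The limit law of an asymptotically linear estimator -/

section LimitLaw

variable {ι κ : Type*}

/-- The pair `(x, ξ)` as a vector of the Euclidean space indexed by the disjoint union. -/
noncomputable def pairVec (x : EuclideanSpace ℝ ι) (ξ : EuclideanSpace ℝ κ) :
    EuclideanSpace ℝ (ι ⊕ κ) :=
  WithLp.toLp 2 (Sum.elim x ξ)

theorem continuous_pairVec :
    Continuous fun z : EuclideanSpace ℝ ι × EuclideanSpace ℝ κ => pairVec z.1 z.2 := by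
  refine (PiLp.continuous_toLp 2 fun _ : ι ⊕ κ => ℝ).comp (continuous_pi fun i => ?_)
  rcases i with i | i
  · exact (EuclideanSpace.proj (𝕜 := ℝ) i).continuous.comp continuous_fst
  · exact (EuclideanSpace.proj (𝕜 := ℝ) i).continuous.comp continuous_snd

variable [Fintype ι] [Fintype κ]

theorem norm_pairVec_le (x : EuclideanSpace ℝ ι) (ξ : EuclideanSpace ℝ κ) :
    ‖pairVec x ξ‖ ≤ ‖x‖ + ‖ξ‖ := by
  refine abs_le_of_sq_le_sq' ?_ (by positivity) |>.2
  rw [EuclideanSpace.real_norm_sq_eq, Fintype.sum_sum_type]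
  simp only [pairVec, Sum.elim_inl, Sum.elim_inr]
  rw [← EuclideanSpace.real_norm_sq_eq, ← EuclideanSpace.real_norm_sq_eq]
  nlinarith [norm_nonneg x, norm_nonneg ξ]

/-- Replaces the score `z` by its leading term `w` in the linear representation of an estimator and
its multiplier. -/
theorem norm_smul_pairVec_sub_le [DecidableEq κ] {A : Matrix ι κ ℝ} {D : Matrix κ κ ℝ}
    {x : EuclideanSpace ℝ ι} {ξ z w : EuclideanSpace ℝ κ} {r a b : ℝ} (hr : 0 ≤ r)
    (h₁ : ‖x - matCLM A z‖ + ‖ξ + matCLM D z‖ ≤ a) (h₂ : ‖z - w‖ ≤ b) :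
    ‖r • pairVec x ξ - r • matCLM (-Matrix.fromRows (-A) D) w‖ ≤
      r * (a + ‖matCLM (-Matrix.fromRows (-A) D)‖ * b) := by
  set B : Matrix (ι ⊕ κ) κ ℝ := -Matrix.fromRows (-A) D with hB
  have hR : pairVec x ξ - matCLM B w =
      pairVec (x - matCLM A z) (ξ + matCLM D z) + matCLM B (z - w) := by
    rw [map_sub]
    have : pairVec x ξ = pairVec (x - matCLM A z) (ξ + matCLM D z) + matCLM B z := by
      ext i
      rcases i with i | i <;> simp [pairVec, matCLM_apply, hB]
    rw [this]
    abel
  rw [← smul_sub, norm_smul, Real.norm_of_nonneg hr, hR]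
  gcongr
  refine (norm_add_le _ _).trans (add_le_add ((norm_pairVec_le _ _).trans h₁) ?_)
  refine ((matCLM B).le_opNorm _).trans ?_
  gcongr

variable {Ω : Type*} {X : ℕ → Ω → ℝ} {P : Measure ℝ}

/-- The normalised sum of influence functions is a linear functional of the empirical process. -/
theorem inv_sqrt_smul_sum_influence {E F : Type*} [NormedAddCommGroup E] [NormedSpace ℝ E]
    [NormedAddCommGroup F] [NormedSpace ℝ F] (T : E →L[ℝ] F) {k : ℝ → E} {n : ℕ} (hn : n ≠ 0)
    {ω : Ω} (hw : ∀ i, Integrable fun y => cdfResidual P (X i ω) y • k y) :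
    (√(n : ℝ))⁻¹ • ∑ i ∈ Finset.range n, T (influence P k (X i ω)) =
      √(n : ℝ) • T (∫ y, (empiricalCdf X n ω y - cdf P y) • k y) := by
  have hsn : (√(n : ℝ))⁻¹ = √(n : ℝ) * (n : ℝ)⁻¹ := by
    have hs : √(n : ℝ) ≠ 0 := Real.sqrt_ne_zero'.2 (Nat.cast_pos.2 (Nat.pos_of_ne_zero hn))
    nth_rewrite 3 [← Real.mul_self_sqrt (Nat.cast_nonneg n)]
    field_simp
  simp_rw [empiricalCdf_sub_cdf (P := P) hn, mul_smul, Finset.sum_smul, influence]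
  rw [integral_smul, integral_finsetSum _ fun i _ => hw i, hsn, mul_smul, map_smul, map_sum]

variable [MeasurableSpace Ω] {μ : Measure Ω}

theorem tendsto_measure_zero_of_subset {f : ℕ → Set Ω} {N g₁ g₂ g₃ : ℕ → Set Ω}
    (hN : ∀ᶠ n in atTop, μ (N n) = 0) (h₁ : Tendsto (fun n => μ (g₁ n)) atTop (𝓝 0))
    (h₂ : Tendsto (fun n => μ (g₂ n)) atTop (𝓝 0)) (h₃ : Tendsto (fun n => μ (g₃ n)) atTop (𝓝 0))
    (hf : ∀ᶠ n in atTop, f n ⊆ N n ∪ (g₁ n ∪ (g₂ n ∪ g₃ n))) :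
    Tendsto (fun n => μ (f n)) atTop (𝓝 0) := by
  have hlim := h₁.add (h₂.add h₃)
  rw [add_zero, add_zero] at hlim
  refine tendsto_of_tendsto_of_tendsto_of_le_of_le' tendsto_const_nhds hlim
    (Eventually.of_forall fun n => zero_le) ?_
  filter_upwards [hN, hf] with n hn hfn
  calc μ (f n) ≤ μ (N n) + μ (g₁ n ∪ (g₂ n ∪ g₃ n)) :=
        (measure_mono hfn).trans (measure_union_le _ _)
    _ ≤ 0 + (μ (g₁ n) + (μ (g₂ n) + μ (g₃ n))) := by
        rw [hn]
        gcongr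
        refine (measure_union_le _ _).trans ?_
        gcongr
        exact measure_union_le _ _
    _ = _ := zero_add _

theorem integral_inner_mul_inner {Y : Ω → EuclideanSpace ℝ κ} {S : Matrix κ κ ℝ}
    (hi : ∀ i j, Integrable (fun ω => Y ω i * Y ω j) μ)
    (hS : ∀ i j, ∫ ω, Y ω i * Y ω j ∂μ = S i j) (a b : EuclideanSpace ℝ κ) :
    ∫ ω, inner ℝ a (Y ω) * inner ℝ b (Y ω) ∂μ = a ⬝ᵥ S *ᵥ b := by
  simp only [PiLp.inner_apply, RCLike.inner_apply, conj_trivial, dotProduct, Matrix.mulVec]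
  simp_rw [Finset.sum_mul_sum]
  have hi' : ∀ i j, Integrable (fun ω => Y ω i * a i * (Y ω j * b j)) μ := fun i j =>
    ((hi i j).const_mul (a i * b j)).congr (Eventually.of_forall fun ω => by ring)
  rw [integral_finsetSum _ fun i _ => integrable_finsetSum _ fun j _ => hi' i j]
  refine Finset.sum_congr rfl fun i _ => ?_
  rw [integral_finsetSum _ fun j _ => hi' i j, Finset.mul_sum]
  refine Finset.sum_congr rfl fun j _ => ?_
  calc _ = ∫ ω, a i * b j * (Y ω i * Y ω j) ∂μ :=
        integral_congr_ae (Eventually.of_forall fun ω => by ring)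
    _ = _ := by
      rw [integral_const_mul, hS]
      ring

variable [IsProbabilityMeasure P]

theorem ae_influence_apply (hcond : Integrable fun y => √(cdf P y * (1 - cdf P y)))
    {k : ℝ → EuclideanSpace ℝ κ} (hk : Measurable k) {C : ℝ} (hkC : ∀ y, ‖k y‖ ≤ C) :
    ∀ᵐ x ∂P, ∀ i, influence P k x i = influence P (fun y => k y i) x := by
  filter_upwards [ae_integrable_cdfResidual hcond] with x hx i
  exact ((EuclideanSpace.proj (𝕜 := ℝ) i).integral_comp_comm
    (hx.smul_bdd C hk.aestronglyMeasurable (Eventually.of_forall hkC))).symm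

variable [IsProbabilityMeasure μ] [DecidableEq ι] [DecidableEq κ]

/-- The central limit theorem for a linear image of the influence function. -/
theorem tendstoInDistribution_influence
    (hcond : Integrable fun y => √(cdf P y * (1 - cdf P y)))
    (hX : ∀ i, HasLaw (X i) P μ) (hindep : iIndepFun X μ)
    {k : ℝ → EuclideanSpace ℝ κ} (hk : Measurable k) {C : ℝ} (hkC : ∀ y, ‖k y‖ ≤ C)
    {S : Matrix κ κ ℝ} (hS : ∀ i j,
      ∫ y, ∫ z, (cdf P (min y z) - cdf P y * cdf P z) * k y i * k z j = S i j)
    (B : Matrix ι κ ℝ) :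
    TendstoInDistribution
      (fun (n : ℕ) ω => (√n)⁻¹ • ∑ i ∈ Finset.range n, matCLM B (influence P k (X i ω))) atTop
      (id : EuclideanSpace ℝ ι → _) (fun _ => μ) (multivariateGaussian 0 (B * S * Bᵀ)) := by
  have hYm : Measurable (influence P k) := measurable_influence hk
  have hki : ∀ i, Measurable fun y => k y i := fun i => by fun_prop
  have hkiC : ∀ i y, |k y i| ≤ C := fun i y => (PiLp.norm_apply_le _ i).trans (hkC y)
  have hae := ae_influence_apply hcond hk hkC
  have hi : ∀ i j, Integrable (fun x => influence P k x i * influence P k x j) P := fun i j =>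
    (integrable_influence_mul hcond (hki i) (hki j) (hkiC i) (hkiC j)).congr
      (hae.mono fun x hx => by simp only [hx])
  have hcov : ∀ i j, ∫ x, influence P k x i * influence P k x j ∂P = S i j := fun i j => by
    rw [← hS, ← integral_influence_mul hcond (hki i) (hki j) (hkiC i) (hkiC j)]
    exact integral_congr_ae (hae.mono fun x hx => by simp only [hx])
  have hYL : ∀ i, MemLp (fun x => influence P k x i) 2 P := fun i => by
    refine (memLp_two_iff_integrable_sq (by fun_prop)).2 ?_
    simpa only [sq] using hi i i
  have hY0 : ∀ i, ∫ x, influence P k x i ∂P = 0 := fun i => by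
    rw [← integral_influence hcond (hki i) (hkiC i)]
    exact integral_congr_ae (hae.mono fun x hx => by simp only [hx])
  have hBm : Measurable fun x => matCLM B (influence P k x) :=
    (matCLM B).continuous.measurable.comp hYm
  have hin : ∀ (t : EuclideanSpace ℝ ι) x, inner ℝ t (matCLM B (influence P k x)) =
      ∑ j, influence P k x j * (matCLM Bᵀ t) j := fun t x => by
    rw [inner_matCLM]
    simp [PiLp.inner_apply]
  have htL : ∀ t : EuclideanSpace ℝ ι,
      MemLp (fun x => inner ℝ t (matCLM B (influence P k x))) 2 P := fun t => by
    simp only [hin]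
    exact memLp_finsetSum _ fun j _ => (hYL j).mul_const _
  refine tendstoInDistribution_inv_sqrt_smul_sum
    (V := fun i ω => matCLM B (influence P k (X i ω))) ?_ (fun i => ?_) (fun t => ?_)
    (fun t => ?_) (fun s t => ?_)
  · exact hindep.comp (fun _ x => matCLM B (influence P k x)) fun _ => hBm
  · exact ((hX i).identDistrib (hX 0)).comp hBm
  · have : MemLp (fun x => inner ℝ t (matCLM B (influence P k x))) 2 (μ.map (X 0)) := by
      rw [(hX 0).map_eq]
      exact htL t
    exact (memLp_map_measure_iff this.1 (hX 0).aemeasurable).1 this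
  · refine ((hX 0).integral_comp (f := fun x => inner ℝ t (matCLM B (influence P k x)))
      (htL t).1).trans ?_
    simp only [hin]
    rw [integral_finsetSum _ fun j _ => ((hYL j).integrable one_le_two).mul_const _]
    simp [integral_mul_const, hY0]
  · refine ((hX 0).integral_comp (f := fun x => inner ℝ s (matCLM B (influence P k x)) *
      inner ℝ t (matCLM B (influence P k x))) ((htL s).1.mul (htL t).1)).trans ?_
    simp only [inner_matCLM]
    rw [integral_inner_mul_inner hi hcov]
    have h : ∀ v : EuclideanSpace ℝ ι, (matCLM Bᵀ v).ofLp = Bᵀ *ᵥ v.ofLp := fun v => by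
      ext i
      exact matCLM_apply _ _ _
    rw [h, h, Matrix.mulVec_mulVec, Matrix.mulVec_transpose, ← Matrix.dotProduct_mulVec,
      Matrix.mulVec_mulVec, Matrix.mul_assoc]

/-- The limit law of an estimator that depends on the sample through a functional `Z` of the
empirical cdf: if `Z` is differentiable at the true cdf, with derivative `G ↦ ∫ G k`, and the
estimator is asymptotically linear in `Z`, then the estimator is asymptotically normal. -/
theorem tendstoInDistribution_of_asymptotic_linearity
    (hcond : Integrable fun y => √(cdf P y * (1 - cdf P y)))
    (hXm : ∀ i, Measurable (X i)) (hX : ∀ i, HasLaw (X i) P μ) (hindep : iIndepFun X μ)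
    {k : ℝ → EuclideanSpace ℝ κ} (hk : Measurable k) {C : ℝ} (hkC : ∀ y, ‖k y‖ ≤ C)
    {S : Matrix κ κ ℝ} (hS : ∀ i j,
      ∫ y, ∫ z, (cdf P (min y z) - cdf P y * cdf P z) * k y i * k z j = S i j)
    {Z : (ℝ → ℝ) → EuclideanSpace ℝ κ} {M : ℝ} (hM : 0 ≤ M)
    (hZ : ∀ δ F, IsNear (cdf P) δ F → ‖Z F‖ ≤ M * ∫ y, |F y - cdf P y| ∧
      ‖Z F - ∫ y, (F y - cdf P y) • k y‖ ≤ M * ∫ y, (F y - cdf P y) ^ 2)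
    {est : (ℝ → ℝ) → EuclideanSpace ℝ ι → EuclideanSpace ℝ κ → Prop}
    {A : Matrix ι κ ℝ} {D : Matrix κ κ ℝ} {p₀ : EuclideanSpace ℝ ι}
    (hlin : ∀ η > 0, ∃ δ > 0, ∀ F, IsNear (cdf P) δ F → ∀ p ξ, ‖p - p₀‖ < δ → ‖ξ‖ < δ →
      est F p ξ → ‖p - p₀ - matCLM A (Z F)‖ + ‖ξ + matCLM D (Z F)‖ ≤ η * ‖Z F‖)
    {ph : ℕ → Ω → EuclideanSpace ℝ ι} {xh : ℕ → Ω → EuclideanSpace ℝ κ}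
    (hph : ∀ n, AEMeasurable (ph n) μ) (hxh : ∀ n, AEMeasurable (xh n) μ)
    (hest : Tendsto (fun n => μ {ω | ¬ est (empiricalCdf X n ω) (ph n ω) (xh n ω)}) atTop (𝓝 0))
    (hcons : TendstoInMeasure μ (fun n ω => (ph n ω, xh n ω)) atTop (fun _ => (p₀, 0))) :
    TendstoInDistribution
      (fun (n : ℕ) ω => √(n : ℝ) • pairVec (ph n ω - p₀) (xh n ω))
      atTop (id : EuclideanSpace ℝ (ι ⊕ κ) → _) (fun _ => μ)
      (multivariateGaussian 0
        (Matrix.fromRows (-A) D * S * (Matrix.fromRows (-A) D)ᵀ)) := by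
  set B : Matrix (ι ⊕ κ) κ ℝ := -Matrix.fromRows (-A) D with hB
  have hBS : Matrix.fromRows (-A) D * S * (Matrix.fromRows (-A) D)ᵀ = B * S * Bᵀ := by
    rw [hB, Matrix.transpose_neg, Matrix.neg_mul, Matrix.neg_mul, Matrix.mul_neg, neg_neg]
  have hpm : ∀ n : ℕ, AEMeasurable (fun ω => √(n : ℝ) • pairVec (ph n ω - p₀) (xh n ω)) μ := by
    intro n
    have hc : Continuous fun z : EuclideanSpace ℝ ι × EuclideanSpace ℝ κ =>
        pairVec (z.1 - p₀) z.2 :=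
      continuous_pairVec.comp (f := fun z : EuclideanSpace ℝ ι × EuclideanSpace ℝ κ =>
        (z.1 - p₀, z.2)) (by fun_prop)
    have hm := hc.measurable.comp_aemeasurable ((hph n).prodMk (hxh n))
    exact hm.const_smul (√(n : ℝ))

  rw [hBS]
  refine tendstoInDistribution_of_tendstoInMeasure_sub _ _
    (tendstoInDistribution_influence hcond hX hindep hk hkC hS B) ?_ hpm
  set I := ∫ y, √(cdf P y * (1 - cdf P y)) with hI
  have hI0 : 0 ≤ I := integral_nonneg fun y => Real.sqrt_nonneg _
  set d1 : ℕ → Ω → ℝ := fun n ω => ∫ y, |empiricalCdf X n ω y - cdf P y| with hd1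
  set d2 : ℕ → Ω → ℝ := fun n ω => ∫ y, (empiricalCdf X n ω y - cdf P y) ^ 2 with hd2
  have hd10 : ∀ n ω, 0 ≤ d1 n ω := fun n ω => integral_nonneg fun y => abs_nonneg _
  have hd20 : ∀ n ω, 0 ≤ d2 n ω := fun n ω => integral_nonneg fun y => sq_nonneg _
  have hne : ∀ᶠ n : ℕ in atTop, n ≠ 0 := eventually_ne_atTop 0
  have hinv : Tendsto (fun n : ℕ => (√(n : ℝ))⁻¹) atTop (𝓝 0) :=
    tendsto_inv_atTop_zero.comp (Real.tendsto_sqrt_atTop.comp tendsto_natCast_atTop_atTop)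
  -- the empirical cdf converges to the true one in mean
  have hd1lim : TendstoInMeasure μ d1 atTop 0 := by
    refine tendstoInMeasure_zero_of_mean_bound fun τ hτ => ⟨d1, hd10, ?_, ?_⟩
    · have := hinv.mul_const I
      rw [zero_mul] at this
      filter_upwards [hne, this.eventually_lt_const hτ] with n hn hlt
      have h := integral_integral_abs_empiricalCdf_sub_le hcond hXm hX hindep hn
      exact ⟨h.1, h.2.trans hlt.le⟩
    · simp [Real.norm_of_nonneg (hd10 _ _)]
  refine tendstoInMeasure_zero_of_mean_bound fun τ hτ => ?_
  set η := τ / (2 * (M * I + 1)) with hη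
  have hη0 : 0 < η := by positivity
  have hηI : η * M * I ≤ τ / 2 := by
    rw [hη, mul_assoc, div_mul_eq_mul_div, div_le_div_iff₀ (by positivity) (by positivity)]
    nlinarith [mul_nonneg hM hI0]
  obtain ⟨δ, hδ, hmain⟩ := hlin η hη0
  refine ⟨fun n ω => η * M * (√n * d1 n ω) + ‖matCLM B‖ * M * (√n * d2 n ω),
    fun n ω => ?_, ?_, ?_⟩
  · have := hd10 n ω
    have := hd20 n ω
    positivity
  · have := hinv.mul_const (‖matCLM B‖ * M * I)
    rw [zero_mul] at this
    filter_upwards [hne, this.eventually_le_const (half_pos hτ)] with n hn hlt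
    have hs : √(n : ℝ) ≠ 0 := Real.sqrt_ne_zero'.2 (Nat.cast_pos.2 (Nat.pos_of_ne_zero hn))
    have hsn : (√(n : ℝ)) * (n : ℝ)⁻¹ = (√(n : ℝ))⁻¹ := by
      nth_rewrite 2 [← Real.mul_self_sqrt (Nat.cast_nonneg n)]
      field_simp
    have h1 := integral_integral_abs_empiricalCdf_sub_le hcond hXm hX hindep hn
    have h2 := integral_integral_empiricalCdf_sub_sq_le hcond hXm hX hindep hn
    have i1 : Integrable (fun ω => η * M * (√n * d1 n ω)) μ := (h1.1.const_mul _).const_mul _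
    have i2 : Integrable (fun ω => ‖matCLM B‖ * M * (√n * d2 n ω)) μ :=
      (h2.1.const_mul _).const_mul _
    refine ⟨i1.add i2, ?_⟩
    rw [integral_add i1 i2]
    simp only [integral_const_mul]
    calc _ ≤ η * M * (√n * ((√n)⁻¹ * I)) + ‖matCLM B‖ * M * (√n * ((n : ℝ)⁻¹ * I)) := by
          gcongr
          exacts [h1.2, h2.2]
      _ = η * M * I + (√n)⁻¹ * (‖matCLM B‖ * M * I) := by
          rw [← mul_assoc (√(n : ℝ)), mul_inv_cancel₀ hs, ← mul_assoc (√(n : ℝ)), hsn]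
          ring
      _ ≤ τ := by linarith
  · have hc := tendstoInMeasure_iff_norm.1 hcons δ hδ
    have hd := tendstoInMeasure_iff_norm.1 hd1lim δ hδ
    refine tendsto_measure_zero_of_subset (N := fun n => {ω | ¬ ((Integrable fun y =>
      empiricalCdf X n ω y - cdf P y) ∧ ∀ i, Integrable fun y => cdfResidual P (X i ω) y)})
      ?_ hest hc hd ?_
    · filter_upwards [hne] with n hn
      have hw : ∀ᵐ ω ∂μ, ∀ i, Integrable fun y => cdfResidual P (X i ω) y :=
        ae_all_iff.2 fun i => ae_of_ae_map (hX i).aemeasurable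
          (by rw [(hX i).map_eq]; exact ae_integrable_cdfResidual hcond)
      exact (ae_integrable_empiricalCdf_sub hcond hXm hX hindep hn).and hw
    · filter_upwards [hne] with n hn ω hω
      by_contra hcon
      simp only [Set.mem_union, Set.mem_ofPred_eq, not_or, not_not, not_le] at hcon hω
      obtain ⟨⟨hint, hw⟩, hest', hnear, hdn⟩ := hcon
      refine hω.not_ge ?_
      rw [Prod.mk_sub_mk, sub_zero, Prod.norm_mk, max_lt_iff] at hnear
      simp only [Pi.zero_apply, sub_zero, Real.norm_of_nonneg (hd10 n ω)] at hdn
      have hF : IsNear (cdf P) δ (empiricalCdf X n ω) :=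
        ⟨measurable_empiricalCdf n ω, empiricalCdf_mem_Icc n ω, hint, hdn.le⟩
      have e1 := hmain _ hF _ _ hnear.1 hnear.2 hest'
      obtain ⟨e2, e3⟩ := hZ δ _ hF
      have e4 := norm_smul_pairVec_sub_le (Real.sqrt_nonneg (n : ℝ))
        (e1.trans (mul_le_mul_of_nonneg_left e2 hη0.le)) e3
      simp only [Pi.sub_apply]
      rw [inv_sqrt_smul_sum_influence (matCLM B) hn fun i =>
        (hw i).smul_bdd C hk.aestronglyMeasurable (Eventually.of_forall hkC)]
      refine e4.trans_eq ?_
      simp only [hd1, hd2, hB]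
      ring

end LimitLaw

/-! ### Asymptotic normality of the estimator -/

/-- The matrix `Σ` is the covariance kernel of the indicator process, integrated against the
derivative of `F ↦ K ∘ F₀`. -/
theorem integral_integral_eq_matSigma {d s : ℕ} (ℓ : ℕ)
    (P₁ : EuclideanSpace ℝ (Fin d) → Measure ℝ) (FT : ℝ → ℝ) (p : Param d s) (i j : Fin (ℓ - 1)) :
    ∫ y, ∫ z, (FT (min y z) - FT y * FT z) *
      ((1 / (1 - p.lam)) • vecL ℓ (F0 P₁ FT p y)) i *
      ((1 / (1 - p.lam)) • vecL ℓ (F0 P₁ FT p z)) j = matSigma P₁ FT p ℓ i j := by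
  rw [matSigma, Matrix.of_apply, ← integral_const_mul]
  refine integral_congr_ae (Eventually.of_forall fun y => ?_)
  simp only
  rw [← integral_const_mul]
  refine integral_congr_ae (Eventually.of_forall fun z => ?_)
  simp only [PiLp.smul_apply, smul_eq_mul, vecL, ← one_div_pow]
  ring

end LMomentMixture

open LMomentMixture
theorem mainTheorem3
    -- dimensions and the divergence
    {d s ℓ : ℕ} (hℓ : 2 ≤ ℓ)
    (φ : ℝ → ℝ≥0∞) (hφ : LMomentMixture.IsDivergenceGenerator φ)
    (ψ : ℝ → ℝ) (hψ : ∀ t, LMomentMixture.fenchelLegendre φ t = (ψ t : EReal))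
    (hψC2 : ContDiff ℝ 2 ψ) (hψ'' : iteratedDeriv 2 ψ 0 = 1)
    -- the parametric component, the constraints and the parameter space
    (Θ : Set (EuclideanSpace ℝ (Fin d))) (A : Set (EuclideanSpace ℝ (Fin s)))
    (P₁ : EuclideanSpace ℝ (Fin d) → Measure ℝ)
    (hP₁ : ∀ θ ∈ Θ, IsProbabilityMeasure (P₁ θ))
    (hP₁mean : ∀ θ ∈ Θ, Integrable (fun x : ℝ => x) (P₁ θ))
    (m : EuclideanSpace ℝ (Fin s) → EuclideanSpace ℝ (Fin (ℓ - 1)))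
    (Φ : Set (LMomentMixture.Param d s))
    (hΦ : ∀ p ∈ Φ, p.lam ∈ Set.Ioo (0 : ℝ) 1 ∧ p.theta ∈ Θ ∧ p.alpha ∈ A)
    -- the true mixture
    (pstar : LMomentMixture.Param d s)
    (PT P₀ : Measure ℝ) [IsProbabilityMeasure PT] [IsProbabilityMeasure P₀]
    (hmix : PT = ENNReal.ofReal pstar.lam • P₁ pstar.theta
      + ENNReal.ofReal (1 - pstar.lam) • P₀)
    (hP₀ : LMomentMixture.quantileMeasure P₀ ∈
      LMomentMixture.constraintSet ℓ (m pstar.alpha) (LMomentMixture.quantileMeasure P₀))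
    -- the sample
    {Ω : Type*} [MeasurableSpace Ω] (μ : Measure Ω) [IsProbabilityMeasure μ]
    (X : ℕ → Ω → ℝ) (hX : ∀ i, HasLaw (X i) PT μ) (hindep : iIndepFun X μ)
    (hXmean : ∀ i, Integrable (X i) μ)
    (hcond1 : Integrable (fun y : ℝ => √(cdf PT y * (1 - cdf PT y))))
    (hcond2 : Integrable (fun z : ℝ × ℝ =>
      cdf PT (min z.1 z.2) - cdf PT z.1 * cdf PT z.2))
    -- the estimator and the associated argsup
    (phihat : ℕ → Ω → LMomentMixture.Param d s)
    (xihat : ℕ → Ω → EuclideanSpace ℝ (Fin (ℓ - 1)))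
    (hphihat : ∀ n, AEMeasurable (phihat n) μ) (hxihat : ∀ n, AEMeasurable (xihat n) μ)
    (hest : Tendsto (fun n => μ {ω | ¬ LMomentMixture.IsEstimate Φ ψ P₁ m
      (LMomentMixture.empiricalCdf X n ω) (phihat n ω) (xihat n ω)}) atTop (𝓝 0))
    (hcons : TendstoInMeasure μ (fun n ω => (phihat n ω, xihat n ω)) atTop
      (fun _ => (pstar, 0)))
    (hint : pstar ∈ interior Φ)
    (hm : ContDiffOn ℝ 2 m A)
    -- regularity of the parametric cdf near the true value
    (hF₁ : ∀ᶠ θ in 𝓝 pstar.theta, ∀ y : ℝ,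
      DifferentiableAt ℝ (fun t => cdf (P₁ t) y) θ ∧
      DifferentiableAt ℝ (gradient (fun t => cdf (P₁ t) y)) θ)
    (hB₁ : ∃ B₁ : ℝ → ℝ, Integrable B₁ ∧ ∀ᶠ θ in 𝓝 pstar.theta, ∀ y : ℝ,
      ‖gradient (fun t => cdf (P₁ t) y) θ‖ ≤ B₁ y)
    (hB₂ : ∃ B₂₁ B₂₂ : ℝ → ℝ, Integrable B₂₁ ∧ Integrable B₂₂ ∧
      ∀ᶠ θ in 𝓝 pstar.theta, ∀ y : ℝ,
        ‖InnerProductSpace.rankOne ℝ (gradient (fun t => cdf (P₁ t) y) θ)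
          (gradient (fun t => cdf (P₁ t) y) θ)‖ ≤ B₂₂ y ∧
        ‖fderiv ℝ (gradient (fun t => cdf (P₁ t) y)) θ‖ ≤ B₂₁ y)
    (hdiff : Integrable (fun y : ℝ => cdf PT y - cdf (P₁ pstar.theta) y))
    -- invertibility
    (hJxixi : IsUnit (LMomentMixture.matJxixi P₁ (cdf PT) pstar ℓ))
    (hInfo : IsUnit (LMomentMixture.matInfo P₁ m (cdf PT) pstar)) :
    TendstoInDistribution
      (fun (n : ℕ) ω => WithLp.toLp 2 (Sum.elim
        (fun i => √(n : ℝ) * (phihat n ω i - pstar i))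
        (fun j => √(n : ℝ) * xihat n ω j)))
      atTop (id : EuclideanSpace ℝ (LMomentMixture.ParamIdx d s ⊕ Fin (ℓ - 1)) → _)
      (fun _ => μ)
      (multivariateGaussian 0 (LMomentMixture.asymptoticCov P₁ m (cdf PT) pstar)) := by
  obtain ⟨⟨hlam0, hlam1⟩, hθ, -⟩ := hΦ _ (interior_subset hint)
  have := hP₁ _ hθ
  have hψ0 := apply_zero_of_fenchelLegendre hφ.apply_one hψ
  have hψ1 := deriv_zero_of_fenchelLegendre hφ.apply_one hψ (hψC2.differentiable (by norm_num))
  have hA := alpha_mem_nhds (fun p hp => (hΦ p hp).2.2) hint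
  obtain ⟨B₁, hi₁, hB₁⟩ := hB₁
  obtain ⟨B₂, _, hi₂, -, hB₂⟩ := hB₂
  have hFT : Measurable (cdf PT) := (monotone_cdf PT).measurable
  have hFT01 : ∀ y, 0 ≤ cdf PT y ∧ cdf PT y ≤ 1 := fun y => ⟨cdf_nonneg PT y, cdf_le_one PT y⟩
  -- the true parameter satisfies the L-moment constraints
  have hF0 : F0 P₁ (cdf PT) pstar = cdf P₀ := funext (F0_eq_cdf_of_mixture hlam0 hlam1 hmix)
  have hvecK : Continuous (vecK ℓ) :=
    continuous_iff_continuousAt.2 fun t => (hasDerivAt_vecK ℓ t).continuousAt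
  obtain ⟨hki, hkm⟩ := integral_comp_cdf (P := P₀) hvecK (vecK_zero ℓ) (vecK_one ℓ) hP₀.2.2.1
  rw [hP₀.2.2.2] at hkm
  simp only [← hF0] at hki hkm
  -- the weight function of the empirical process
  obtain ⟨C, hC⟩ := (isCompact_Icc (a := (0 : ℝ)) (b := 1)).exists_bound_of_continuousOn
    (contDiff_vecL ℓ).continuous.continuousOn
  have hLC : ∀ y, ‖(1 / (1 - pstar.lam)) • vecL ℓ (F0 P₁ (cdf PT) pstar y)‖ ≤
      ‖1 / (1 - pstar.lam)‖ * C := fun y => by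
    rw [norm_smul, hF0]
    gcongr
    exact hC _ ⟨cdf_nonneg P₀ y, cdf_le_one P₀ y⟩
  have hLm : Measurable fun y => (1 / (1 - pstar.lam)) • vecL ℓ (F0 P₁ (cdf PT) pstar y) :=
    ((contDiff_vecL ℓ).continuous.measurable.comp (measurable_F0 hFT pstar)).const_smul
      (1 / (1 - pstar.lam))
  obtain ⟨M, hM, hexp⟩ := exists_integral_vecK_expansion ℓ hFT hFT01 hki
  rw [hkm] at hexp
  -- measurable versions of the observations
  set X' : ℕ → Ω → ℝ := fun i => (hX i).aemeasurable.mk (X i) with hX'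
  have hXX' : ∀ i, X i =ᵐ[μ] X' i := fun i => (hX i).aemeasurable.ae_eq_mk
  have hemp : ∀ᵐ ω ∂μ, ∀ n, empiricalCdf X n ω = empiricalCdf X' n ω := by
    filter_upwards [ae_all_iff.2 hXX'] with ω hω n
    ext y
    simp only [empiricalCdf, hω]
  have key := tendstoInDistribution_of_asymptotic_linearity (X := X') (ph := phihat) (xh := xihat)
    (p₀ := pstar)
    (Z := fun F => (∫ y, vecK ℓ (F0 P₁ F pstar y)) - m pstar.alpha)
    (est := IsEstimate Φ ψ P₁ m) (A := matH P₁ m (cdf PT) pstar) (D := matP P₁ m (cdf PT) pstar)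
    hcond1 (fun i => (hX i).aemeasurable.measurable_mk) (fun i => (hX i).congr (hXX' i).symm)
    (hindep.congr hXX') hLm hLC (integral_integral_eq_matSigma ℓ P₁ (cdf PT) pstar) hM
    (fun δ F hF => by simpa only [smul_smul, mul_comm] using hexp δ F hF)
    (fun η hη => exists_asymptotic_linearity hψC2 hψ0 hψ1 hψ''
      (convexOn_of_fenchelLegendre hψ) hFT hFT01 hlam1 hint (hm.contDiffAt hA) hF₁ hi₁ hB₁ hi₂
      (hB₂.mono fun θ hθ y => (hθ y).2) hdiff hki hJxixi hInfo hη)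
    hphihat hxihat ?_ hcons
  · have hvec : ∀ (n : ℕ) ω, √(n : ℝ) • pairVec (phihat n ω - pstar) (xihat n ω) =
        WithLp.toLp 2 (Sum.elim (fun i => √(n : ℝ) * (phihat n ω i - pstar i))
          (fun j => √(n : ℝ) * xihat n ω j)) := fun n ω => by
      ext i
      rcases i with i | i <;> simp [pairVec]
    simp only [hvec] at key
    exact key
  · refine hest.congr fun n => measure_congr ?_
    filter_upwards [hemp] with ω hω
    exact congrArg (fun F => ¬ IsEstimate Φ ψ P₁ m F (phihat n ω) (xihat n ω)) (hω n)
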